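/- Let $\mathbb K\in\{\mathbb R,\mathbb C\}$ and let $A_1\subseteq A_2\subseteq\cdots$ be an ascending sequence of unital associative Banach algebras over $\mathbb K$ such that each inclusion map $A_n\to A_{n+1}$ is a continuous homomorphism of unital algebras. Give $A:=\bigcup_{n}A_n$ the locally convex direct limit topology, i.e. the finest (not necessarily Hausdorff) locally convex vector topology making all inclusions $A_n\to A$ continuous, and give all unit groups the topology induced by the respective algebra. Then the following holds. (a) $A$ is a locally m-convex topological algebra (its vector topology is defined by a family of submultiplicative seminorms). Its unit group $A^\times=\bigcup_n A_n^\times$ is open in $A$, and it is a topological group with the topology induced by $A$. (b) $A^\times=\varinjlim A_n^\times$ in the category of (not necessarily Hausdorff) topological groups and continuous homomorphisms. (c) Product sets are large in $A^\times=\bigcup_n A_n^\times$: the product map $$\pi\colon {\prod_{n}}^{*}A_n^\times\to A^\times,\qquad (g_n)_n\mapsto g_1g_2\cdots g_N\quad\text{if } g_n=1\text{ for all } n>N,$$ on the weak direct product (the group of families with $g_n=1$ for all but finitely many $n$, with the box topology) takes identity neighbourhoods to identity neighbourhoods. Moreover, $(A_n^\times)_n$ satisfies the "passing through assumption" (PTA):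 each $A_n^\times$ has a basis of symmetric identity neighbourhoods $U$ such that, for each $m>n$ and each identity neighbourhood $V\subseteq A_m^\times$, there exists an identity neighbourhood $W\subseteq A_m^\times$ with $WU\subseteq UV$. If each inclusion $A_n\to A_{n+1}$ is a topological embedding, then $A$ is Hausdorff. If $A$ is Hausdorff, then the open set $A^\times\subseteq A$, with the inclusion $A^\times\to A$ as a global chart, is a $\mathbb K$-analytic Lie group modelled on the locally convex space $A$, and $A^\times=\varinjlim A_n^\times$ in the category of $C^\infty_{\mathbb K}$-Lie groups modelled on Hausdorff locally convex $\mathbb K$-vector spaces and $C^\infty_{\mathbb K}$-homomorphisms (each $A_n^\times$ being considered as an open subset of $A_n$). Here a map $f\colon U\to F$ from an open subset of a Hausdorff locally convex space $E$ to a Hausdorff locally convex space $F$ is $C^\infty_{\mathbb K}$ if it is continuous and, for all $k\ge 1$, the iterated directional derivatives $D_{y_1}\cdots D_{y_k}f(x)$ over $\mathbb K$ exist for all $x\in U$ and $y_1,\dots,y_k\in E$ and are continuous in $(x,y_1,\dots,y_k)\in U\times E^k$. It is complex analytic (for $\mathbb K=\mathbb C$) if it is continuous and locally given by a pointwise convergent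 series of continuous homogeneous polynomials, and real analytic (for $\mathbb K=\mathbb R$) if it extends to a complex analytic map between open subsets of the complexifications of $E$ and $F$. -/

import Mathlib

open Filter Topology Set
open scoped Pointwise ContDiff

universe w w₁ w₂

/-! ### Locally convex direct limits and locally m-convex algebras

For `𝕜 = ℝ` or `𝕜 = ℂ`, a topological `𝕜`-vector space is locally convex iff its topology is given
by a family of `𝕜`-seminorms; this is Mathlib's `PolynormableSpace 𝕜`. -/

/-- The locally convex direct limit topology on a vector space `F` with respect to linear maps
`i n : E n → F`: the finest (not necessarily Hausdorff) locally convex vector topology on `F` for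
which every `i n` is continuous. (In Mathlib's order on topologies, the coarsest common refinement
of a set of topologies is its `sInf`.) -/
@[reducible] def lcDirectLimitTopology (𝕜 : Type*) [RCLike 𝕜] {E : ℕ → Type*} [∀ n, AddCommGroup (E n)]
    [∀ n, Module 𝕜 (E n)] [∀ n, TopologicalSpace (E n)] {F : Type*} [AddCommGroup F] [Module 𝕜 F]
    (i : ∀ n, E n →ₗ[𝕜] F) : TopologicalSpace F :=
  sInf {t : TopologicalSpace F |
    @IsTopologicalAddGroup F t _ ∧ @ContinuousSMul 𝕜 F _ _ t ∧
      @PolynormableSpace 𝕜 F _ _ _ t ∧ ∀ n, @Continuous (E n) F _ t (i n)}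

/-- A topological algebra is locally m-convex if its topology is the vector topology defined by a
family of sub-multiplicative seminorms. -/
def IsLocallyMConvex (𝕜 B : Type*) [RCLike 𝕜] [Ring B] [Algebra 𝕜 B] [TopologicalSpace B] : Prop :=
  ∃ P : Set (Seminorm 𝕜 B),
    (∀ p ∈ P, ∀ x y : B, p (x * y) ≤ p x * p y) ∧ WithSeminorms (fun p : P => (p : Seminorm 𝕜 B))

/-! ### Unit groups with the induced topology -/

/-- The unit group of `R`, as the subset of all invertible elements of `R`. As a subtype it carries
the topology induced by `R` (which, in general, is not Mathlib's topology on `Rˣ`). -/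
abbrev UnitGrp (R : Type*) [Monoid R] : Type _ := ↥(IsUnit.submonoid R)

/-- The homomorphism between unit groups induced by a homomorphism of monoids. -/
def UnitGrp.map {R S : Type*} [Monoid R] [Monoid S] (f : R →* S) : UnitGrp R →* UnitGrp S where
  toFun x := ⟨f (x : R), IsUnit.map f x.2⟩
  map_one' := Subtype.ext (map_one f)
  map_mul' x y := Subtype.ext (map_mul f (x : R) (y : R))

/-- If the set of invertible elements is open in `R`, then the inclusion `R^× → R` is a global
chart for the unit group, modelled on `R`. -/
@[reducible] noncomputable def UnitGrp.chartedSpace (R : Type*) [Monoid R] [TopologicalSpace R]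
    (h : IsOpen {x : R | IsUnit x}) : ChartedSpace R (UnitGrp R) :=
  haveI : Nonempty {x : R | IsUnit x} := ⟨⟨1, isUnit_one⟩⟩
  (IsOpen.isOpenEmbedding_subtypeVal (X := R) (s := {x : R | IsUnit x}) h).singletonChartedSpace

/-! ### Ascending unions of topological groups -/

/-- `(L, (i n))` is the direct limit, in the category of (not necessarily Hausdorff) topological
groups and continuous homomorphisms, of the direct sequence `G 0 → G 1 → ⋯` with bonding maps
`j n`. -/
structure IsTopGroupDirectLimit {G : ℕ → Type*} [∀ n, Group (G n)] [∀ n, TopologicalSpace (G n)]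
    {L : Type*} [Group L] [TopologicalSpace L]
    (j : ∀ n, G n →* G (n + 1)) (i : ∀ n, G n →* L) : Prop where
  topGroup : ∀ n, IsTopologicalGroup (G n)
  topGroup_limit : IsTopologicalGroup L
  continuous_bonding : ∀ n, Continuous (j n)
  continuous_limitMap : ∀ n, Continuous (i n)
  cone : ∀ n, (i (n + 1)).comp (j n) = i n
  universal : ∀ (H : Type w) [Group H] [TopologicalSpace H] [IsTopologicalGroup H]
    (ψ : ∀ n, G n →* H), (∀ n, Continuous (ψ n)) → (∀ n, (ψ (n + 1)).comp (j n) = ψ n) →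
    ∃! φ : L →* H, Continuous φ ∧ ∀ n, φ.comp (i n) = ψ n

/-- The subgroup of all finitely supported families in the product of the `G n`. -/
def weakProdSubgroup (G : ℕ → Type*) [∀ n, Group (G n)] : Subgroup (∀ n, G n) where
  carrier := {g | {n | g n ≠ 1}.Finite}
  one_mem' := by simp
  mul_mem' {a b} ha hb := (Set.Finite.union ha hb).subset fun n hn => by
    by_contra h
    simp only [Set.mem_union, Set.mem_ofPred_eq, not_or, not_not] at h
    exact hn (by simp [h.1, h.2])
  inv_mem' {a} ha := by simpa using ha

/-- The weak direct product of the groups `G n`. -/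
def WeakProd (G : ℕ → Type*) [∀ n, Group (G n)] : Type _ := ↥(weakProdSubgroup G)

namespace WeakProd

instance {G : ℕ → Type*} [∀ n, Group (G n)] : Group (WeakProd G) :=
  inferInstanceAs (Group ↥(weakProdSubgroup G))

/-- The box topology on the weak direct product: a basis consists of the boxes determined by open
sets `U n ⊆ G n` with `1 ∈ U n` for all but finitely many `n`. -/
instance {G : ℕ → Type*} [∀ n, Group (G n)] [∀ n, TopologicalSpace (G n)] :
    TopologicalSpace (WeakProd G) :=
  TopologicalSpace.generateFrom
    {S | ∃ U : ∀ n, Set (G n), (∀ n, IsOpen (U n)) ∧ {n | (1 : G n) ∉ U n}.Finite ∧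
      S = {g | ∀ n, g.1 n ∈ U n}}

theorem exists_bound {G : ℕ → Type*} [∀ n, Group (G n)] (g : WeakProd G) :
    ∃ N, ∀ n, N ≤ n → g.1 n = 1 := by
  obtain ⟨M, hM⟩ := Set.Finite.bddAbove (show {n | g.1 n ≠ 1}.Finite from g.2)
  refine ⟨M + 1, fun n hn => ?_⟩
  by_contra h
  have := hM h
  omega

open Classical in
/-- The product map `(g n) ↦ g 0 * g 1 * ⋯ * g (N - 1)`, where `g n = 1` for all `n ≥ N`. (We take
the smallest such `N`; every other one gives the same product.) -/
noncomputable def prodMap {G : ℕ → Type*} [∀ n, Group (G n)] {L : Type*} [Group L]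
    (i : ∀ n, G n →* L) (g : WeakProd G) : L :=
  ((List.range (Nat.find g.exists_bound)).map fun n => i n (g.1 n)).prod

end WeakProd

/-- Product sets are large in `L = ⋃ G n` (with inclusion maps `i n : G n → L`): the product map
takes identity neighbourhoods in the weak direct product to identity neighbourhoods in `L`. -/
def ProductSetsLarge {G : ℕ → Type*} [∀ n, Group (G n)] [∀ n, TopologicalSpace (G n)]
    {L : Type*} [Group L] [TopologicalSpace L] (i : ∀ n, G n →* L) : Prop :=
  ∀ U ∈ 𝓝 (1 : WeakProd G), WeakProd.prodMap i '' U ∈ 𝓝 (1 : L)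

/-- The passing through assumption (PTA) for an ascending sequence of topological groups `G n`:
every `G n` has a basis of symmetric identity neighbourhoods `U` such that, for all `m > n` and
every identity neighbourhood `V` in `G m`, there is an identity neighbourhood `W` in `G m` such that
`W U ⊆ U V`. The groups are viewed as subgroups of their union `L` by means of injective
homomorphisms `i n`, and the products are formed there. -/
def SatisfiesPTA {G : ℕ → Type*} [∀ n, Group (G n)] [∀ n, TopologicalSpace (G n)]
    {L : Type*} [Group L] (i : ∀ n, G n →* L) : Prop :=
  ∀ n, ∃ 𝓑 : Set (Set (G n)),
    (∀ U ∈ 𝓑, U ∈ 𝓝 (1 : G n) ∧ U⁻¹ = U) ∧ (∀ N ∈ 𝓝 (1 : G n), ∃ U ∈ 𝓑, U ⊆ N) ∧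
    ∀ U ∈ 𝓑, ∀ m, n < m → ∀ V ∈ 𝓝 (1 : G m), ∃ W ∈ 𝓝 (1 : G m),
      i m '' W * i n '' U ⊆ i n '' U * i m '' V

/-! ### Calculus in locally convex spaces -/

/-- The complexification `E ⊕ iE` of a vector space over `𝕜 = ℝ`, with the product topology. -/
def Complexif (E : Type*) : Type _ := E × E

namespace Complexif

instance {E : Type*} [AddCommGroup E] : AddCommGroup (Complexif E) :=
  inferInstanceAs (AddCommGroup (E × E))

instance {E : Type*} [TopologicalSpace E] : TopologicalSpace (Complexif E) :=
  inferInstanceAs (TopologicalSpace (E × E))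

/-- The inclusion `x ↦ x + i0`. -/
def ofReal {E : Type*} [AddCommGroup E] (x : E) : Complexif E := (x, 0)

/-- Complex scalar multiplication `(a + ib) (x + iy) = (ax - by) + i(ay + bx)`. -/
@[reducible] noncomputable def module (𝕜 E : Type*) [RCLike 𝕜] [AddCommGroup E] [Module 𝕜 E] :
    Module ℂ (Complexif E) where
  smul z v := ((z.re : 𝕜) • v.1 - (z.im : 𝕜) • v.2, (z.re : 𝕜) • v.2 + (z.im : 𝕜) • v.1)
  one_smul v := Prod.ext
    (show ((1 : ℂ).re : 𝕜) • v.1 - ((1 : ℂ).im : 𝕜) • v.2 = v.1 by simp)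
    (show ((1 : ℂ).re : 𝕜) • v.2 + ((1 : ℂ).im : 𝕜) • v.1 = v.2 by simp)
  mul_smul a b v := Prod.ext
    (show ((a * b).re : 𝕜) • v.1 - ((a * b).im : 𝕜) • v.2 =
        (a.re : 𝕜) • ((b.re : 𝕜) • v.1 - (b.im : 𝕜) • v.2)
          - (a.im : 𝕜) • ((b.re : 𝕜) • v.2 + (b.im : 𝕜) • v.1) by
      rw [Complex.mul_re, Complex.mul_im]; push_cast; module)
    (show ((a * b).re : 𝕜) • v.2 + ((a * b).im : 𝕜) • v.1 =
        (a.re : 𝕜) • ((b.re : 𝕜) • v.2 + (b.im : 𝕜) • v.1)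
          + (a.im : 𝕜) • ((b.re : 𝕜) • v.1 - (b.im : 𝕜) • v.2) by
      rw [Complex.mul_re, Complex.mul_im]; push_cast; module)
  smul_zero a := Prod.ext
    (show (a.re : 𝕜) • (0 : E) - (a.im : 𝕜) • (0 : E) = 0 by simp)
    (show (a.re : 𝕜) • (0 : E) + (a.im : 𝕜) • (0 : E) = 0 by simp)
  smul_add a v u := Prod.ext
    (show (a.re : 𝕜) • (v.1 + u.1) - (a.im : 𝕜) • (v.2 + u.2) =
        ((a.re : 𝕜) • v.1 - (a.im : 𝕜) • v.2) + ((a.re : 𝕜) • u.1 - (a.im : 𝕜) • u.2) by module)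
    (show (a.re : 𝕜) • (v.2 + u.2) + (a.im : 𝕜) • (v.1 + u.1) =
        ((a.re : 𝕜) • v.2 + (a.im : 𝕜) • v.1) + ((a.re : 𝕜) • u.2 + (a.im : 𝕜) • u.1) by module)
  add_smul a b v := Prod.ext
    (show ((a + b).re : 𝕜) • v.1 - ((a + b).im : 𝕜) • v.2 =
        ((a.re : 𝕜) • v.1 - (a.im : 𝕜) • v.2) + ((b.re : 𝕜) • v.1 - (b.im : 𝕜) • v.2) by
      rw [Complex.add_re, Complex.add_im]; push_cast; module)
    (show ((a + b).re : 𝕜) • v.2 + ((a + b).im : 𝕜) • v.1 =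
        ((a.re : 𝕜) • v.2 + (a.im : 𝕜) • v.1) + ((b.re : 𝕜) • v.2 + (b.im : 𝕜) • v.1) by
      rw [Complex.add_re, Complex.add_im]; push_cast; module)
  zero_smul v := Prod.ext
    (show ((0 : ℂ).re : 𝕜) • v.1 - ((0 : ℂ).im : 𝕜) • v.2 = 0 by simp)
    (show ((0 : ℂ).re : 𝕜) • v.2 + ((0 : ℂ).im : 𝕜) • v.1 = 0 by simp)

end Complexif

section Calculus

variable (𝕜 : Type*) [RCLike 𝕜] {E F : Type*}
  [AddCommGroup E] [Module 𝕜 E] [TopologicalSpace E]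
  [AddCommGroup F] [Module 𝕜 F] [TopologicalSpace F]

/-- `v` is the directional derivative `D_y f (x)`. -/
def HasDirDeriv (f : E → F) (v : F) (x y : E) : Prop :=
  Tendsto (fun t : 𝕜 => t⁻¹ • (f (x + t • y) - f x)) (𝓝[≠] 0) (𝓝 v)

/-- `f` is `C^r_𝕜` on the open set `U` (in Keller's sense), `r ∈ ℕ₀ ∪ {∞}`: for all `k ≤ r`, the
iterated directional derivatives `d k x (y₁, …, y_k) = D_{y₁} ⋯ D_{y_k} f (x)` exist for `x ∈ U`
and define a continuous map on `U × E^k`; the case `k = 0` is continuity of `f`. -/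
def IsKellerCrOn (r : ℕ∞) (f : E → F) (U : Set E) : Prop :=
  ∃ d : ∀ k : ℕ, E → (Fin k → E) → F,
    (∀ x ∈ U, ∀ y, d 0 x y = f x) ∧
    (∀ k : ℕ, ((k + 1 : ℕ) : ℕ∞) ≤ r → ∀ x ∈ U, ∀ y : Fin (k + 1) → E,
      HasDirDeriv 𝕜 (fun x' => d k x' (Fin.tail y)) (d (k + 1) x y) x (y 0)) ∧
    ∀ k : ℕ, (k : ℕ∞) ≤ r →
      ContinuousOn (fun q : E × (Fin k → E) => d k q.1 q.2) (U ×ˢ Set.univ)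

/-- `f` is continuous on the open set `U` and given locally by a pointwise convergent series of
continuous homogeneous polynomials (over `𝕜`). For `𝕜 = ℂ`, this is complex analyticity. -/
def IsSeriesAnalyticOn (f : E → F) (U : Set E) : Prop :=
  ContinuousOn f U ∧ ∀ x ∈ U, ∃ p : ∀ k : ℕ, ContinuousMultilinearMap 𝕜 (fun _ : Fin k => E) F,
    ∀ᶠ v in 𝓝 (0 : E),
      Tendsto (fun N : ℕ => ∑ k ∈ Finset.range N, p k (fun _ => v)) atTop (𝓝 (f (x + v)))

/-- `f` is `𝕜`-analytic on the open set `U`. If `𝕜 = ℂ` (i.e. if the imaginary unit of the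
`RCLike` field is nonzero), this is complex analyticity. If `𝕜 = ℝ` (i.e. if the imaginary unit is
zero), it means that `f` extends to a complex analytic map between open subsets of the
complexifications of `E` and `F`. -/
def IsKAnalyticOn (f : E → F) (U : Set E) : Prop :=
  ((RCLike.I : 𝕜) ≠ 0 → IsSeriesAnalyticOn 𝕜 f U) ∧
  ((RCLike.I : 𝕜) = 0 →
    letI := Complexif.module 𝕜 E
    letI := Complexif.module 𝕜 F
    ∃ (V : Set (Complexif E)) (g : Complexif E → Complexif F), IsOpen V ∧
      IsSeriesAnalyticOn ℂ g V ∧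
      ∀ x ∈ U, Complexif.ofReal x ∈ V ∧ g (Complexif.ofReal x) = Complexif.ofReal (f x))

/-- `f` is `C^r_𝕜` on the open set `U`, where `r ∈ ℕ₀ ∪ {∞, ω}`. -/
def IsClassOn (r : WithTop ℕ∞) (f : E → F) (U : Set E) : Prop :=
  (r = ω → IsKAnalyticOn 𝕜 f U) ∧ ∀ k : ℕ∞, r = k → IsKellerCrOn 𝕜 k f U

end Calculus

/-! ### Lie groups modelled on locally convex spaces -/

section LieGroups

/-- A map between manifolds modelled on `E` and `F` is `C^r_𝕜`: it is continuous, and `C^r_𝕜` in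
local coordinates. -/
def IsClassMap (𝕜 : Type*) [RCLike 𝕜] (r : WithTop ℕ∞) (E F : Type*)
    [AddCommGroup E] [Module 𝕜 E] [TopologicalSpace E]
    [AddCommGroup F] [Module 𝕜 F] [TopologicalSpace F]
    {M N : Type*} [TopologicalSpace M] [ChartedSpace E M] [TopologicalSpace N] [ChartedSpace F N]
    (f : M → N) : Prop :=
  Continuous f ∧ ∀ e ∈ atlas E M, ∀ e' ∈ atlas F N,
    IsClassOn 𝕜 r (fun x => e' (f (e.symm x))) {x | x ∈ e.target ∧ f (e.symm x) ∈ e'.source}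

/-- `G`, with its given topology and atlas, is a `C^r_𝕜`-Lie group (`r ∈ {∞, ω}`) modelled on the
Hausdorff locally convex space `E`: a Hausdorff topological group, with charts whose transition maps
are `C^r_𝕜`, such that multiplication and inversion are `C^r_𝕜` in local coordinates. -/
structure IsLCLieGroup (𝕜 : Type*) [RCLike 𝕜] (r : WithTop ℕ∞) (E G : Type*)
    [AddCommGroup E] [Module 𝕜 E] [TopologicalSpace E]
    [Group G] [TopologicalSpace G] [ChartedSpace E G] : Prop where
  addGroup_model : IsTopologicalAddGroup E
  smul_model : ContinuousSMul 𝕜 E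
  locallyConvex_model : PolynormableSpace 𝕜 E
  t2_model : T2Space E
  t2 : T2Space G
  topGroup : IsTopologicalGroup G
  transition : ∀ e ∈ atlas E G, ∀ e' ∈ atlas E G,
    IsClassOn 𝕜 r (fun x => e' (e.symm x)) {x | x ∈ e.target ∧ e.symm x ∈ e'.source}
  mul : ∀ e₁ ∈ atlas E G, ∀ e₂ ∈ atlas E G, ∀ e ∈ atlas E G,
    IsClassOn 𝕜 r (fun x : E × E => e (e₁.symm x.1 * e₂.symm x.2))
      {x | x.1 ∈ e₁.target ∧ x.2 ∈ e₂.target ∧ e₁.symm x.1 * e₂.symm x.2 ∈ e.source}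
  inv : IsClassMap 𝕜 r E E (fun g : G => g⁻¹)

/-- `(L, (i n))` is the direct limit, in the category of `C^∞_𝕜`-Lie groups modelled on Hausdorff
locally convex spaces and `C^∞_𝕜`-homomorphisms, of the direct sequence `G 0 → G 1 → ⋯` with bonding
maps `j n`. -/
structure IsLieGroupDirectLimit (𝕜 : Type*) [RCLike 𝕜] (E : ℕ → Type*) (EL : Type*)
    [∀ n, AddCommGroup (E n)] [∀ n, Module 𝕜 (E n)] [∀ n, TopologicalSpace (E n)]
    [AddCommGroup EL] [Module 𝕜 EL] [TopologicalSpace EL]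
    {G : ℕ → Type*} [∀ n, Group (G n)] [∀ n, TopologicalSpace (G n)]
    [∀ n, ChartedSpace (E n) (G n)]
    {L : Type*} [Group L] [TopologicalSpace L] [ChartedSpace EL L]
    (j : ∀ n, G n →* G (n + 1)) (i : ∀ n, G n →* L) : Prop where
  lieGroup : ∀ n, IsLCLieGroup 𝕜 ∞ (E n) (G n)
  lieGroup_limit : IsLCLieGroup 𝕜 ∞ EL L
  smooth_bonding : ∀ n, IsClassMap 𝕜 ∞ (E n) (E (n + 1)) (j n)
  smooth_limitMap : ∀ n, IsClassMap 𝕜 ∞ (E n) EL (i n)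
  cone : ∀ n, (i (n + 1)).comp (j n) = i n
  universal : ∀ (F : Type w₁) (H : Type w₂) [AddCommGroup F] [Module 𝕜 F] [TopologicalSpace F]
    [Group H] [TopologicalSpace H] [ChartedSpace F H], IsLCLieGroup 𝕜 ∞ F H →
    ∀ ψ : ∀ n, G n →* H, (∀ n, IsClassMap 𝕜 ∞ (E n) F (ψ n)) →
    (∀ n, (ψ (n + 1)).comp (j n) = ψ n) →
    ∃! φ : L →* H, IsClassMap 𝕜 ∞ EL F φ ∧ ∀ n, φ.comp (i n) = ψ n

end LieGroups

-- The technical core is a supply of bounded multiplicative semigroups. Given a continuous seminorm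
-- `p` on the union, one builds recursively bounded balanced 0-neighbourhoods `K n` in the steps,
-- each closed under multiplication and containing the previous one, on which `p` stays small
-- (`exists_semigroup_extension`, `exists_semigroups`). The union of their convex hulls is an
-- absolutely convex semigroup, so its gauge is a submultiplicative seminorm; this seminorm is
-- continuous because continuity of seminorms can be tested on the steps
-- (`exists_submultiplicative`). Local m-convexity and continuity of multiplication and inversion
-- follow.
--
-- Openness of the unit group and largeness of product sets come from one factorization
-- (`exists_factorization`): a partial sum `u = 1 + a₀ + ⋯ + a_{N-1}` is continued by `u + a_N = u
-- (1 + u⁻¹ a_N)`, and an a priori bound on `u⁻¹` makes every factor close to 1. Finite sums of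
-- sufficiently small elements form a 0-neighbourhood (`nhds_zero_sums`). Large product sets give
-- the universal property for topological groups: a homomorphism that is continuous on all steps
-- maps a suitable product set into a prescribed identity neighbourhood.
--
-- For analyticity, an element `v` near 0 is half an element of one of the bounded semigroups, so
-- its geometric series converges already in a Banach step; a variant with 1/4 handles the
-- complexification. Hence inversion is given locally by power series.
--
-- For the universal property among Lie groups, the derivatives at 1 of the restrictions to the
-- steps glue to a continuous linear map `l`. Translating by units gives the derivative of the
-- homomorphism at `x` in direction `y` from the multiplication of the target, the homomorphism
-- itself and `l (x⁻¹ y)`; so class `C^k` implies class `C^(k+1)`. This bootstrapping needs a chain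
-- rule, which is proved for a recursive (Bastiani) form of the differentiability classes, shown
-- equivalent to the iterated (Keller) form for smooth maps.
--
-- The Hausdorff property in the strict case is a stepwise Hahn–Banach extension.

universe u u' v v'

/-! ### The locally convex direct limit topology -/

section LimitTopology

variable {𝕜 : Type*} [RCLike 𝕜] {E : ℕ → Type*} [∀ n, AddCommGroup (E n)]
  [∀ n, Module 𝕜 (E n)] [∀ n, TopologicalSpace (E n)] [∀ n, IsTopologicalAddGroup (E n)]
  {F : Type*} [AddCommGroup F] [Module 𝕜 F]

/-- The topology defined by `p` alone is among those whose infimum is taken, so the limit topology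
is finer than it. -/
theorem continuous_seminorm_lcDirectLimitTopology (i : ∀ n, E n →ₗ[𝕜] F) (p : Seminorm 𝕜 F)
    (hp : ∀ n, Continuous fun x => p (i n x)) :
    @Continuous F ℝ (lcDirectLimitTopology 𝕜 i) _ p := by
  let P : SeminormFamily 𝕜 F Unit := fun _ => p
  let t : TopologicalSpace F := P.moduleFilterBasis.topology
  have hP : WithSeminorms P := ⟨rfl⟩
  have hg : IsTopologicalAddGroup F := hP.topologicalAddGroup
  have ht : t ∈ {t : TopologicalSpace F |
      @IsTopologicalAddGroup F t _ ∧ @ContinuousSMul 𝕜 F _ _ t ∧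
      @PolynormableSpace 𝕜 F _ _ _ t ∧ ∀ n, @Continuous (E n) F _ t (i n)} := by
    refine ⟨hg, hP.continuousSMul, hP.toPolynormableSpace, fun n => ?_⟩
    refine continuous_of_continuousAt_zero (i n) ?_
    rw [ContinuousAt, map_zero, hP.tendsto_nhds]
    intro _ ε hε
    have := (hp n).tendsto 0
    simp only [map_zero] at this
    filter_upwards [this.eventually (gt_mem_nhds hε)] with x hx
    simpa [P] using hx
  exact continuous_le_dom (sInf_le ht) (hP.continuous_seminorm ())

/-- `F` is the ascending union of its subspaces `i n (E n)`, with the locally convex direct limit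
topology. -/
structure IsLCUnion (𝕜 : Type*) [RCLike 𝕜] {A : ℕ → Type*} [∀ n, NormedRing (A n)]
    [∀ n, NormedAlgebra 𝕜 (A n)] {B : Type*} [Ring B] [Algebra 𝕜 B] [TopologicalSpace B]
    (i : ∀ n, A n →ₐ[𝕜] B) : Prop where
  injective : ∀ n, Function.Injective (i n)
  exists_eq : ∀ b, ∃ n x, i n x = b
  bond : ∀ n m, n ≤ m → ∃ f : A n →ₐ[𝕜] A m, Continuous f ∧ ∀ x, i m (f x) = i n x
  addGroup : IsTopologicalAddGroup B
  smul : ContinuousSMul 𝕜 B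
  polynormable : PolynormableSpace 𝕜 B
  continuous_incl : ∀ n, Continuous (i n)
  continuous_seminorm : ∀ p : Seminorm 𝕜 B, (∀ n, Continuous fun x => p (i n x)) → Continuous p

end LimitTopology

theorem IsLCUnion.of_lcDirectLimitTopology {𝕜 : Type*} [RCLike 𝕜]
    {A : ℕ → Type*} [∀ n, NormedRing (A n)] [∀ n, NormedAlgebra 𝕜 (A n)]
    (j : ∀ n, A n →ₐ[𝕜] A (n + 1)) (hj : ∀ n, Continuous (j n))
    {B : Type*} [Ring B] [Algebra 𝕜 B] [tB : TopologicalSpace B]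
    (i : ∀ n, A n →ₐ[𝕜] B) (hi : ∀ n, Function.Injective (i n))
    (hij : ∀ n x, i (n + 1) (j n x) = i n x) (hB : ∀ b : B, ∃ n x, i n x = b)
    (htB : tB = lcDirectLimitTopology 𝕜 (fun n => (i n).toLinearMap)) : IsLCUnion 𝕜 i where
  injective := hi
  exists_eq := hB
  bond n m h := by
    induction m, h using Nat.le_induction with
    | base => exact ⟨AlgHom.id 𝕜 (A n), continuous_id, fun _ => rfl⟩
    | succ m _ ih =>
      obtain ⟨f, hf, hf'⟩ := ih
      exact ⟨(j m).comp f, (hj m).comp hf, fun x => by simp [hij, hf']⟩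
  addGroup := by subst htB; exact topologicalAddGroup_sInf fun t ht => ht.1
  smul := by subst htB; exact continuousSMul_sInf fun t ht => ht.2.1
  polynormable := by subst htB; exact PolynormableSpace.sInf fun t ht => ht.2.2.1
  continuous_incl n := by
    subst htB; exact continuous_sInf_rng.2 fun t ht => ht.2.2.2 n
  continuous_seminorm p hp := by
    subst htB; exact continuous_seminorm_lcDirectLimitTopology _ p hp

/-! ### Absolutely convex sub-semigroups -/

section Convex

/-- Convex hulls and gauges are formed over `ℝ`, whereas the algebra is over `𝕜`; the real scalars
have to be moved past products. -/
theorem isScalarTower_real_self (𝕜 : Type*) [RCLike 𝕜] (R : Type*) [Ring R] [Algebra 𝕜 R]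
    [Module ℝ R] [IsScalarTower ℝ 𝕜 R] : IsScalarTower ℝ R R where
  smul_assoc r x y := by
    rw [smul_eq_mul, smul_eq_mul, ← algebraMap_smul 𝕜 r x, ← algebraMap_smul 𝕜 r (x * y),
      smul_mul_assoc]

theorem smulCommClass_real_self (𝕜 : Type*) [RCLike 𝕜] (R : Type*) [Ring R] [Algebra 𝕜 R]
    [Module ℝ R] [IsScalarTower ℝ 𝕜 R] : SMulCommClass ℝ R R where
  smul_comm r x y := by
    rw [smul_eq_mul, smul_eq_mul, ← algebraMap_smul 𝕜 r y, ← algebraMap_smul 𝕜 r (x * y),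
      mul_smul_comm]

variable {R : Type*} [Ring R] [Module ℝ R] [IsScalarTower ℝ R R] [SMulCommClass ℝ R R]

/-- The product is linear in each factor, so minimality of the hull can be applied to one factor at
a time. -/
theorem mul_mem_convexHull {s : Set R} (hs : ∀ x ∈ s, ∀ y ∈ s, x * y ∈ s) {x y : R}
    (hx : x ∈ convexHull ℝ s) (hy : y ∈ convexHull ℝ s) : x * y ∈ convexHull ℝ s := by
  have key : ∀ x ∈ s, ∀ y ∈ convexHull ℝ s, x * y ∈ convexHull ℝ s := by
    intro x hx
    have : convexHull ℝ s ⊆ {y : R | x * y ∈ convexHull ℝ s} := by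
      refine convexHull_min (fun y hy => subset_convexHull ℝ s (hs x hx y hy)) ?_
      intro u hu v hv a b ha hb hab
      rw [mem_ofPred_eq, mul_add, mul_smul_comm, mul_smul_comm]
      exact convex_convexHull ℝ s hu hv ha hb hab
    exact fun y hy => this hy
  have : convexHull ℝ s ⊆ {x : R | x * y ∈ convexHull ℝ s} := by
    refine convexHull_min (fun x hx => key x hx y hy) ?_
    intro u hu v hv a b ha hb hab
    rw [mem_ofPred_eq, add_mul, smul_mul_assoc, smul_mul_assoc]
    exact convex_convexHull ℝ s hu hv ha hb hab
  exact this hx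

theorem Balanced.convexHull_real {𝕜 : Type*} [RCLike 𝕜] {E : Type*} [AddCommGroup E] [Module 𝕜 E]
    [Module ℝ E] [IsScalarTower ℝ 𝕜 E] {s : Set E} (hs : Balanced 𝕜 s) :
    Balanced 𝕜 (convexHull ℝ s) := by
  intro a ha
  rintro _ ⟨x, hx, rfl⟩
  have : convexHull ℝ s ⊆ {x : E | a • x ∈ convexHull ℝ s} := by
    refine convexHull_min (fun y hy => subset_convexHull ℝ s (hs a ha ⟨y, hy, rfl⟩)) ?_
    intro u hu v hv c d hc hd hcd
    rw [mem_ofPred_eq, smul_add, ← algebraMap_smul 𝕜 c u, ← algebraMap_smul 𝕜 d v, smul_comm,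
      smul_comm a _ v, algebraMap_smul, algebraMap_smul]
    exact convex_convexHull ℝ s hu hv hc hd hcd
  exact this hx

/-- If `x ∈ a T` and `y ∈ b T` then `x y ∈ a b T`, as `T` is a semigroup; then let `a` and `b`
decrease to the gauges. -/
theorem gauge_mul_le {T : Set R} (h0 : Absorbent ℝ T)
    (hmul : ∀ x ∈ T, ∀ y ∈ T, x * y ∈ T) (x y : R) :
    gauge T (x * y) ≤ gauge T x * gauge T y := by
  have key : ∀ a b : ℝ, gauge T x < a → gauge T y < b → gauge T (x * y) ≤ a * b := by
    intro a b ha hb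
    obtain ⟨a', ha'0, ha', u, hu, rfl⟩ := exists_lt_of_gauge_lt h0 ha
    obtain ⟨b', hb'0, hb', v, hv, rfl⟩ := exists_lt_of_gauge_lt h0 hb
    refine (gauge_le_of_mem (a := a' * b') (by positivity) ⟨u * v, hmul u hu v hv, ?_⟩).trans
      (mul_le_mul ha'.le hb'.le hb'0.le (ha'0.trans ha').le)
    change (a' * b') • (u * v) = a' • u * b' • v
    rw [smul_mul_assoc, mul_smul_comm, mul_smul]
  have h1 : Tendsto (fun e : ℝ => (gauge T x + e) * (gauge T y + e)) (𝓝[>] 0)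
      (𝓝 ((gauge T x + 0) * (gauge T y + 0))) :=
    Tendsto.mono_left (by apply Continuous.tendsto; fun_prop) nhdsWithin_le_nhds
  rw [add_zero, add_zero] at h1
  refine ge_of_tendsto h1 ?_
  filter_upwards [self_mem_nhdsWithin] with e he
  exact key _ _ (lt_add_of_pos_right _ he) (lt_add_of_pos_right _ he)

end Convex

/-- One step in the construction of bounded semigroups in an ascending sequence of normed
algebras. -/
theorem exists_semigroup_extension {𝕜 : Type*} [RCLike 𝕜] {R S : Type*} [NormedRing R]
    [NormedAlgebra 𝕜 R] [NormedRing S] [NormedAlgebra 𝕜 S] (f : R →ₐ[𝕜] S) (hf : Continuous f)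
    {K : Set R} (hbal : Balanced 𝕜 K) (hmul : ∀ x ∈ K, ∀ y ∈ K, x * y ∈ K)
    {M : ℝ} (hM : ∀ x ∈ K, ‖x‖ ≤ M) {N : Set S} (hN : N ∈ 𝓝 0) :
    ∃ K' ∈ 𝓝 (0 : S), Balanced 𝕜 K' ∧ (∀ x ∈ K', ∀ y ∈ K', x * y ∈ K') ∧
      (∃ M', ∀ x ∈ K', ‖x‖ ≤ M') ∧ f '' K ⊆ K' ∧ K' ⊆ f '' K ∪ N := by
  let fL : R →L[𝕜] S := ⟨f.toLinearMap, hf⟩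
  obtain ⟨C, hC1, hC⟩ : ∃ C : ℝ, 1 ≤ C ∧ ∀ x ∈ K, ‖f x‖ ≤ C := by
    refine ⟨max 1 (‖fL‖ * M), le_max_left _ _, fun x hx => le_max_of_le_right ?_⟩
    exact (fL.le_opNorm x).trans (mul_le_mul_of_nonneg_left (hM x hx) (norm_nonneg _))
  obtain ⟨ε, hε0, hε⟩ := Metric.nhds_basis_closedBall.mem_iff.1 hN
  -- The cap 1 makes the δ-ball closed under products.
  set δ := min ε 1 with hδ
  have hδ0 : 0 < δ := lt_min hε0 one_pos
  have hδ1 : δ ≤ 1 := min_le_right _ _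
  -- `f '' K` need not contain 1, so the element itself, its one-sided products and its two-sided
  -- products are bounded separately. This makes `J` stable under multiplication by `f '' K` from
  -- both sides, and `f '' K ∪ J` a semigroup.
  let J : Set S := {z | ‖z‖ ≤ δ ∧ (∀ s ∈ K, ‖f s * z‖ ≤ δ) ∧ (∀ s ∈ K, ‖z * f s‖ ≤ δ) ∧
    ∀ s ∈ K, ∀ s' ∈ K, ‖f s * z * f s'‖ ≤ δ}
  have hJδ : J ⊆ Metric.closedBall 0 δ := fun z hz => by simpa using hz.1
  refine ⟨f '' K ∪ J, ?_, ?_, ?_, ⟨max C δ, ?_⟩, subset_union_left,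
    union_subset_union_right _ (hJδ.trans ((Metric.closedBall_subset_closedBall
      (min_le_left _ _)).trans hε))⟩
  -- As `1 ≤ C`, the radius `δ / C²` meets all four conditions at once.
  · refine mem_of_superset (Metric.closedBall_mem_nhds (0 : S) (ε := δ / (C * C)) (by positivity))
      (subset_union_of_subset_right (fun z hz => ?_) _)
    have hz' : ‖z‖ ≤ δ / (C * C) := by simpa using hz
    have hzC : C * ‖z‖ * C ≤ δ := by
      rw [le_div_iff₀ (by positivity)] at hz'; linarith
    have h0 := norm_nonneg z
    have h1 : C * ‖z‖ ≤ C * ‖z‖ * C := le_mul_of_one_le_right (by positivity) hC1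
    have h2 : ‖z‖ ≤ C * ‖z‖ := le_mul_of_one_le_left (by positivity) hC1
    refine ⟨by linarith, fun s hs => ?_, fun s hs => ?_, fun s hs s' hs' => ?_⟩
    · refine (norm_mul_le _ _).trans ?_
      have := mul_le_mul_of_nonneg_right (hC s hs) h0
      linarith
    · refine (norm_mul_le _ _).trans ?_
      have := mul_le_mul_of_nonneg_left (hC s hs) h0
      linarith
    · refine (norm_mul_le _ _).trans ((mul_le_mul (norm_mul_le _ _) (hC s' hs') (norm_nonneg _)
        (by positivity)).trans ?_)
      have := mul_le_mul_of_nonneg_right (mul_le_mul_of_nonneg_right (hC s hs) h0)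
        (zero_le_one.trans hC1)
      linarith
  · rintro a ha _ ⟨z, hz | hz, rfl⟩
    · obtain ⟨x, hx, rfl⟩ := hz
      exact Or.inl ⟨a • x, hbal a ha ⟨x, hx, rfl⟩, map_smul f a x⟩
    · have key : ∀ y : S, ‖y‖ ≤ δ → ‖a • y‖ ≤ δ := fun y hy => by
        rw [norm_smul]
        exact (mul_le_of_le_one_left (norm_nonneg _) ha).trans hy
      refine Or.inr ⟨key _ hz.1, fun s hs => ?_, fun s hs => ?_, fun s hs s' hs' => ?_⟩
      · simpa using key _ (hz.2.1 s hs)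
      · simpa using key _ (hz.2.2.1 s hs)
      · simpa using key _ (hz.2.2.2 s hs s' hs')
  · have mulδ : ∀ u v : S, ‖u‖ ≤ δ → ‖v‖ ≤ δ → ‖u * v‖ ≤ δ := fun u v hu hv =>
      (norm_mul_le _ _).trans ((mul_le_mul hu (hv.trans hδ1) (norm_nonneg _) hδ0.le).trans
        (mul_one δ).le)
    rintro _ (⟨x, hx, rfl⟩ | hx) _ (⟨y, hy, rfl⟩ | hy)
    · exact Or.inl ⟨x * y, hmul x hx y hy, map_mul f x y⟩
    · refine Or.inr ⟨hy.2.1 x hx, fun s hs => ?_, fun s hs => hy.2.2.2 x hx s hs,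
        fun s hs s' hs' => ?_⟩
      · rw [← mul_assoc, ← map_mul]; exact hy.2.1 _ (hmul s hs x hx)
      · rw [← mul_assoc, ← map_mul]; exact hy.2.2.2 _ (hmul s hs x hx) s' hs'
    · refine Or.inr ⟨hx.2.2.1 y hy, fun s hs => ?_, fun s hs => ?_, fun s hs s' hs' => ?_⟩
      · rw [← mul_assoc]; exact hx.2.2.2 s hs y hy
      · rw [mul_assoc, ← map_mul]; exact hx.2.2.1 _ (hmul y hy s hs)
      · rw [← mul_assoc, mul_assoc, ← map_mul]; exact hx.2.2.2 s hs _ (hmul y hy s' hs')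
    · refine Or.inr ⟨mulδ _ _ hx.1 hy.1, fun s hs => ?_, fun s hs => ?_, fun s hs s' hs' => ?_⟩
      · rw [← mul_assoc]; exact mulδ _ _ (hx.2.1 s hs) hy.1
      · rw [mul_assoc]; exact mulδ _ _ hx.1 (hy.2.2.1 s hs)
      · rw [← mul_assoc, mul_assoc]; exact mulδ _ _ (hx.2.1 s hs) (hy.2.2.1 s' hs')
  · rintro _ (⟨x, hx, rfl⟩ | hx)
    · exact le_max_of_le_left (hC x hx)
    · exact le_max_of_le_right hx.1

theorem exists_continuous_seminorm_lt_one {𝕜 : Type*} [RCLike 𝕜] {E : Type*} [AddCommGroup E]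
    [Module 𝕜 E] [TopologicalSpace E] [PolynormableSpace 𝕜 E] {W : Set E} (hW : W ∈ 𝓝 0) :
    ∃ p : Seminorm 𝕜 E, Continuous p ∧ ∀ x, p x < 1 → x ∈ W := by
  have hs := PolynormableSpace.withSeminorms 𝕜 E
  obtain ⟨s, r, hr, hsr⟩ := (hs.mem_nhds_iff 0 W).1 hW
  let q : Seminorm 𝕜 E := s.sup fun p : {p : Seminorm 𝕜 E // Continuous p} => p.1
  have hc : Continuous q := by
    have := hs.topologicalAddGroup
    have := hs.continuousSMul
    exact Seminorm.continuous (r := 1) (hs.mem_nhds_iff _ _ |>.2 ⟨s, 1, one_pos, subset_rfl⟩)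
  refine ⟨(⟨r, hr.le⟩⁻¹ : NNReal) • q, ?_, fun x hx => hsr ?_⟩
  · exact continuous_const.mul hc
  · rw [Seminorm.mem_ball_zero]
    have : r⁻¹ * q x < 1 := hx
    rwa [inv_mul_lt_iff₀ hr, mul_one] at this

/-! ### Submultiplicative seminorms on the union -/

namespace IsLCUnion

variable {𝕜 : Type*} [RCLike 𝕜] {A : ℕ → Type*} [∀ n, NormedRing (A n)]
  [∀ n, NormedAlgebra 𝕜 (A n)] {B : Type*} [Ring B] [Algebra 𝕜 B] [TopologicalSpace B]
  {i : ∀ n, A n →ₐ[𝕜] B}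

theorem exists_common (h : IsLCUnion 𝕜 i) {ι : Type*} [Finite ι] (b : ι → B) (m : ℕ) :
    ∃ n, m ≤ n ∧ ∃ a : ι → A n, ∀ k, i n (a k) = b k := by
  choose n x hx using fun k => h.exists_eq (b k)
  have := Fintype.ofFinite ι
  choose f _ hf using h.bond
  have hle : ∀ k, n k ≤ max m (Finset.univ.sup n) :=
    fun k => le_max_of_le_right (Finset.le_sup (Finset.mem_univ k))
  exact ⟨_, le_max_left _ _, fun k => f _ _ (hle k) (x k), fun k => by rw [hf, hx]⟩

theorem exists_common_pair (h : IsLCUnion 𝕜 i) (b c : B) (m : ℕ) :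
    ∃ n, m ≤ n ∧ ∃ x y : A n, i n x = b ∧ i n y = c := by
  obtain ⟨n, hn, a, ha⟩ := h.exists_common ![b, c] m
  exact ⟨n, hn, a 0, a 1, ha 0, ha 1⟩

theorem absorbent_of_nhds (h : IsLCUnion 𝕜 i) [Module ℝ B] [IsScalarTower ℝ 𝕜 B] {T : Set B}
    (hT : ∀ n, i n ⁻¹' T ∈ 𝓝 0) : Absorbent ℝ T := by
  rw [absorbent_iff_eventually_nhdsNE_zero]
  intro b
  obtain ⟨n, x, rfl⟩ := h.exists_eq b
  have : Tendsto (fun c : ℝ => (algebraMap ℝ 𝕜 c) • x) (𝓝 0) (𝓝 0) := by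
    have hc : Continuous fun c : ℝ => (algebraMap ℝ 𝕜 c) • x :=
      (algebraMapCLM ℝ 𝕜).continuous.smul continuous_const
    simpa using hc.tendsto 0
  filter_upwards [(this.eventually (hT n)).filter_mono nhdsWithin_le_nhds] with c hc
  have hc : i n ((algebraMap ℝ 𝕜 c) • x) ∈ T := hc
  rwa [map_smul, algebraMap_smul] at hc

/-- On each step the gauge is at most 1 on a 0-neighbourhood, hence continuous there. -/
theorem continuous_gaugeSeminorm (h : IsLCUnion 𝕜 i) [Module ℝ B] [IsScalarTower ℝ 𝕜 B]
    {T : Set B} (hb : Balanced 𝕜 T) (hc : Convex ℝ T) (ha : Absorbent ℝ T)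
    (hT : ∀ n, i n ⁻¹' T ∈ 𝓝 0) : Continuous (gaugeSeminorm hb hc ha) := by
  refine h.continuous_seminorm _ fun n => ?_
  have : ((gaugeSeminorm hb hc ha).comp (i n).toLinearMap).closedBall 0 1 ∈ 𝓝 0 := by
    refine mem_of_superset (hT n) fun x hx => ?_
    rw [Seminorm.mem_closedBall_zero]
    exact gauge_le_one_of_mem hx
  exact Seminorm.continuous' this

theorem mem_nhds_zero_of_convex (h : IsLCUnion 𝕜 i) [Module ℝ B] [IsScalarTower ℝ 𝕜 B]
    {T : Set B} (hb : Balanced 𝕜 T) (hc : Convex ℝ T)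
    (hT : ∀ n, i n ⁻¹' T ∈ 𝓝 0) : T ∈ 𝓝 (0 : B) := by
  have ha := h.absorbent_of_nhds hT
  have hq := h.continuous_gaugeSeminorm hb hc ha hT
  have := hq.tendsto 0
  rw [map_zero] at this
  filter_upwards [this.eventually (gt_mem_nhds one_pos)] with x hx
  refine setOfPred_gauge_lt_one_subset_self hc ?_ ha hx
  have := mem_of_mem_nhds (hT 0)
  rwa [mem_preimage, map_zero] at this

/-- The recursion preserves `p ≤ 1`: elements coming from the previous step keep their value of `p`,
and new ones are admitted only from the 0-neighbourhood where `p ≤ 1`. -/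
theorem exists_semigroups (h : IsLCUnion 𝕜 i) (p : Seminorm 𝕜 B) (hp : Continuous p) :
    ∃ K : ∀ n, Set (A n), (∀ n, K n ∈ 𝓝 0) ∧ (∀ n, Balanced 𝕜 (K n)) ∧
      (∀ n, ∀ x ∈ K n, ∀ y ∈ K n, x * y ∈ K n) ∧ (∀ n, ∃ M, ∀ x ∈ K n, ‖x‖ ≤ M) ∧
      (∀ n, i n '' K n ⊆ i (n + 1) '' K (n + 1)) ∧ ∀ n, ∀ x ∈ K n, p (i n x) ≤ 1 := by
  let Q : ∀ n, Set (A n) → Prop := fun n K => K ∈ 𝓝 0 ∧ Balanced 𝕜 K ∧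
    (∀ x ∈ K, ∀ y ∈ K, x * y ∈ K) ∧ (∃ M, ∀ x ∈ K, ‖x‖ ≤ M) ∧ ∀ x ∈ K, p (i n x) ≤ 1
  have hN : ∀ n, {x | p (i n x) ≤ 1} ∈ 𝓝 (0 : A n) := fun n => by
    have := (hp.comp (h.continuous_incl n)).tendsto 0
    simp only [Function.comp_apply, map_zero] at this
    exact this.eventually (ge_mem_nhds one_pos)
  have h0 : ∃ K, Q 0 K := by
    -- The first semigroup arises by extending `{0}` along the identity map.
    obtain ⟨K, hK, hb, hm, hM, -, hK'⟩ := exists_semigroup_extension (AlgHom.id 𝕜 (A 0))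
      continuous_id (K := {0}) (M := 0) (by rintro a - _ ⟨x, rfl, rfl⟩; simp) (by simp) (by simp)
      (hN 0)
    refine ⟨K, hK, hb, hm, hM, fun x hx => ?_⟩
    rcases hK' hx with ⟨y, hy, rfl⟩ | hx
    · rw [mem_singleton_iff.1 hy]; simp
    · exact hx
  have hs : ∀ n, ∀ K : {K // Q n K}, ∃ K' : {K // Q (n + 1) K}, i n '' K.1 ⊆ i (n + 1) '' K'.1 := by
    rintro n ⟨K, hK, hb, hm, ⟨M, hM⟩, hp1⟩
    obtain ⟨f, hf, hfi⟩ := h.bond n (n + 1) n.le_succ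
    obtain ⟨K', hK', hb', hm', hM', hs, hK''⟩ :=
      exists_semigroup_extension f hf hb hm hM (hN (n + 1))
    refine ⟨⟨K', hK', hb', hm', hM', fun x hx => ?_⟩, ?_⟩
    · rcases hK'' hx with ⟨y, hy, rfl⟩ | hx
      · rw [hfi]; exact hp1 y hy
      · exact hx
    · rintro _ ⟨x, hx, rfl⟩
      exact ⟨f x, hs ⟨x, hx, rfl⟩, hfi x⟩
  choose s hs using hs
  let K : ∀ n, {K // Q n K} := fun n => Nat.rec ⟨_, h0.choose_spec⟩ s n
  exact ⟨fun n => (K n).1, fun n => (K n).2.1, fun n => (K n).2.2.1, fun n => (K n).2.2.2.1,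
    fun n => (K n).2.2.2.2.1, fun n => hs n (K n), fun n => (K n).2.2.2.2.2⟩

/-- Every neighbourhood of `0` contains the open unit ball of a continuous submultiplicative
seminorm, all of whose elements lie in bounded absolutely convex semigroups in the steps. -/
theorem exists_submultiplicative (h : IsLCUnion 𝕜 i) {W : Set B} (hW : W ∈ 𝓝 0) :
    ∃ (q : Seminorm 𝕜 B) (C : ∀ n, Set (A n)), Continuous q ∧ (∀ x y, q (x * y) ≤ q x * q y) ∧
      (∀ x, q x < 1 → x ∈ W) ∧ (∀ n, ∃ M, ∀ x ∈ C n, ‖x‖ ≤ M) ∧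
      (∀ n, ∀ x ∈ C n, ∀ y ∈ C n, x * y ∈ C n) ∧ (∀ n, ∀ x ∈ C n, -x ∈ C n) ∧
      (∀ n, ∀ x ∈ C n, ∀ y ∈ C n, (2⁻¹ : 𝕜) • (x + y) ∈ C n) ∧
      Monotone (fun n => i n '' C n) ∧ ∀ x, q x < 1 → ∃ n, x ∈ i n '' C n := by
  have := h.polynormable
  obtain ⟨p, hp, hpW⟩ := exists_continuous_seminorm_lt_one (𝕜 := 𝕜) hW
  -- The factor 2 gives `p ≤ 1/2` on the semigroups, which survives convex hulls and yields a strict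
  -- inequality `p < 1`.
  obtain ⟨K, hK, hb, hm, hM, hs, hp1⟩ := h.exists_semigroups ((2 : NNReal) • p)
    (continuous_const.mul hp)
  let : Module ℝ B := Module.compHom B (algebraMap ℝ 𝕜)
  have : IsScalarTower ℝ 𝕜 B := ⟨fun r a b => by
    rw [Algebra.smul_def r a, mul_smul]; rfl⟩
  let : ∀ n, NormedSpace ℝ (A n) := fun n => NormedSpace.restrictScalars ℝ 𝕜 (A n)
  have : ∀ n, IsScalarTower ℝ 𝕜 (A n) := fun n => ⟨fun r a b => by
    rw [Algebra.smul_def r a, mul_smul]; rfl⟩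
  have := isScalarTower_real_self 𝕜 B
  have := smulCommClass_real_self 𝕜 B
  have := fun n => isScalarTower_real_self 𝕜 (A n)
  have := fun n => smulCommClass_real_self 𝕜 (A n)
  let iR : ∀ n, A n →ₗ[ℝ] B := fun n => (i n).toLinearMap.restrictScalars ℝ
  let C : ∀ n, Set (A n) := fun n => convexHull ℝ (K n)
  have himg : ∀ n, i n '' C n = convexHull ℝ (i n '' K n) := fun n =>
    (iR n).image_convexHull (K n)
  have hmono : Monotone (fun n => i n '' C n) := by
    refine monotone_nat_of_le_succ fun n => ?_
    rw [himg, himg]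
    exact convexHull_mono (hs n)
  have hCb : ∀ n, Balanced 𝕜 (C n) := fun n => (hb n).convexHull_real
  have hCm : ∀ n, ∀ x ∈ C n, ∀ y ∈ C n, x * y ∈ C n :=
    fun n x hx y hy => mul_mem_convexHull (hm n) hx hy
  -- An increasing union of absolutely convex semigroups is again one; the seminorm sought is its
  -- gauge.
  let T : Set B := ⋃ n, i n '' C n
  have hTb : Balanced 𝕜 T := by
    rintro a ha _ ⟨x, hx, rfl⟩
    obtain ⟨n, y, hy, rfl⟩ := mem_iUnion.1 hx
    exact mem_iUnion.2 ⟨n, a • y, hCb n a ha ⟨y, hy, rfl⟩, map_smul _ _ _⟩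
  have hTc : Convex ℝ T := by
    refine (hmono.directed_le).convex_iUnion fun n => ?_
    rw [himg]; exact convex_convexHull ℝ _
  have hTn : ∀ n, i n ⁻¹' T ∈ 𝓝 0 := fun n =>
    mem_of_superset (hK n) fun x hx => mem_iUnion.2 ⟨n, x, subset_convexHull ℝ _ hx, rfl⟩
  have hTm : ∀ x ∈ T, ∀ y ∈ T, x * y ∈ T := by
    intro x hx y hy
    obtain ⟨n, hx⟩ := mem_iUnion.1 hx
    obtain ⟨m, hy⟩ := mem_iUnion.1 hy
    obtain ⟨x, hx', rfl⟩ := hmono (le_max_left n m) hx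
    obtain ⟨y, hy', rfl⟩ := hmono (le_max_right n m) hy
    exact mem_iUnion.2 ⟨_, x * y, hCm _ x hx' y hy', map_mul _ _ _⟩
  have hTa := h.absorbent_of_nhds hTn
  have hT0 : (0 : B) ∈ T := by
    have := mem_of_mem_nhds (hTn 0)
    rwa [mem_preimage, map_zero] at this
  have hqT : ∀ x, gauge T x < 1 → ∃ n, x ∈ i n '' C n := fun x hx =>
    mem_iUnion.1 (setOfPred_gauge_lt_one_subset_self hTc hT0 hTa hx)
  have hCp : ∀ n, ∀ x ∈ C n, p (i n x) < 1 := by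
    intro n x hx
    have hsub : C n ⊆ iR n ⁻¹' {y | ((2 : NNReal) • p) y ≤ 1} := by
      refine convexHull_min (fun y hy => hp1 n y hy) (Convex.linear_preimage ?_ (iR n))
      have := ((2 : NNReal) • p).convex_closedBall (0 : B) 1
      simpa [Seminorm.closedBall_zero_eq] using this
    have : 2 * p (i n x) ≤ 1 := hsub hx
    linarith
  refine ⟨gaugeSeminorm hTb hTc hTa, C, h.continuous_gaugeSeminorm hTb hTc hTa hTn,
    gauge_mul_le hTa hTm, fun x hx => ?_, fun n => ?_, hCm, fun n x hx => (hCb n).neg_mem_iff.2 hx,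
    fun n x hx y hy => ?_, hmono, hqT⟩
  · obtain ⟨n, y, hy, rfl⟩ := hqT x hx
    exact hpW _ (hCp n y hy)
  · obtain ⟨M, hM⟩ := hM n
    refine ⟨M, fun x hx => ?_⟩
    have : C n ⊆ Metric.closedBall 0 M :=
      convexHull_min (fun y hy => by simpa using hM y hy) (convex_closedBall _ _)
    simpa using this hx
  · have := convex_convexHull ℝ (K n) hx hy (a := 2⁻¹) (b := 2⁻¹) (by norm_num) (by norm_num)
      (by norm_num)
    rwa [← smul_add, ← algebraMap_smul 𝕜 (2⁻¹ : ℝ), map_inv₀, map_ofNat] at this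

end IsLCUnion

/-! ### Unit groups of topological rings -/

section UnitGrp

variable {R : Type*} [Ring R]

theorem UnitGrp.coe_mul_coe_inv (g : UnitGrp R) : (g : R) * ((g⁻¹ : UnitGrp R) : R) = 1 :=
  congrArg Subtype.val (mul_inv_cancel g)

theorem UnitGrp.coe_inv_mul_coe (g : UnitGrp R) : ((g⁻¹ : UnitGrp R) : R) * (g : R) = 1 :=
  congrArg Subtype.val (inv_mul_cancel g)

theorem UnitGrp.coe_inv_eq_inverse (g : UnitGrp R) :
    ((g⁻¹ : UnitGrp R) : R) = Ring.inverse (g : R) := by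
  have h := Ring.mul_inverse_cancel _ g.2
  calc ((g⁻¹ : UnitGrp R) : R) = (g⁻¹ : UnitGrp R) * ((g : R) * Ring.inverse (g : R)) := by
        rw [h, mul_one]
    _ = _ := by rw [← mul_assoc, UnitGrp.coe_inv_mul_coe, one_mul]

theorem UnitGrp.coe_list_prod_map {ι : Type*} (l : List ι) (g : ι → UnitGrp R) :
    (((l.map g).prod : UnitGrp R) : R) = (l.map fun k => (g k : R)).prod := by
  induction l with
  | nil => rfl
  | cons a l ih =>
    rw [List.map_cons, List.prod_cons, List.map_cons, List.prod_cons, ← ih]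
    rfl

/-- Every neighbourhood of `0` contains the open unit ball of a continuous submultiplicative
seminorm on the additive group of the ring. -/
def HasRingSeminormBasis (R : Type*) [Ring R] [TopologicalSpace R] : Prop :=
  ∀ W ∈ 𝓝 (0 : R), ∃ q : RingSeminorm R, Continuous q ∧ ∀ x, q x < 1 → x ∈ W

variable [TopologicalSpace R]

theorem tendsto_zero_of_ringSeminorm (hR : HasRingSeminormBasis R) {ι : Type*} {l : Filter ι}
    {f : ι → R} (hf : ∀ q : RingSeminorm R, Continuous q → Tendsto (fun x => q (f x)) l (𝓝 0)) :
    Tendsto f l (𝓝 0) := by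
  intro W hW
  obtain ⟨q, hq, hqW⟩ := hR W hW
  rw [mem_map]
  filter_upwards [(hf q hq).eventually (gt_mem_nhds one_pos)] with x hx using hqW _ hx

theorem HasRingSeminormBasis.isTopologicalRing [IsTopologicalAddGroup R]
    (hR : HasRingSeminormBasis R) : IsTopologicalRing R := by
  refine IsTopologicalRing.of_addGroup_of_nhds_zero ?_ (fun x₀ => ?_) fun x₀ => ?_ <;>
    refine tendsto_zero_of_ringSeminorm hR fun q hq => ?_ <;>
    have hq0 : Tendsto q (𝓝 0) (𝓝 0) := by simpa using hq.tendsto 0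
  · refine squeeze_zero (fun _ => apply_nonneg q _) (fun x => map_mul_le_mul q x.1 x.2) ?_
    simpa using (hq0.comp tendsto_fst).mul (hq0.comp tendsto_snd)
  · refine squeeze_zero (fun _ => apply_nonneg q _) (fun x => map_mul_le_mul q x₀ x) ?_
    simpa using hq0.const_mul (q x₀)
  · refine squeeze_zero (fun _ => apply_nonneg q _) (fun x => map_mul_le_mul q x x₀) ?_
    simpa using hq0.mul_const (q x₀)

/-- Based on `b⁻¹ - a⁻¹ = -b⁻¹ (b - a) a⁻¹`; neither completeness nor openness of the set of units
is required. -/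
theorem HasRingSeminormBasis.continuousOn_inverse [IsTopologicalAddGroup R]
    (hR : HasRingSeminormBasis R) : ContinuousOn Ring.inverse {x : R | IsUnit x} := by
  intro a ha
  have ha : IsUnit a := ha
  rw [ContinuousWithinAt, ← tendsto_sub_nhds_zero_iff]
  refine tendsto_zero_of_ringSeminorm hR fun q hq => ?_
  set c := q (Ring.inverse a)
  have h1 : Tendsto (fun b => q (b - a)) (𝓝[{x : R | IsUnit x}] a) (𝓝 0) := by
    have : Continuous fun b => q (b - a) := hq.comp (continuous_id.sub continuous_const)
    simpa using (this.tendsto a).mono_left nhdsWithin_le_nhds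
  have h2 : Tendsto (fun b => q (b - a) * c) (𝓝[{x : R | IsUnit x}] a) (𝓝 0) := by
    simpa using h1.mul_const c
  have h3 : Tendsto (fun b => 2 * c * (q (b - a) * c)) (𝓝[{x : R | IsUnit x}] a) (𝓝 0) := by
    simpa using h2.const_mul (2 * c)
  refine squeeze_zero' (Eventually.of_forall fun _ => apply_nonneg q _) ?_ h3
  filter_upwards [h2.eventually (gt_mem_nhds (by norm_num : (0 : ℝ) < 1 / 2)),
    self_mem_nhdsWithin] with b hb hbu
  have hbu : IsUnit b := hbu
  have key : Ring.inverse b - Ring.inverse a = -(Ring.inverse b * ((b - a) * Ring.inverse a)) := by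
    rw [sub_mul, mul_sub, ← mul_assoc, Ring.inverse_mul_cancel _ hbu,
      Ring.mul_inverse_cancel _ ha]
    simp
  have hle : q (Ring.inverse b - Ring.inverse a) ≤ q (Ring.inverse b) * (q (b - a) * c) := by
    rw [key, map_neg_eq_map]
    refine (map_mul_le_mul q _ _).trans ?_
    exact mul_le_mul_of_nonneg_left (map_mul_le_mul q _ _) (apply_nonneg q _)
  have hb0 : 0 ≤ q (Ring.inverse b) := apply_nonneg q _
  have hb2 : q (Ring.inverse b) ≤ c + q (Ring.inverse b - Ring.inverse a) := by
    have := map_add_le_add q (Ring.inverse a) (Ring.inverse b - Ring.inverse a)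
    rwa [add_sub_cancel] at this
  -- Since `q (b - a) c < 1/2`, the two estimates give `q b⁻¹ ≤ c + q b⁻¹ / 2`, and the last term is
  -- absorbed.
  have hb3 : q (Ring.inverse b) ≤ 2 * c := by nlinarith
  refine hle.trans (mul_le_mul_of_nonneg_right hb3 ?_)
  exact mul_nonneg (apply_nonneg q _) (apply_nonneg q _)

theorem UnitGrp.isTopologicalGroup [IsTopologicalRing R]
    (h : ContinuousOn Ring.inverse {x : R | IsUnit x}) : IsTopologicalGroup (UnitGrp R) where
  continuous_mul := continuous_induced_rng.2 <|
    (continuous_subtype_val.comp continuous_fst).mul (continuous_subtype_val.comp continuous_snd)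
  continuous_inv := continuous_induced_rng.2 <| by
    have : (Subtype.val ∘ fun a : UnitGrp R => a⁻¹) = fun a : UnitGrp R => Ring.inverse (a : R) :=
      funext UnitGrp.coe_inv_eq_inverse
    rw [this]
    exact h.comp_continuous continuous_subtype_val fun x => x.2

theorem continuousOn_inverse_of_normed (R : Type*) [NormedRing R] [CompleteSpace R] :
    ContinuousOn Ring.inverse {x : R | IsUnit x} := by
  rintro _ ⟨u, rfl⟩
  exact (NormedRing.inverse_continuousAt u).continuousWithinAt

theorem UnitGrp.isTopologicalGroup_of_normed (R : Type*) [NormedRing R] [CompleteSpace R] :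
    IsTopologicalGroup (UnitGrp R) :=
  UnitGrp.isTopologicalGroup (continuousOn_inverse_of_normed R)

theorem isOpen_isUnit_of_mem_nhds [IsTopologicalRing R] (h : {x : R | IsUnit x} ∈ 𝓝 1) :
    IsOpen {x : R | IsUnit x} := by
  rw [isOpen_iff_mem_nhds]
  intro a ha
  have ha : IsUnit a := ha
  have hc : Tendsto (fun x => Ring.inverse a * x) (𝓝 a) (𝓝 1) := by
    have := (continuous_const_mul (Ring.inverse a)).tendsto a
    rwa [Ring.inverse_mul_cancel _ ha] at this
  filter_upwards [hc.eventually h] with x hx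
  have := ha.mul hx
  rwa [← mul_assoc, Ring.mul_inverse_cancel _ ha, one_mul] at this

/-- The bound on the inverse is uniform in `x`, so constants can be fixed before elements are
chosen. It is `‖1‖ + 1` because the norm of 1 is not assumed to be 1. -/
theorem UnitGrp.exists_bounded_nhds {R : Type*} [NormedRing R] [CompleteSpace R]
    {U : Set (UnitGrp R)} (hU : U ∈ 𝓝 1) : ∃ δ > 0, ∀ x : R, ‖x‖ < δ → ∃ g ∈ U,
      (g : R) = 1 + x ∧ ‖((g⁻¹ : UnitGrp R) : R)‖ ≤ ‖(1 : R)‖ + 1 := by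
  have hG := UnitGrp.isTopologicalGroup_of_normed R
  have hV : {g : UnitGrp R | ‖((g⁻¹ : UnitGrp R) : R)‖ < ‖(1 : R)‖ + 1} ∈ 𝓝 (1 : UnitGrp R) := by
    have hc : Continuous fun g : UnitGrp R => ‖((g⁻¹ : UnitGrp R) : R)‖ :=
      (continuous_subtype_val.comp continuous_inv).norm
    refine hc.tendsto 1 (gt_mem_nhds ?_)
    simp
  have hemb : IsOpenEmbedding (Subtype.val : UnitGrp R → R) :=
    (Units.isOpen (R := R)).isOpenEmbedding_subtypeVal
  have := hemb.isOpenMap.image_mem_nhds (inter_mem hU hV)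
  obtain ⟨δ, hδ, hs⟩ := Metric.mem_nhds_iff.1 this
  refine ⟨δ, hδ, fun x hx => ?_⟩
  obtain ⟨g, hg, hgx⟩ := hs (show 1 + x ∈ Metric.ball ((1 : UnitGrp R) : R) δ by
    simpa [mem_ball_iff_norm] using hx)
  exact ⟨g, hg.1, hgx, le_of_lt hg.2⟩

end UnitGrp

/-! ### The weak direct product -/

/-- Induction over the way an open set is generated from boxes; intersections of boxes are taken
componentwise. -/
theorem WeakProd.exists_box_subset {G : ℕ → Type*} [∀ n, Group (G n)]
    [∀ n, TopologicalSpace (G n)] {U : Set (WeakProd G)} (hU : U ∈ 𝓝 1) :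
    ∃ V : ∀ n, Set (G n), (∀ n, V n ∈ 𝓝 1) ∧ ∀ g : WeakProd G, (∀ n, g.1 n ∈ V n) → g ∈ U := by
  obtain ⟨s, hsU, hs, h1⟩ := mem_nhds_iff.1 hU
  suffices ∃ V : ∀ n, Set (G n), (∀ n, V n ∈ 𝓝 1) ∧
      ∀ g : WeakProd G, (∀ n, g.1 n ∈ V n) → g ∈ s by
    obtain ⟨V, hV, hVs⟩ := this
    exact ⟨V, hV, fun g hg => hsU (hVs g hg)⟩
  clear hsU hU
  induction hs with
  | basic s hs =>
    obtain ⟨V, hV, -, rfl⟩ := hs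
    exact ⟨V, fun n => (hV n).mem_nhds (h1 n), fun g hg => hg⟩
  | univ => exact ⟨fun _ => Set.univ, fun _ => univ_mem, fun _ _ => trivial⟩
  | inter s t _ _ ihs iht =>
    obtain ⟨V, hV, hVs⟩ := ihs h1.1
    obtain ⟨V', hV', hVt⟩ := iht h1.2
    exact ⟨fun n => V n ∩ V' n, fun n => inter_mem (hV n) (hV' n),
      fun g hg => ⟨hVs g fun n => (hg n).1, hVt g fun n => (hg n).2⟩⟩
  | sUnion S _ ih =>
    obtain ⟨s, hs, h1⟩ := h1
    obtain ⟨V, hV, hVs⟩ := ih s hs h1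
    exact ⟨V, hV, fun g hg => ⟨s, hs, hVs g hg⟩⟩

theorem WeakProd.prodMap_eq {G : ℕ → Type*} [∀ n, Group (G n)] {L : Type*} [Group L]
    (i : ∀ n, G n →* L) (g : WeakProd G) {N : ℕ} (hN : ∀ n, N ≤ n → g.1 n = 1) :
    WeakProd.prodMap i g = ((List.range N).map fun n => i n (g.1 n)).prod := by
  classical
  have key : ∀ M k, (∀ n, M ≤ n → g.1 n = 1) →
      ((List.range (M + k)).map fun n => i n (g.1 n)).prod =
        ((List.range M).map fun n => i n (g.1 n)).prod := by
    intro M k hM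
    induction k with
    | zero => rfl
    | succ k ih =>
      rw [← add_assoc, List.range_succ, List.map_append, List.prod_append, ih]
      simp [hM (M + k) (Nat.le_add_right _ _)]
  have hle := Nat.find_min' g.exists_bound hN
  have hspec := Nat.find_spec g.exists_bound
  obtain ⟨k, rfl⟩ := Nat.exists_eq_add_of_le hle
  rw [key _ k hspec]
  unfold WeakProd.prodMap
  congr!

/-! ### Units of the union: topology, factorization and product sets -/

namespace IsLCUnion

variable {𝕜 : Type*} [RCLike 𝕜] {A : ℕ → Type*} [∀ n, NormedRing (A n)]
  [∀ n, NormedAlgebra 𝕜 (A n)] {B : Type*} [Ring B] [Algebra 𝕜 B] [TopologicalSpace B]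
  {i : ∀ n, A n →ₐ[𝕜] B}

theorem hasRingSeminormBasis (h : IsLCUnion 𝕜 i) : HasRingSeminormBasis B := by
  intro W hW
  obtain ⟨q, -, hq, hm, hqW, -⟩ := h.exists_submultiplicative hW
  exact ⟨{ q with
    map_zero' := map_zero q
    mul_le' := hm
    neg' := map_neg_eq_map q }, hq, hqW⟩

theorem isTopologicalRing (h : IsLCUnion 𝕜 i) : IsTopologicalRing B :=
  haveI := h.addGroup
  h.hasRingSeminormBasis.isTopologicalRing

theorem isTopologicalGroup (h : IsLCUnion 𝕜 i) : IsTopologicalGroup (UnitGrp B) :=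
  haveI := h.addGroup
  haveI := h.isTopologicalRing
  UnitGrp.isTopologicalGroup h.hasRingSeminormBasis.continuousOn_inverse

theorem isLocallyMConvex (h : IsLCUnion 𝕜 i) : IsLocallyMConvex 𝕜 B := by
  have := h.addGroup
  refine ⟨{q | Continuous q ∧ ∀ x y, q (x * y) ≤ q x * q y}, fun q hq => hq.2, ?_⟩
  rw [SeminormFamily.withSeminorms_iff_nhds_eq_iInf]
  refine le_antisymm (le_iInf fun q => ?_) fun W hW => ?_
  · have := q.2.1.tendsto 0
    rw [map_zero] at this
    exact this.le_comap
  · obtain ⟨q, -, hq, hm, hqW, -⟩ := h.exists_submultiplicative hW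
    refine mem_iInf_of_mem ⟨q, hq, hm⟩ ?_
    exact mem_comap.2 ⟨Iio 1, Iio_mem_nhds one_pos, fun x hx => hqW x hx⟩

/-- A unit and its inverse lie in a common step, and injectivity carries the inverse relations back
to it. -/
theorem isUnit_eq_iUnion (h : IsLCUnion 𝕜 i) :
    {b : B | IsUnit b} = ⋃ n, i n '' {x : A n | IsUnit x} := by
  ext b
  simp only [mem_ofPred_eq, mem_iUnion, mem_image]
  constructor
  · rintro ⟨u, rfl⟩
    obtain ⟨n, -, x, y, hx, hy⟩ := h.exists_common_pair (u : B) (↑u⁻¹ : B) 0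
    refine ⟨n, x, ⟨⟨x, y, h.injective n ?_, h.injective n ?_⟩, rfl⟩, hx⟩ <;> simp [hx, hy]
  · rintro ⟨n, x, hx, rfl⟩
    exact hx.map (i n)

/-- This set is absolutely convex and contains a ball of every step, as families with a single
nonzero entry. Requiring equality for all large `N` encodes finite sums without fixing their length.
-/
theorem nhds_zero_sums (h : IsLCUnion 𝕜 i) {ε : ℕ → ℝ} (hε : ∀ n, 0 < ε n) :
    {b : B | ∃ a : ∀ n, A n, (∀ n, ‖a n‖ < ε n) ∧
      ∀ᶠ N in atTop, b = ∑ k ∈ Finset.range N, i k (a k)} ∈ 𝓝 (0 : B) := by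
  let _ : Module ℝ B := Module.compHom B (algebraMap ℝ 𝕜)
  have : IsScalarTower ℝ 𝕜 B := ⟨fun r a b => by
    rw [Algebra.smul_def r a, mul_smul]; rfl⟩
  refine h.mem_nhds_zero_of_convex ?_ ?_ fun n => ?_
  · rintro c hc _ ⟨_, ⟨a, ha, hb⟩, rfl⟩
    refine ⟨fun n => c • a n, fun n => ?_, ?_⟩
    · rw [norm_smul]
      exact (mul_le_of_le_one_left (norm_nonneg _) hc).trans_lt (ha n)
    · filter_upwards [hb] with N hN
      simp [hN, Finset.smul_sum]
  · rintro _ ⟨a, ha, hb⟩ _ ⟨a', ha', hb'⟩ c d hc hd hcd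
    refine ⟨fun n => (algebraMap ℝ 𝕜 c) • a n + (algebraMap ℝ 𝕜 d) • a' n, fun n => ?_, ?_⟩
    · refine (norm_add_le _ _).trans_lt ?_
      rw [norm_smul, norm_smul, norm_algebraMap', norm_algebraMap', Real.norm_of_nonneg hc,
        Real.norm_of_nonneg hd]
      -- The strict bound needs a positive coefficient; if `c = 0` then `d = 1`.
      rcases hc.eq_or_lt with rfl | hc
      · simp only [zero_add] at hcd
        simpa [hcd] using ha' n
      · have h1 := mul_lt_mul_of_pos_left (ha n) hc
        have h2 := mul_le_mul_of_nonneg_left (ha' n).le hd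
        have : c * ε n + d * ε n = ε n := by rw [← add_mul, hcd, one_mul]
        linarith
    · filter_upwards [hb, hb'] with N hN hN'
      rw [hN, hN', ← algebraMap_smul 𝕜 c, ← algebraMap_smul 𝕜 d, Finset.smul_sum,
        Finset.smul_sum, ← Finset.sum_add_distrib]
      simp
  · filter_upwards [Metric.ball_mem_nhds (0 : A n) (hε n)] with x hx
    refine ⟨Pi.single n x, fun m => ?_, ?_⟩
    · rcases eq_or_ne m n with rfl | hm
      · simpa using hx
      · simpa [Pi.single_eq_of_ne hm] using hε m
    · filter_upwards [eventually_gt_atTop n] with N hN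
      rw [Finset.sum_eq_single n, Pi.single_eq_same]
      · intro m _ hm
        rw [Pi.single_eq_of_ne hm, map_zero]
      · simp [hN]

/-- Small sums factor as products of small units. -/
theorem exists_factorization [∀ n, CompleteSpace (A n)] (h : IsLCUnion 𝕜 i)
    {U : ∀ n, Set (UnitGrp (A n))} (hU : ∀ n, U n ∈ 𝓝 1) :
    ∃ ε : ℕ → ℝ, (∀ n, 0 < ε n) ∧ ∀ a : ∀ n, A n, (∀ n, ‖a n‖ < ε n) →
      ∃ g : ∀ n, UnitGrp (A n), (∀ n, g n ∈ U n) ∧ ∀ N, 1 + ∑ k ∈ Finset.range N, i k (a k) =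
        ((List.range N).map fun k => i k (g k : A k)).prod := by
  choose δ hδ0 hδ using fun n => UnitGrp.exists_bounded_nhds (hU n)
  choose f hf hfi using fun n => h.bond n (n + 1) n.le_succ
  have hC : ∀ n, ∃ C : ℝ, 0 < C ∧ ∀ x : A n, ‖f n x‖ ≤ C * ‖x‖ := fun n => by
    let fL : A n →L[𝕜] A (n + 1) := ⟨(f n).toLinearMap, hf n⟩
    exact ⟨‖fL‖ + 1, by positivity, fun x => (fL.le_opNorm x).trans
      (mul_le_mul_of_nonneg_right (by linarith) (norm_nonneg _))⟩
  choose C hC0 hC using hC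
  -- `M n` bounds the inverse of the `n`-th partial sum: passing on by one step costs the factor
  -- `‖1‖ + 1` for the new inverse and `C n` for the inclusion. It does not depend on `a`, so `ε n =
  -- δ n / M n` can be chosen beforehand.
  let M : ℕ → ℝ := fun n =>
    Nat.rec (‖(1 : A 0)‖ + 1) (fun k m => C k * ((‖(1 : A k)‖ + 1) * m)) n
  have hM : ∀ n, 0 < M n := fun n => by
    induction n with
    | zero => exact add_pos_of_nonneg_of_pos (norm_nonneg _) one_pos
    | succ k ih =>
      exact mul_pos (hC0 k) (mul_pos (add_pos_of_nonneg_of_pos (norm_nonneg _) one_pos) ih)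
  refine ⟨fun n => δ n / M n, fun n => div_pos (hδ0 n) (hM n), fun a ha => ?_⟩
  have hsmall : ∀ N, ∀ u : UnitGrp (A N), ‖((u⁻¹ : UnitGrp (A N)) : A N)‖ ≤ M N →
      ‖((u⁻¹ : UnitGrp (A N)) : A N) * a N‖ < δ N := fun N u hu => by
    refine (norm_mul_le _ _).trans_lt ((mul_le_mul_of_nonneg_right hu (norm_nonneg _)).trans_lt ?_)
    have := ha N
    rw [lt_div_iff₀ (hM N)] at this
    linarith
  -- The partial sum over `k < N` is a unit `u` in step `N`; its successor is the image of `u (1 +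
  -- u⁻¹ a_N)`.
  have hu : ∀ N, ∃ u : UnitGrp (A N), ‖((u⁻¹ : UnitGrp (A N)) : A N)‖ ≤ M N ∧
      i N (u : A N) = 1 + ∑ k ∈ Finset.range N, i k (a k) := fun N => by
    induction N with
    | zero => exact ⟨1, by simp [M], by simp⟩
    | succ N ih =>
      obtain ⟨u, hu, hui⟩ := ih
      obtain ⟨g, -, hg1, hg⟩ := hδ N _ (hsmall N u hu)
      refine ⟨UnitGrp.map (f N : A N →* A (N + 1)) (u * g), ?_, ?_⟩
      · rw [← map_inv]
        refine (hC N _).trans (mul_le_mul_of_nonneg_left ?_ (hC0 N).le)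
        rw [mul_inv_rev]
        exact (norm_mul_le _ _).trans (mul_le_mul hg hu (norm_nonneg _) (by positivity))
      · change i (N + 1) (f N (u * g : A N)) = _
        rw [hfi, hg1, mul_add, mul_one, ← mul_assoc, UnitGrp.coe_mul_coe_inv, one_mul, map_add,
          hui, Finset.sum_range_succ, add_assoc]
  choose u hu hui using hu
  choose g hgU hg1 _ using fun N => hδ N _ (hsmall N (u N) (hu N))
  refine ⟨g, hgU, fun N => ?_⟩
  induction N with
  | zero => simp
  | succ N ih =>
    rw [List.range_succ, List.map_append, List.prod_append, ← ih, ← hui N, List.map_singleton,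
      List.prod_singleton, ← map_mul, hg1, mul_add, mul_one, ← mul_assoc, UnitGrp.coe_mul_coe_inv,
      one_mul, map_add, hui, Finset.sum_range_succ, add_assoc]

/-- Near 1, every element is 1 plus a small finite sum, hence a finite product of units from the
steps. -/
theorem isOpen_isUnit [∀ n, CompleteSpace (A n)] (h : IsLCUnion 𝕜 i) :
    IsOpen {b : B | IsUnit b} := by
  have := h.isTopologicalRing
  refine isOpen_isUnit_of_mem_nhds ?_
  obtain ⟨ε, hε, hfac⟩ := h.exists_factorization (U := fun _ => univ) fun n => univ_mem
  have hs := h.nhds_zero_sums hε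
  have : Tendsto (fun x : B => x - 1) (𝓝 1) (𝓝 0) := by
    simpa using (continuous_sub_right (1 : B)).tendsto 1
  filter_upwards [this.eventually hs] with x hx
  obtain ⟨a, ha, hxa⟩ := hx
  obtain ⟨N, hN⟩ := hxa.exists
  obtain ⟨g, -, hg⟩ := hfac a ha
  have hx : x = ((List.range N).map fun k => i k (g k : A k)).prod := by
    rw [← hg, ← hN, add_sub_cancel]
  rw [hx]
  refine (IsUnit.submonoid B).list_prod_mem fun y hy => ?_
  obtain ⟨k, -, rfl⟩ := List.mem_map.1 hy
  exact (g k).2.map (i k)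

theorem productSetsLarge [∀ n, CompleteSpace (A n)] (h : IsLCUnion 𝕜 i) :
    ProductSetsLarge (fun n => UnitGrp.map (i n : A n →* B)) := by
  have := h.isTopologicalRing
  intro U hU
  obtain ⟨V, hV, hVU⟩ := WeakProd.exists_box_subset hU
  obtain ⟨ε, hε, hfac⟩ := h.exists_factorization hV
  have hs := h.nhds_zero_sums hε
  have : Tendsto (fun x : UnitGrp B => (x : B) - 1) (𝓝 1) (𝓝 0) := by
    have : Continuous fun x : UnitGrp B => (x : B) - 1 :=
      continuous_subtype_val.sub continuous_const
    simpa using this.tendsto 1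
  filter_upwards [this.eventually hs] with x hx
  obtain ⟨a, ha, hxa⟩ := hx
  obtain ⟨N, hN⟩ := hxa.exists
  obtain ⟨g, hgV, hg⟩ := hfac a ha
  -- The factorization supplies units for all indices; only those below `N` enter the product, and
  -- cutting off the rest yields finite support.
  let g' : ∀ n, UnitGrp (A n) := fun n => if n < N then g n else 1
  have hg' : ∀ n, N ≤ n → g' n = 1 := fun n hn => if_neg (by omega)
  have hfin : {n | g' n ≠ 1}.Finite := by
    refine (Set.finite_lt_nat N).subset fun n hn => ?_
    by_contra hn'
    exact hn (hg' n (not_lt.1 hn'))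
  let w : WeakProd fun n => UnitGrp (A n) := ⟨g', hfin⟩
  refine ⟨w, hVU w fun n => ?_, ?_⟩
  · change g' n ∈ V n
    by_cases hn : n < N
    · simpa [g', hn] using hgV n
    · simpa [g', hn] using mem_of_mem_nhds (hV n)
  · rw [WeakProd.prodMap_eq _ w hg']
    refine Subtype.ext ?_
    rw [UnitGrp.coe_list_prod_map]
    have hx : (x : B) = ((List.range N).map fun k => i k (g k : A k)).prod := by
      rw [← hg, ← hN, add_sub_cancel]
    rw [hx]
    congr 1
    refine List.map_congr_left fun k hk => ?_
    have : g' k = g k := if_pos (List.mem_range.1 hk)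
    rw [← this]
    rfl

/-- Write `w u = u (u⁻¹ w u)`. On a symmetric norm-bounded `U`, conjugation is controlled by `u⁻¹ w
u - 1 = u⁻¹ (w - 1) u`, so `‖w - 1‖ < δ / D²` suffices. -/
theorem satisfiesPTA [∀ n, CompleteSpace (A n)] (h : IsLCUnion 𝕜 i) :
    SatisfiesPTA (fun n => UnitGrp.map (i n : A n →* B)) := by
  intro n
  have hG := fun n => UnitGrp.isTopologicalGroup_of_normed (A n)
  refine ⟨{U | U ∈ 𝓝 1 ∧ U⁻¹ = U ∧ ∃ M, ∀ g ∈ U, ‖(g : A n)‖ ≤ M},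
    fun U hU => ⟨hU.1, hU.2.1⟩, fun N hN => ?_, ?_⟩
  · have hV : {g : UnitGrp (A n) | ‖(g : A n)‖ ≤ ‖(1 : A n)‖ + 1} ∈ 𝓝 (1 : UnitGrp (A n)) := by
      have hc : Continuous fun g : UnitGrp (A n) => ‖(g : A n)‖ := continuous_subtype_val.norm
      refine hc.tendsto 1 (ge_mem_nhds ?_)
      simp
    have hW := inter_mem hN hV
    refine ⟨(N ∩ {g : UnitGrp (A n) | ‖(g : A n)‖ ≤ ‖(1 : A n)‖ + 1}) ∩
      (N ∩ {g : UnitGrp (A n) | ‖(g : A n)‖ ≤ ‖(1 : A n)‖ + 1})⁻¹,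
      ⟨inter_mem hW (inv_mem_nhds_one _ hW), ?_, _, fun g hg => hg.1.2⟩, fun g hg => hg.1.1⟩
    rw [inter_inv, inv_inv, inter_comm]
  · rintro U ⟨hU1, hUs, M, hM⟩ m hnm V hV
    obtain ⟨f, hf, hfi⟩ := h.bond n m hnm.le
    let fL : A n →L[𝕜] A m := ⟨f.toLinearMap, hf⟩
    obtain ⟨D, hD0, hD⟩ : ∃ D : ℝ, 0 < D ∧ ∀ g ∈ U, ‖f (g : A n)‖ ≤ D := by
      refine ⟨max 1 (‖fL‖ * M), lt_max_of_lt_left one_pos, fun g hg => le_max_of_le_right ?_⟩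
      exact (fL.le_opNorm _).trans (mul_le_mul_of_nonneg_left (hM g hg) (norm_nonneg _))
    obtain ⟨δ, hδ0, hδ⟩ := UnitGrp.exists_bounded_nhds hV
    refine ⟨{w | ‖(w : A m) - 1‖ < δ / (D * D)}, ?_, ?_⟩
    · have hc : Continuous fun g : UnitGrp (A m) => ‖(g : A m) - 1‖ :=
        (continuous_subtype_val.sub continuous_const).norm
      refine hc.tendsto 1 (gt_mem_nhds ?_)
      simpa using div_pos hδ0 (mul_pos hD0 hD0)
    · rintro _ ⟨_, ⟨w, hw, rfl⟩, _, ⟨u, hu, rfl⟩, rfl⟩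
      have hw : ‖(w : A m) - 1‖ < δ / (D * D) := hw
      let u' := UnitGrp.map (f : A n →* A m) u
      have hu' : UnitGrp.map (i m : A m →* B) u' = UnitGrp.map (i n : A n →* B) u :=
        Subtype.ext (hfi _)
      have hn1 : ‖(u' : A m)‖ ≤ D := hD u hu
      have hn2 : ‖((u'⁻¹ : UnitGrp (A m)) : A m)‖ ≤ D := by
        rw [← map_inv]
        refine hD u⁻¹ ?_
        rw [← hUs]
        exact Set.inv_mem_inv.2 hu
      refine ⟨_, ⟨u, hu, rfl⟩, _, ⟨u'⁻¹ * w * u', ?_, rfl⟩, ?_⟩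
      · have hsub : ‖((u'⁻¹ : UnitGrp (A m)) : A m) * ((w : A m) - 1) * (u' : A m)‖ < δ := by
          refine (norm_mul_le _ _).trans_lt ?_
          rw [lt_div_iff₀ (by positivity)] at hw
          calc _ ≤ (D * ‖(w : A m) - 1‖) * D := by
                refine mul_le_mul ((norm_mul_le _ _).trans ?_) hn1 (norm_nonneg _) (by positivity)
                exact mul_le_mul_of_nonneg_right hn2 (norm_nonneg _)
            _ < δ := by linarith
        obtain ⟨g, hgV, hg, -⟩ := hδ _ hsub
        convert hgV using 1
        refine Subtype.ext ?_
        rw [hg, mul_sub, sub_mul, mul_one, UnitGrp.coe_inv_mul_coe, add_sub_cancel]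
        rfl
      · simp only [map_mul, map_inv, hu']
        group

end IsLCUnion

/-! ### Gluing maps on ascending unions -/

/-- Compatibility of consecutive maps propagates to any two steps, so the value does not depend on
the chosen representative. -/
theorem exists_glued_map {G : ℕ → Type*} {L X : Type*} (ι : ∀ n, G n → L)
    (hι : ∀ n, Function.Injective (ι n)) (hmono : ∀ n m, n ≤ m → ∀ x, ∃ y, ι m y = ι n x)
    (hL : ∀ b, ∃ n x, ι n x = b) (ψ : ∀ n, G n → X)
    (hψ : ∀ n x y, ι (n + 1) y = ι n x → ψ (n + 1) y = ψ n x) :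
    ∃ φ : L → X, ∀ n x, φ (ι n x) = ψ n x := by
  have key : ∀ n m, n ≤ m → ∀ x y, ι m y = ι n x → ψ m y = ψ n x := by
    intro n m hnm
    induction m, hnm using Nat.le_induction with
    | base => intro x y h; rw [hι n h]
    | succ m hm ih =>
      intro x y h
      obtain ⟨z, hz⟩ := hmono n m hm x
      rw [hψ m z y (h.trans hz.symm), ih x z hz]
  choose n x hx using hL
  refine ⟨fun b => ψ (n b) (x b), fun m y => ?_⟩
  rcases le_total (n (ι m y)) m with h | h
  · exact (key _ _ h _ _ (hx _).symm).symm
  · exact key _ _ h _ _ (hx _)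

/-- Choose neighbourhoods with `W (n + 1) * W (n + 1) ⊆ W n` and `W 0 = V`, using `W (n + 1)` for
the `n`-th factor. Products absorb from the right, whence the induction over all starting indices.
-/
theorem exists_seq_prod_mem {H : Type*} [Group H] [TopologicalSpace H] [IsTopologicalGroup H]
    {V : Set H} (hV : V ∈ 𝓝 1) : ∃ W : ℕ → Set H, (∀ n, W n ∈ 𝓝 1) ∧
      ∀ (v : ℕ → H), (∀ n, v n ∈ W n) → ∀ N, ((List.range N).map v).prod ∈ V := by
  have step : ∀ S : {S : Set H // S ∈ 𝓝 1}, ∃ S' : {S : Set H // S ∈ 𝓝 1},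
      ∀ x ∈ S'.1, ∀ y ∈ S'.1, x * y ∈ S.1 := by
    rintro ⟨S, hS⟩
    obtain ⟨S', hS', h1, hmul⟩ := exists_open_nhds_one_mul_subset hS
    exact ⟨⟨S', hS'.mem_nhds h1⟩, fun x hx y hy => hmul (Set.mul_mem_mul hx hy)⟩
  choose s hs using step
  let W : ℕ → {S : Set H // S ∈ 𝓝 1} := fun n => Nat.rec ⟨V, hV⟩ (fun _ => s) n
  refine ⟨fun n => (W (n + 1)).1, fun n => (W (n + 1)).2, fun v hv N => ?_⟩
  have key : ∀ l m, ((List.range' m l).map v).prod ∈ (W m).1 := by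
    intro l
    induction l with
    | zero => intro m; exact mem_of_mem_nhds (W m).2
    | succ l ih =>
      intro m
      rw [List.range'_succ, List.map_cons, List.prod_cons]
      exact hs (W m) _ (hv m) _ (ih (m + 1))
  rw [List.range_eq_range']
  exact key N 0

theorem WeakProd.box_mem_nhds {G : ℕ → Type*} [∀ n, Group (G n)] [∀ n, TopologicalSpace (G n)]
    {V : ∀ n, Set (G n)} (hV : ∀ n, V n ∈ 𝓝 1) :
    {g : WeakProd G | ∀ n, g.1 n ∈ V n} ∈ 𝓝 1 := by
  have h1 : ∀ n, (1 : G n) ∈ interior (V n) := fun n => mem_interior_iff_mem_nhds.2 (hV n)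
  have ho : IsOpen {g : WeakProd G | ∀ n, g.1 n ∈ interior (V n)} :=
    TopologicalSpace.isOpen_generateFrom_of_mem
      ⟨fun n => interior (V n), fun n => isOpen_interior, by simp [h1], rfl⟩
  exact mem_of_superset (ho.mem_nhds h1) fun g hg n => interior_subset (hg n)

/-- An embedding is a homeomorphism onto its range, so the functional transfers to the range, where
Hahn–Banach applies. -/
theorem exists_extension_of_isEmbedding {𝕜 : Type*} [RCLike 𝕜] {V W : Type*}
    [SeminormedAddCommGroup V] [NormedSpace 𝕜 V] [NormedAddCommGroup W] [NormedSpace 𝕜 W]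
    (g : V →ₗ[𝕜] W) (hg : IsEmbedding g) (f : V →L[𝕜] 𝕜) :
    ∃ f' : W →L[𝕜] 𝕜, ∀ x, f' (g x) = f x := by
  let e := LinearEquiv.ofInjective g hg.injective
  have he : IsInducing e := IsInducing.of_comp_iff (g := Subtype.val) IsInducing.subtypeVal |>.1
    (show IsInducing g from hg.isInducing)
  have hq : IsQuotientMap e := by
    refine (he.isOpenMap ?_).isQuotientMap he.continuous e.surjective
    rw [e.surjective.range_eq]; exact isOpen_univ
  let f₀ : LinearMap.range g →L[𝕜] 𝕜 := ⟨f.toLinearMap.comp e.symm.toLinearMap, by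
    refine hq.continuous_iff.2 ?_
    have : ((f.toLinearMap.comp e.symm.toLinearMap : LinearMap.range g →ₗ[𝕜] 𝕜) ∘ e) = f := by
      ext x; simp
    exact this ▸ f.continuous⟩
  obtain ⟨f', hf', -⟩ := exists_extension_norm_eq (LinearMap.range g) f₀
  refine ⟨f', fun x => ?_⟩
  exact (hf' (e x)).trans (by simp [f₀])

/-! ### Universal property of the unit group, and the Hausdorff criterion -/

namespace IsLCUnion

variable {𝕜 : Type*} [RCLike 𝕜] {A : ℕ → Type*} [∀ n, NormedRing (A n)]
  [∀ n, NormedAlgebra 𝕜 (A n)] {B : Type*} [Ring B] [Algebra 𝕜 B] [TopologicalSpace B]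
  {i : ∀ n, A n →ₐ[𝕜] B}

theorem unitGrpMap_injective (h : IsLCUnion 𝕜 i) (n : ℕ) :
    Function.Injective (UnitGrp.map (i n : A n →* B)) := fun _ _ hxy =>
  Subtype.ext (h.injective n (congrArg Subtype.val hxy))

theorem unitGrpMap_mono (h : IsLCUnion 𝕜 i) (n m : ℕ) (hnm : n ≤ m) (x : UnitGrp (A n)) :
    ∃ y : UnitGrp (A m), UnitGrp.map (i m : A m →* B) y = UnitGrp.map (i n : A n →* B) x := by
  obtain ⟨f, -, hf⟩ := h.bond n m hnm
  exact ⟨UnitGrp.map (f : A n →* A m) x, Subtype.ext (hf _)⟩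

theorem exists_unitGrpMap_eq (h : IsLCUnion 𝕜 i) (b : UnitGrp B) :
    ∃ n x, UnitGrp.map (i n : A n →* B) x = b := by
  have hb : (b : B) ∈ {b : B | IsUnit b} := b.2
  rw [h.isUnit_eq_iUnion] at hb
  obtain ⟨n, x, hx, hxb⟩ := mem_iUnion.1 hb
  exact ⟨n, ⟨x, hx⟩, Subtype.ext hxb⟩

theorem exists_glued_hom (h : IsLCUnion 𝕜 i) {H : Type*} [Group H]
    (ψ : ∀ n, UnitGrp (A n) →* H)
    (hψ : ∀ n x y, UnitGrp.map (i (n + 1) : A (n + 1) →* B) y = UnitGrp.map (i n : A n →* B) x →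
      ψ (n + 1) y = ψ n x) :
    ∃ φ : UnitGrp B →* H, ∀ n, φ.comp (UnitGrp.map (i n : A n →* B)) = ψ n := by
  obtain ⟨φ, hφ⟩ := exists_glued_map (fun n => UnitGrp.map (i n : A n →* B))
    h.unitGrpMap_injective h.unitGrpMap_mono h.exists_unitGrpMap_eq (fun n x => ψ n x) hψ
  refine ⟨MonoidHom.mk' φ fun a b => ?_, fun n => MonoidHom.ext fun x => hφ n x⟩
  obtain ⟨n, x, hx⟩ := h.exists_unitGrpMap_eq a
  obtain ⟨m, y, hy⟩ := h.exists_unitGrpMap_eq b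
  obtain ⟨x', hx'⟩ := h.unitGrpMap_mono n (max n m) (le_max_left _ _) x
  obtain ⟨y', hy'⟩ := h.unitGrpMap_mono m (max n m) (le_max_right _ _) y
  rw [← hx, ← hy, ← hx', ← hy', ← map_mul, hφ, hφ, hφ, map_mul]

/-- The preimages of a sequence of neighbourhoods as in `exists_seq_prod_mem` form a box; its
product set is an identity neighbourhood mapped into `V`. -/
theorem continuous_hom [∀ n, CompleteSpace (A n)] (h : IsLCUnion 𝕜 i) {H : Type*} [Group H]
    [TopologicalSpace H] [IsTopologicalGroup H] (φ : UnitGrp B →* H)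
    (hφ : ∀ n, Continuous (φ.comp (UnitGrp.map (i n : A n →* B)))) : Continuous φ := by
  have := h.isTopologicalGroup
  refine continuous_of_continuousAt_one φ ?_
  intro V hV
  rw [map_one] at hV
  obtain ⟨W, hW, hWV⟩ := exists_seq_prod_mem hV
  have hbox := WeakProd.box_mem_nhds
    (V := fun n => φ.comp (UnitGrp.map (i n : A n →* B)) ⁻¹' W n)
    fun n => (hφ n).continuousAt.preimage_mem_nhds (by rw [map_one]; exact hW n)
  rw [mem_map]
  filter_upwards [h.productSetsLarge _ hbox] with x hx
  obtain ⟨g, hg, rfl⟩ := hx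
  rw [mem_preimage, WeakProd.prodMap, map_list_prod, List.map_map]
  exact hWV _ hg _

theorem exists_unique_hom [∀ n, CompleteSpace (A n)] (h : IsLCUnion 𝕜 i) {H : Type*} [Group H]
    (j : ∀ n, A n →ₐ[𝕜] A (n + 1)) (hij : ∀ n x, i (n + 1) (j n x) = i n x)
    (ψ : ∀ n, UnitGrp (A n) →* H)
    (hψ : ∀ n, (ψ (n + 1)).comp (UnitGrp.map (j n : A n →* A (n + 1))) = ψ n) :
    ∃! φ : UnitGrp B →* H, ∀ n, φ.comp (UnitGrp.map (i n : A n →* B)) = ψ n := by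
  obtain ⟨φ, hφ⟩ := h.exists_glued_hom ψ fun n x y hxy => by
    rw [← hψ n, MonoidHom.comp_apply]
    congr 1
    refine h.unitGrpMap_injective (n + 1) (hxy.trans (Subtype.ext ?_))
    exact (hij n x).symm
  refine ⟨φ, hφ, fun φ' hφ' => MonoidHom.ext fun b => ?_⟩
  obtain ⟨n, x, rfl⟩ := h.exists_unitGrpMap_eq b
  exact (DFunLike.congr_fun (hφ' n) x).trans (DFunLike.congr_fun (hφ n) x).symm

theorem continuous_unitGrpMap {R S : Type*} [Ring R] [TopologicalSpace R] [Ring S]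
    [TopologicalSpace S] (f : R →* S) (hf : Continuous f) : Continuous (UnitGrp.map f) :=
  continuous_induced_rng.2 (hf.comp continuous_subtype_val)

theorem isTopGroupDirectLimit [∀ n, CompleteSpace (A n)] (h : IsLCUnion 𝕜 i)
    (j : ∀ n, A n →ₐ[𝕜] A (n + 1)) (hj : ∀ n, Continuous (j n))
    (hij : ∀ n x, i (n + 1) (j n x) = i n x) :
    IsTopGroupDirectLimit.{w}
      (fun n => UnitGrp.map (j n : A n →* A (n + 1))) (fun n => UnitGrp.map (i n : A n →* B)) where
  topGroup n := UnitGrp.isTopologicalGroup_of_normed (A n)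
  topGroup_limit := h.isTopologicalGroup
  continuous_bonding n := continuous_unitGrpMap _ (hj n)
  continuous_limitMap n := continuous_unitGrpMap _ (h.continuous_incl n)
  cone n := MonoidHom.ext fun x => Subtype.ext (hij n x)
  universal H _ _ _ ψ hψc hψ := by
    obtain ⟨φ, hφ, huniq⟩ := h.exists_unique_hom j hij ψ hψ
    refine ⟨φ, ⟨h.continuous_hom φ fun n => ?_, hφ⟩, fun φ' hφ' => huniq φ' hφ'.2⟩
    rw [hφ n]
    exact hψc n

/-- A functional not vanishing at `a` is extended successively from step `n` to all steps `n + k`.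
The glued functional has continuous absolute value, because this is a seminorm continuous on each
step, and it separates the given point from 0. -/
theorem t2Space_of_isEmbedding (h : IsLCUnion 𝕜 i)
    (j : ∀ n, A n →ₐ[𝕜] A (n + 1)) (hij : ∀ n x, i (n + 1) (j n x) = i n x)
    (hj : ∀ n, IsEmbedding (j n)) : T2Space B := by
  have := h.addGroup
  refine IsTopologicalAddGroup.t2Space_of_zero_sep fun b hb => ?_
  obtain ⟨n, a, rfl⟩ := h.exists_eq b
  have ha : a ≠ 0 := fun ha => hb (by rw [ha, map_zero])
  obtain ⟨f₀, -, hf₀⟩ := exists_dual_vector 𝕜 a (norm_ne_zero_iff.2 ha)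
  have step : ∀ k (f : A (n + k) →L[𝕜] 𝕜), ∃ f' : A (n + (k + 1)) →L[𝕜] 𝕜,
      ∀ x, f' (j (n + k) x) = f x :=
    fun k f => exists_extension_of_isEmbedding (j (n + k)).toLinearMap (hj (n + k)) f
  choose s hs using step
  let f : ∀ k, A (n + k) →L[𝕜] 𝕜 := fun k => Nat.rec f₀ s k
  have hmono : ∀ m m', m ≤ m' → ∀ x : A m, ∃ y, i m' y = i m x := fun m m' hm x => by
    obtain ⟨g, -, hg⟩ := h.bond m m' hm
    exact ⟨g x, hg x⟩
  have hex : ∀ b : B, ∃ k x, i (n + k) x = b := fun b => by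
    obtain ⟨m, x, rfl⟩ := h.exists_eq b
    exact ⟨m, hmono m (n + m) (Nat.le_add_left _ _) x⟩
  obtain ⟨φ, hφ⟩ := exists_glued_map (fun k => i (n + k)) (fun k => h.injective _)
    (fun k k' hk => hmono _ _ (Nat.add_le_add_left hk n)) hex (fun k x => f k x)
    (fun k x y hxy => by
      have : y = j (n + k) x := h.injective _ (hxy.trans (hij _ x).symm)
      rw [this]
      exact hs k (f k) x)
  have hpair : ∀ b c : B, ∃ k, ∃ x y, i (n + k) x = b ∧ i (n + k) y = c := fun b c => by
    obtain ⟨m, -, x, y, rfl, rfl⟩ := h.exists_common_pair b c 0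
    obtain ⟨x', hx'⟩ := hmono m (n + m) (Nat.le_add_left _ _) x
    obtain ⟨y', hy'⟩ := hmono m (n + m) (Nat.le_add_left _ _) y
    exact ⟨m, x', y', hx', hy'⟩
  let p : Seminorm 𝕜 B := Seminorm.of (fun b => ‖φ b‖)
    (fun b c => by
      obtain ⟨k, x, y, rfl, rfl⟩ := hpair b c
      rw [← map_add, hφ, hφ, hφ, map_add]
      exact norm_add_le _ _)
    (fun r b => by
      obtain ⟨k, x, rfl⟩ := hex b
      rw [← map_smul, hφ, hφ, map_smul, norm_smul])
  have hp : Continuous p := by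
    refine h.continuous_seminorm p fun m => ?_
    obtain ⟨g, hg, hgi⟩ := h.bond m (n + m) (Nat.le_add_left _ _)
    have : (fun x => p (i m x)) = fun x => ‖f m (g x)‖ := by
      funext x
      change ‖φ (i m x)‖ = _
      rw [← hgi, hφ]
    rw [this]
    exact ((f m).continuous.comp hg).norm
  have hpa : p (i n a) ≠ 0 := by
    have : φ (i n a) = f₀ a := hφ 0 a
    change ‖φ (i n a)‖ ≠ 0
    rw [this, hf₀]
    simpa using ha
  refine ⟨{b | p b < p (i n a)}, ?_, fun hlt => lt_irrefl (p (i n a)) hlt⟩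
  refine hp.tendsto 0 (gt_mem_nhds ?_)
  rw [map_zero]
  exact lt_of_le_of_ne (apply_nonneg p _) hpa.symm

end IsLCUnion

/-! ### Directional derivatives and the mean value inequality -/

section MeanValue

variable {𝕜 : Type*} [RCLike 𝕜] {F : Type*} [AddCommGroup F] [Module 𝕜 F] [TopologicalSpace F]

/-- The triangle inequality bounds the right slopes of the real function `s ↦ p (u s - u 0)` by
those of `u`, so the scalar comparison theorem applies without linear functionals. -/
theorem seminorm_sub_le_of_hasRightDeriv [IsTopologicalAddGroup F] (p : Seminorm 𝕜 F)
    (hp : Continuous p) {u u' : ℝ → F} {C : ℝ} (hu : ContinuousOn u (Icc 0 1))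
    (hd : ∀ s ∈ Ico (0 : ℝ) 1, Tendsto (fun z : ℝ => ((z - s : ℝ) : 𝕜)⁻¹ • (u z - u s))
      (𝓝[>] s) (𝓝 (u' s)))
    (hC : ∀ s ∈ Ico (0 : ℝ) 1, p (u' s) ≤ C) : p (u 1 - u 0) ≤ C := by
  have key := image_le_of_liminf_slope_right_le_deriv_boundary (f := fun s => p (u s - u 0))
    (a := 0) (b := 1) (B := fun s => C * s) (B' := fun _ => C)
    (hp.comp_continuousOn (hu.sub continuousOn_const)) (by simp)
    (by fun_prop) (fun x _ => by simpa using ((hasDerivAt_id x).const_mul C).hasDerivWithinAt)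
    (fun s hs r hr => ?_) (right_mem_Icc.2 zero_le_one)
  · simpa using key
  · have h1 := ((hp.tendsto _).comp (hd s hs)).eventually (gt_mem_nhds ((hC s hs).trans_lt hr))
    refine Eventually.frequently ?_
    filter_upwards [h1, self_mem_nhdsWithin] with z hz hzs
    have hzs : 0 < z - s := sub_pos.2 hzs
    refine lt_of_le_of_lt ?_ hz
    have h2 : p (u z - u 0) - p (u s - u 0) ≤ p (u z - u s) := by
      have := map_sub_le_add p (u z - u 0) (u s - u 0)
      have h3 := map_add_le_add p (u z - u s) (u s - u 0)
      rw [sub_add_sub_cancel] at h3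
      linarith
    rw [slope_def_field, Function.comp_apply, map_smul_eq_mul, norm_inv, RCLike.norm_ofReal,
      abs_of_pos hzs, div_eq_inv_mul]
    exact mul_le_mul_of_nonneg_left h2 (inv_nonneg.2 hzs.le)

theorem HasDirDeriv.unique {E : Type*} [AddCommGroup E] [Module 𝕜 E] [T2Space F]
    {f : E → F} {v v' : F} {x y : E} (h : HasDirDeriv 𝕜 f v x y) (h' : HasDirDeriv 𝕜 f v' x y) :
    v = v' :=
  tendsto_nhds_unique h h'

theorem dirDeriv_smul {E : Type*} [AddCommGroup E] [Module 𝕜 E] [ContinuousSMul 𝕜 F]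
    [T2Space F] {f : E → F} {v v' : F}
    {x y : E} {c : 𝕜} (h : HasDirDeriv 𝕜 f v x y) (h' : HasDirDeriv 𝕜 f v' x (c • y)) :
    v' = c • v := by
  refine tendsto_nhds_unique h' ?_
  rcases eq_or_ne c 0 with rfl | hc
  · simp
  · have hτ : Tendsto (fun t : 𝕜 => t * c) (𝓝[≠] 0) (𝓝[≠] 0) := by
      refine tendsto_nhdsWithin_iff.2 ⟨?_, ?_⟩
      · have : Continuous fun t : 𝕜 => t * c := by fun_prop
        simpa using (this.tendsto 0).mono_left nhdsWithin_le_nhds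
      · filter_upwards [self_mem_nhdsWithin] with t ht using mul_ne_zero ht hc
    refine ((h.comp hτ).const_smul c).congr fun t => ?_
    simp only [Function.comp_apply]
    rw [smul_smul, mul_inv_rev, ← mul_assoc, mul_inv_cancel₀ hc, one_mul, mul_smul]

variable {E : Type*} [AddCommGroup E] [Module 𝕜 E] [TopologicalSpace E] [IsTopologicalAddGroup E]
  [ContinuousSMul 𝕜 E]

variable (𝕜) in
theorem tendsto_add_smul (x y : E) : Tendsto (fun t : 𝕜 => x + t • y) (𝓝 0) (𝓝 x) := by
  have : Continuous fun t : 𝕜 => x + t • y := by fun_prop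
  simpa using this.tendsto 0

theorem HasDirDeriv.congr_of_eqOn {f g : E → F} {v : F} {x y : E} {U : Set E} (hU : IsOpen U)
    (hx : x ∈ U) (hfg : EqOn f g U) (h : HasDirDeriv 𝕜 f v x y) : HasDirDeriv 𝕜 g v x y := by
  refine Tendsto.congr' ?_ h
  filter_upwards [((tendsto_add_smul 𝕜 x y).eventually (hU.mem_nhds hx)).filter_mono
    nhdsWithin_le_nhds] with t ht
  rw [hfg ht, hfg hx]

/-- A form of strict differentiability: base point, direction and increment may all vary. The mean
value inequality is applied to `s ↦ f (a + s t w) - s t df (x, y)`, whose derivative is `t` times a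
small vector. -/
theorem tendsto_slope_of_continuousOn_dirDeriv [IsTopologicalAddGroup F] [ContinuousSMul 𝕜 F]
    [PolynormableSpace 𝕜 F] {f : E → F} {df : E × E → F} {U : Set E} (hU : IsOpen U)
    (hf : ContinuousOn f U) (hd : ∀ x ∈ U, ∀ y, HasDirDeriv 𝕜 f (df (x, y)) x y)
    (hdc : ContinuousOn df (U ×ˢ univ)) {ι : Type*} {l : Filter ι} {a w : ι → E} {t : ι → 𝕜}
    {x y : E} (hx : x ∈ U) (ha : Tendsto a l (𝓝 x)) (ht : Tendsto t l (𝓝 0))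
    (ht0 : ∀ᶠ k in l, t k ≠ 0) (hw : Tendsto w l (𝓝 y)) :
    Tendsto (fun k => (t k)⁻¹ • (f (a k + t k • w k) - f (a k))) l (𝓝 (df (x, y))) := by
  rw [(PolynormableSpace.withSeminorms 𝕜 F).tendsto_nhds]
  rintro ⟨p, hp⟩ ε hε
  have hS : {q : E × E | q.1 ∈ U ∧ p (df q - df (x, y)) < ε / 2} ∈ 𝓝 (x, y) := by
    have hUn : U ×ˢ univ ∈ 𝓝 (x, y) := (hU.prod isOpen_univ).mem_nhds ⟨hx, trivial⟩
    have h1 : Tendsto (fun q => p (df q - df (x, y))) (𝓝 (x, y)) (𝓝 0) := by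
      have := (hdc.continuousAt hUn).sub (continuousAt_const (y := df (x, y)))
      have h2 := (hp.tendsto _).comp this.tendsto
      rw [Pi.sub_apply, sub_self, map_zero] at h2
      exact h2
    filter_upwards [hUn, h1.eventually (gt_mem_nhds (half_pos hε))] with q hq hq'
    exact ⟨hq.1, hq'⟩
  have hΦ : Tendsto (fun q : E × 𝕜 × E => (q.1 + q.2.1 • q.2.2, q.2.2)) (𝓝 (x, 0, y))
      (𝓝 (x, y)) := by
    have : Continuous (fun q : E × 𝕜 × E => (q.1 + q.2.1 • q.2.2, q.2.2)) := by fun_prop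
    simpa using this.tendsto (x, 0, y)
  have hev := hΦ.eventually hS
  rw [nhds_prod_eq, nhds_prod_eq, eventually_prod_iff] at hev
  obtain ⟨pa, hpa, pr, hpr, hev⟩ := hev
  obtain ⟨pt, hpt, pw, hpw, hpr⟩ := eventually_prod_iff.1 hpr
  obtain ⟨δ, hδ, hδt⟩ := Metric.eventually_nhds_iff.1 hpt
  have htδ : ∀ᶠ k in l, ‖t k‖ < δ := by
    have := ht.norm
    rw [norm_zero] at this
    exact this.eventually (gt_mem_nhds hδ)
  filter_upwards [ha.eventually hpa, htδ, ht0, hw.eventually hpw] with k hak htk htk0 hwk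
  -- The smallness condition on the increment is a ball, so it passes from `t k` to `s * t k` and
  -- the estimate is uniform along the segment.
  have hmem : ∀ s ∈ Icc (0 : ℝ) 1, a k + ((s : 𝕜) * t k) • w k ∈ U ∧
      p (df (a k + ((s : 𝕜) * t k) • w k, w k) - df (x, y)) < ε / 2 := by
    intro s hs
    refine hev hak (hpr (hδt ?_) hwk)
    rw [dist_zero_right, norm_mul, RCLike.norm_ofReal, abs_of_nonneg hs.1]
    exact (mul_le_of_le_one_left (norm_nonneg _) hs.2).trans_lt htk
  have hpath : Continuous fun s : ℝ => a k + ((s : 𝕜) * t k) • w k := by fun_prop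
  have hmv := seminorm_sub_le_of_hasRightDeriv p hp
    (u := fun s => f (a k + ((s : 𝕜) * t k) • w k) - ((s : 𝕜) * t k) • df (x, y))
    (u' := fun s => t k • (df (a k + ((s : 𝕜) * t k) • w k, w k) - df (x, y)))
    (C := ‖t k‖ * (ε / 2)) ?_ ?_ ?_
  · have hb : p ((t k)⁻¹ • (f (a k + t k • w k) - f (a k)) - df (x, y)) =
        ‖t k‖⁻¹ * p (f (a k + t k • w k) - t k • df (x, y) - f (a k)) := by
      rw [← norm_inv, ← map_smul_eq_mul]
      congr 1
      rw [sub_right_comm, smul_sub _ (f _ - f _), inv_smul_smul₀ htk0]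
    have hmv' : p (f (a k + t k • w k) - t k • df (x, y) - f (a k)) ≤ ‖t k‖ * (ε / 2) := by
      simpa using hmv
    change p _ < ε
    rw [hb, inv_mul_lt_iff₀ (norm_pos_iff.2 htk0)]
    refine hmv'.trans_lt (mul_lt_mul_of_pos_left (half_lt_self hε) (norm_pos_iff.2 htk0))
  · refine ContinuousOn.sub (hf.comp hpath.continuousOn fun s hs => (hmem s hs).1) ?_
    exact Continuous.continuousOn (by fun_prop)
  · intro s hs
    have hs' := Ico_subset_Icc_self hs
    have hτ : Tendsto (fun z : ℝ => ((z - s : ℝ) : 𝕜) * t k) (𝓝[>] s) (𝓝[≠] 0) := by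
      refine tendsto_nhdsWithin_iff.2 ⟨?_, ?_⟩
      · have : Continuous fun z : ℝ => ((z - s : ℝ) : 𝕜) * t k := by fun_prop
        simpa using (this.tendsto s).mono_left nhdsWithin_le_nhds
      · filter_upwards [self_mem_nhdsWithin] with z hz
        exact mul_ne_zero (RCLike.ofReal_ne_zero.2 (sub_ne_zero.2 (ne_of_gt hz))) htk0
    have h1 := (((hd _ (hmem s hs').1 (w k)).comp hτ).sub_const (df (x, y))).const_smul (t k)
    refine h1.congr' ?_
    filter_upwards [self_mem_nhdsWithin] with z hz
    have hz0 : ((z - s : ℝ) : 𝕜) ≠ 0 := RCLike.ofReal_ne_zero.2 (sub_ne_zero.2 (ne_of_gt hz))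
    have hpt : a k + ((s : 𝕜) * t k) • w k + (((z - s : ℝ) : 𝕜) * t k) • w k =
        a k + ((z : 𝕜) * t k) • w k := by
      rw [add_assoc, ← add_smul, ← add_mul, RCLike.ofReal_sub, add_sub_cancel]
    simp only [Function.comp_apply]
    rw [hpt, smul_sub, smul_smul, mul_inv_rev, ← mul_assoc, mul_inv_cancel₀ htk0, one_mul,
      sub_sub_sub_comm, smul_sub _ (f _ - f _), ← sub_smul, ← sub_mul, ← RCLike.ofReal_sub,
      mul_smul ((z - s : ℝ) : 𝕜), inv_smul_smul₀ hz0]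
  · intro s hs
    rw [map_smul_eq_mul]
    exact mul_le_mul_of_nonneg_left (hmem s (Ico_subset_Icc_self hs)).2.le (norm_nonneg _)

/-- Split the increment as first `t y`, then `t z`; the second quotient has moving base point `x + t
y`, which the strict form permits. -/
theorem dirDeriv_add_of_continuousOn [IsTopologicalAddGroup F] [ContinuousSMul 𝕜 F]
    [PolynormableSpace 𝕜 F] [T2Space F] {f : E → F} {df : E × E → F} {U : Set E} (hU : IsOpen U)
    (hf : ContinuousOn f U) (hd : ∀ x ∈ U, ∀ y, HasDirDeriv 𝕜 f (df (x, y)) x y)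
    (hdc : ContinuousOn df (U ×ˢ univ)) {x : E} (hx : x ∈ U) (y z : E) :
    df (x, y + z) = df (x, y) + df (x, z) := by
  have h0 : Tendsto (fun t : 𝕜 => t) (𝓝[≠] 0) (𝓝 0) := nhdsWithin_le_nhds
  have h1 := tendsto_slope_of_continuousOn_dirDeriv hU hf hd hdc (l := 𝓝[≠] (0 : 𝕜))
    (a := fun t => x + t • y) (w := fun _ => z) (t := fun t => t) hx
    ((tendsto_add_smul 𝕜 x y).mono_left nhdsWithin_le_nhds) h0 self_mem_nhdsWithin
    tendsto_const_nhds
  refine tendsto_nhds_unique (hd x hx (y + z)) ?_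
  refine ((hd x hx y).add h1).congr fun t => ?_
  rw [← smul_add, add_comm (f _ - f _), sub_add_sub_cancel, add_assoc x, ← smul_add]

end MeanValue

/-! ### Recursive form of Keller's differentiability classes -/

/-- `f` is `C^k` on `U` in the sense of Bastiani: recursively, `f` is continuous and has directional
derivatives which form a `C^(k-1)` map on `U × E`. -/
def IsBastianiCkOn (𝕜 : Type*) [RCLike 𝕜] {F : Type v} [AddCommGroup F] [Module 𝕜 F]
    [TopologicalSpace F] : ℕ → ∀ {E : Type u} [AddCommGroup E] [Module 𝕜 E] [TopologicalSpace E],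
      (E → F) → Set E → Prop
  | 0, _, _, _, _, f, U => ContinuousOn f U
  | k + 1, E, _, _, _, f, U => ContinuousOn f U ∧ ∃ df : E × E → F,
      (∀ x ∈ U, ∀ y, HasDirDeriv 𝕜 f (df (x, y)) x y) ∧ IsBastianiCkOn 𝕜 k df (U ×ˢ univ)

namespace IsBastianiCkOn

section Basic

variable {𝕜 : Type*} [RCLike 𝕜] {F : Type v} [AddCommGroup F] [Module 𝕜 F] [TopologicalSpace F]
  {G : Type v'} [AddCommGroup G] [Module 𝕜 G] [TopologicalSpace G]

theorem continuousOn {k : ℕ} {E : Type u} [AddCommGroup E] [Module 𝕜 E] [TopologicalSpace E]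
    {f : E → F} {U : Set E} (h : IsBastianiCkOn 𝕜 k f U) : ContinuousOn f U := by
  cases k with
  | zero => exact h
  | succ k => exact h.1

theorem mono {k : ℕ} {E : Type u} [AddCommGroup E] [Module 𝕜 E] [TopologicalSpace E]
    {f : E → F} {U V : Set E} (h : IsBastianiCkOn 𝕜 k f U) (hV : V ⊆ U) :
    IsBastianiCkOn 𝕜 k f V := by
  induction k generalizing E with
  | zero => exact ContinuousOn.mono h hV
  | succ k ih =>
    obtain ⟨h1, df, h2, h3⟩ := h
    exact ⟨h1.mono hV, df, fun x hx => h2 x (hV hx), ih h3 (prod_mono hV subset_rfl)⟩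

theorem of_succ {k : ℕ} {E : Type u} [AddCommGroup E] [Module 𝕜 E] [TopologicalSpace E]
    {f : E → F} {U : Set E} (h : IsBastianiCkOn 𝕜 (k + 1) f U) : IsBastianiCkOn 𝕜 k f U := by
  induction k generalizing E with
  | zero => exact h.1
  | succ k ih =>
    obtain ⟨h1, df, h2, h3⟩ := h
    exact ⟨h1, df, h2, ih h3⟩

theorem congr {k : ℕ} {E : Type u} [AddCommGroup E] [Module 𝕜 E] [TopologicalSpace E]
    [IsTopologicalAddGroup E] [ContinuousSMul 𝕜 E]
    {f g : E → F} {U : Set E} (h : IsBastianiCkOn 𝕜 k f U) (hU : IsOpen U) (hfg : EqOn f g U) :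
    IsBastianiCkOn 𝕜 k g U := by
  cases k with
  | zero => exact ContinuousOn.congr h hfg.symm
  | succ k =>
    obtain ⟨h1, df, h2, h3⟩ := h
    exact ⟨h1.congr hfg.symm, df, fun x hx y => (h2 x hx y).congr_of_eqOn hU hx hfg, h3⟩

theorem continuousLinearMap (k : ℕ) {E : Type u} [AddCommGroup E] [Module 𝕜 E]
    [TopologicalSpace E] (L : E →L[𝕜] F) (U : Set E) : IsBastianiCkOn 𝕜 k L U := by
  induction k generalizing E with
  | zero => exact L.continuous.continuousOn
  | succ k ih =>
    refine ⟨L.continuous.continuousOn, _, fun x _ y => ?_,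
      ih (L.comp (ContinuousLinearMap.snd 𝕜 E E)) _⟩
    refine tendsto_const_nhds.congr' ?_
    filter_upwards [self_mem_nhdsWithin] with t ht
    have ht : t ≠ 0 := ht
    simp [ht]

theorem const (k : ℕ) {E : Type u} [AddCommGroup E] [Module 𝕜 E]
    [TopologicalSpace E] (c : F) (U : Set E) : IsBastianiCkOn 𝕜 k (fun _ : E => c) U := by
  induction k generalizing E c with
  | zero => exact continuousOn_const
  | succ k ih =>
    refine ⟨continuousOn_const, fun _ => 0, fun x _ y => ?_, ih 0 _⟩
    simp [HasDirDeriv, tendsto_const_nhds]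

theorem prodMk {k : ℕ} {E : Type u} [AddCommGroup E] [Module 𝕜 E] [TopologicalSpace E]
    {f : E → F} {g : E → G} {U : Set E} (hf : IsBastianiCkOn 𝕜 k f U)
    (hg : IsBastianiCkOn 𝕜 k g U) : IsBastianiCkOn 𝕜 k (fun x => (f x, g x)) U := by
  induction k generalizing E with
  | zero => exact ContinuousOn.prodMk hf hg
  | succ k ih =>
    obtain ⟨hf1, df, hf2, hf3⟩ := hf
    obtain ⟨hg1, dg, hg2, hg3⟩ := hg
    exact ⟨hf1.prodMk hg1, fun q => (df q, dg q),
      fun x hx y => (hf2 x hx y).prodMk_nhds (hg2 x hx y), ih hf3 hg3⟩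

theorem comp_continuousLinearMap {k : ℕ} {E : Type u} [AddCommGroup E] [Module 𝕜 E]
    [TopologicalSpace E] {E' : Type u'} [AddCommGroup E'] [Module 𝕜 E'] [TopologicalSpace E']
    {f : E → F} {U : Set E} (hf : IsBastianiCkOn 𝕜 k f U) (L : E' →L[𝕜] E) {V : Set E'}
    (hV : MapsTo L V U) : IsBastianiCkOn 𝕜 k (fun x => f (L x)) V := by
  induction k generalizing E E' with
  | zero => exact ContinuousOn.comp hf L.continuous.continuousOn hV
  | succ k ih =>
    obtain ⟨hf1, df, hf2, hf3⟩ := hf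
    refine ⟨hf1.comp L.continuous.continuousOn hV, fun q => df (L.prodMap L q), fun x hx y => ?_,
      ih hf3 (L.prodMap L) fun q hq => ⟨hV hq.1, trivial⟩⟩
    refine (hf2 (L x) (hV hx) (L y)).congr fun t => ?_
    simp

theorem continuousLinearMap_comp {k : ℕ} {E : Type u} [AddCommGroup E] [Module 𝕜 E]
    [TopologicalSpace E] {f : E → F} {U : Set E} (hf : IsBastianiCkOn 𝕜 k f U) (L : F →L[𝕜] G) :
    IsBastianiCkOn 𝕜 k (fun x => L (f x)) U := by
  induction k generalizing E with
  | zero => exact L.continuous.comp_continuousOn hf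
  | succ k ih =>
    obtain ⟨hf1, df, hf2, hf3⟩ := hf
    refine ⟨L.continuous.comp_continuousOn hf1, fun q => L (df q), fun x hx y => ?_, ih hf3⟩
    refine ((L.continuous.tendsto _).comp (hf2 x hx y)).congr fun t => ?_
    simp

theorem add [IsTopologicalAddGroup F] {k : ℕ} {E : Type u} [AddCommGroup E] [Module 𝕜 E]
    [TopologicalSpace E] {f g : E → F} {U : Set E} (hf : IsBastianiCkOn 𝕜 k f U)
    (hg : IsBastianiCkOn 𝕜 k g U) : IsBastianiCkOn 𝕜 k (fun x => f x + g x) U :=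
  (hf.prodMk hg).continuousLinearMap_comp
    (ContinuousLinearMap.fst 𝕜 F F + ContinuousLinearMap.snd 𝕜 F F)

theorem neg [IsTopologicalAddGroup F] {k : ℕ} {E : Type u} [AddCommGroup E] [Module 𝕜 E]
    [TopologicalSpace E] {f : E → F} {U : Set E} (hf : IsBastianiCkOn 𝕜 k f U) :
    IsBastianiCkOn 𝕜 k (fun x => -f x) U :=
  hf.continuousLinearMap_comp (-ContinuousLinearMap.id 𝕜 F)

theorem sum [IsTopologicalAddGroup F] {k : ℕ} {E : Type u} [AddCommGroup E] [Module 𝕜 E]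
    [TopologicalSpace E] {ι : Type*} {s : Finset ι} {f : ι → E → F} {U : Set E}
    (hf : ∀ m ∈ s, IsBastianiCkOn 𝕜 k (f m) U) :
    IsBastianiCkOn 𝕜 k (fun x => ∑ m ∈ s, f m x) U := by
  classical
  induction s using Finset.induction_on with
  | empty => simpa using const k (0 : F) U
  | insert a s ha ih =>
    simp only [Finset.sum_insert ha]
    exact (hf a (Finset.mem_insert_self _ _)).add
      (ih fun m hm => hf m (Finset.mem_insert_of_mem hm))

end Basic

section Comp

variable {𝕜 : Type*} [RCLike 𝕜] {F : Type v} [AddCommGroup F] [Module 𝕜 F] [TopologicalSpace F]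
  [IsTopologicalAddGroup F] [ContinuousSMul 𝕜 F] [PolynormableSpace 𝕜 F]

/-- Writing `g (x + t y) = g x + t w_t`, the directions `w_t` converge to `g'`, and the strict form
of differentiability applies to `f`. -/
theorem hasDirDeriv_comp {E : Type u} [AddCommGroup E] [Module 𝕜 E] [TopologicalSpace E]
    {E' : Type u'} [AddCommGroup E'] [Module 𝕜 E'] [TopologicalSpace E']
    [IsTopologicalAddGroup E] [ContinuousSMul 𝕜 E]
    {f : E → F} {df : E × E → F} {g : E' → E} {x y : E'} {g' : E} {V : Set E} (hV : IsOpen V)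
    (hf : ContinuousOn f V) (hd : ∀ x ∈ V, ∀ y, HasDirDeriv 𝕜 f (df (x, y)) x y)
    (hdc : ContinuousOn df (V ×ˢ univ)) (hx : g x ∈ V) (hg : HasDirDeriv 𝕜 g g' x y) :
    HasDirDeriv 𝕜 (fun z => f (g z)) (df (g x, g')) x y := by
  have h1 := tendsto_slope_of_continuousOn_dirDeriv hV hf hd hdc (l := 𝓝[≠] (0 : 𝕜))
    (a := fun _ => g x) (t := fun t => t) hx tendsto_const_nhds nhdsWithin_le_nhds
    self_mem_nhdsWithin hg
  refine h1.congr' ?_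
  filter_upwards [self_mem_nhdsWithin] with t ht
  have ht : t ≠ 0 := ht
  rw [smul_inv_smul₀ ht, add_sub_cancel]

/-- The derivative `(x, y) ↦ df (g x, dg (x, y))` is again a composition, of maps of one order less.
-/
theorem comp {k : ℕ} {E : Type u} [AddCommGroup E] [Module 𝕜 E] [TopologicalSpace E]
    [IsTopologicalAddGroup E] [ContinuousSMul 𝕜 E]
    {E' : Type u'} [AddCommGroup E'] [Module 𝕜 E'] [TopologicalSpace E']
    {f : E → F} {g : E' → E} {U : Set E'} {V : Set E} (hf : IsBastianiCkOn 𝕜 k f V)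
    (hg : IsBastianiCkOn 𝕜 k g U) (hV : IsOpen V) (hUV : MapsTo g U V) :
    IsBastianiCkOn 𝕜 k (fun x => f (g x)) U := by
  induction k generalizing E E' with
  | zero => exact ContinuousOn.comp hf hg hUV
  | succ k ih =>
    have hg' := hg.of_succ
    obtain ⟨hf1, df, hf2, hf3⟩ := hf
    obtain ⟨hg1, dg, hg2, hg3⟩ := hg
    refine ⟨hf1.comp hg1 hUV, fun q => df (g q.1, dg q),
      fun x hx y => hasDirDeriv_comp hV hf1 hf2 hf3.continuousOn (hUV hx) (hg2 x hx y), ?_⟩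
    exact ih hf3 ((hg'.comp_continuousLinearMap (ContinuousLinearMap.fst 𝕜 E' E')
      fun q hq => hq.1).prodMk hg3) (hV.prod isOpen_univ) fun q hq => ⟨hUV hq.1, trivial⟩

end Comp

end IsBastianiCkOn

open Classical in
/-- The iterated directional derivatives of a map. -/
noncomputable def iteratedDirDeriv (𝕜 : Type*) [RCLike 𝕜] {E : Type u} [AddCommGroup E]
    [Module 𝕜 E] {F : Type v} [AddCommGroup F] [Module 𝕜 F] [TopologicalSpace F] (f : E → F) :
    ∀ k : ℕ, E → (Fin k → E) → F
  | 0, x, _ => f x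
  | k + 1, x, y => Classical.epsilon fun v =>
      HasDirDeriv 𝕜 (fun x' => iteratedDirDeriv 𝕜 f k x' (Fin.tail y)) v x (y 0)

theorem iteratedDirDeriv_succ {𝕜 : Type*} [RCLike 𝕜] {E : Type u} [AddCommGroup E] [Module 𝕜 E]
    {F : Type v} [AddCommGroup F] [Module 𝕜 F] [TopologicalSpace F] {f : E → F} {k : ℕ} {x : E} {y : Fin (k + 1) → E} {v : F}
    (h : HasDirDeriv 𝕜 (fun x' => iteratedDirDeriv 𝕜 f k x' (Fin.tail y)) v x (y 0)) :
    HasDirDeriv 𝕜 (fun x' => iteratedDirDeriv 𝕜 f k x' (Fin.tail y))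
      (iteratedDirDeriv 𝕜 f (k + 1) x y) x (y 0) :=
  Classical.epsilon_spec (p := fun v =>
    HasDirDeriv 𝕜 (fun x' => iteratedDirDeriv 𝕜 f k x' (Fin.tail y)) v x (y 0)) ⟨v, h⟩

/-! ### Equivalence of the iterated and the recursive notion of smoothness -/

section Comparison

variable {𝕜 : Type*} [RCLike 𝕜] {E : Type u} [AddCommGroup E] [Module 𝕜 E] [TopologicalSpace E]
  [IsTopologicalAddGroup E] [ContinuousSMul 𝕜 E]
  {F : Type v} [AddCommGroup F] [Module 𝕜 F] [TopologicalSpace F]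

/-- `f` is `C^k` in the sense of Bastiani, for all `k`. -/
def IsBastianiSmoothOn (𝕜 : Type*) [RCLike 𝕜] {E : Type u} [AddCommGroup E] [Module 𝕜 E]
    [TopologicalSpace E] {F : Type v} [AddCommGroup F] [Module 𝕜 F] [TopologicalSpace F]
    (f : E → F) (U : Set E) : Prop := ∀ k, IsBastianiCkOn 𝕜 k f U

theorem IsBastianiSmoothOn.congr {f g : E → F} {U : Set E} (h : IsBastianiSmoothOn 𝕜 f U)
    (hU : IsOpen U) (hfg : EqOn f g U) : IsBastianiSmoothOn 𝕜 g U :=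
  fun k => (h k).congr hU hfg

/-- Derivatives are unique in a Hausdorff space, so one and the same `df` serves every order. -/
theorem IsBastianiSmoothOn.exists_deriv [T2Space F] {f : E → F} {U : Set E}
    (h : IsBastianiSmoothOn 𝕜 f U) (hU : IsOpen U) :
    ∃ df : E × E → F, (∀ x ∈ U, ∀ y, HasDirDeriv 𝕜 f (df (x, y)) x y) ∧
      IsBastianiSmoothOn 𝕜 df (U ×ˢ univ) := by
  obtain ⟨-, df, hdf, -⟩ := h 1
  refine ⟨df, hdf, fun k => ?_⟩
  obtain ⟨-, df', hdf', h'⟩ := h (k + 1)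
  exact h'.congr (hU.prod isOpen_univ)
    fun q hq => (hdf' q.1 hq.1 q.2).unique (hdf q.1 hq.1 q.2)

/-- `(x, y) ↦ ((x, tail y), (y 0, 0))`. -/
noncomputable def tailHeadCLM (𝕜 E : Type*) [RCLike 𝕜] [AddCommGroup E] [Module 𝕜 E]
    [TopologicalSpace E] (k : ℕ) :
    (E × (Fin (k + 1) → E)) →L[𝕜] (E × (Fin k → E)) × (E × (Fin k → E)) :=
  ((ContinuousLinearMap.fst 𝕜 E _).prod (ContinuousLinearMap.pi fun m : Fin k =>
    (ContinuousLinearMap.proj m.succ).comp (ContinuousLinearMap.snd 𝕜 E (Fin (k + 1) → E)))).prod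
  (((ContinuousLinearMap.proj 0).comp (ContinuousLinearMap.snd 𝕜 E (Fin (k + 1) → E))).prod 0)

/-- The next iterated derivative is the derivative of the map `(x, tail y) ↦ D_{tail y} f (x)` in
direction `(y 0, 0)`, with the vectors in `tail y` kept fixed; the passage to these arguments is
linear. -/
theorem IsBastianiSmoothOn.iteratedDirDeriv [T2Space F] {f : E → F} {U : Set E}
    (h : IsBastianiSmoothOn 𝕜 f U) (hU : IsOpen U) (k : ℕ) :
    IsBastianiSmoothOn 𝕜 (fun q : E × (Fin k → E) => iteratedDirDeriv 𝕜 f k q.1 q.2)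
        (U ×ˢ univ) ∧
      ∀ x ∈ U, ∀ y : Fin (k + 1) → E,
        HasDirDeriv 𝕜 (fun x' => _root_.iteratedDirDeriv 𝕜 f k x' (Fin.tail y))
          (_root_.iteratedDirDeriv 𝕜 f (k + 1) x y) x (y 0) := by
  have key : ∀ k, IsBastianiSmoothOn 𝕜
      (fun q : E × (Fin k → E) => _root_.iteratedDirDeriv 𝕜 f k q.1 q.2) (U ×ˢ univ) →
      ∃ df : (E × (Fin k → E)) × (E × (Fin k → E)) → F,
        IsBastianiSmoothOn 𝕜 df ((U ×ˢ univ) ×ˢ univ) ∧ ∀ x ∈ U, ∀ y : Fin (k + 1) → E,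
        HasDirDeriv 𝕜 (fun x' => _root_.iteratedDirDeriv 𝕜 f k x' (Fin.tail y))
          (df (tailHeadCLM 𝕜 E k (x, y))) x (y 0) := by
    intro k hk
    obtain ⟨df, hdf, hdfs⟩ := hk.exists_deriv (hU.prod isOpen_univ)
    refine ⟨df, hdfs, fun x hx y => ?_⟩
    refine (hdf (x, Fin.tail y) ⟨hx, trivial⟩ (y 0, 0)).congr fun t => ?_
    simp
  have hs : ∀ k, IsBastianiSmoothOn 𝕜
      (fun q : E × (Fin k → E) => _root_.iteratedDirDeriv 𝕜 f k q.1 q.2) (U ×ˢ univ) := by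
    intro k
    induction k with
    | zero =>
      exact fun r => (h r).comp_continuousLinearMap (ContinuousLinearMap.fst 𝕜 E (Fin 0 → E))
        fun q hq => hq.1
    | succ k ih =>
      obtain ⟨df, hdfs, hdf⟩ := key k ih
      refine IsBastianiSmoothOn.congr (f := fun q => df (tailHeadCLM 𝕜 E k q)) (fun r =>
        (hdfs r).comp_continuousLinearMap (tailHeadCLM 𝕜 E k) fun q hq => ⟨⟨hq.1, trivial⟩, trivial⟩)
        (hU.prod isOpen_univ) fun q hq => ?_
      exact (hdf q.1 hq.1 q.2).unique (iteratedDirDeriv_succ (hdf q.1 hq.1 q.2))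
  refine ⟨hs k, fun x hx y => ?_⟩
  obtain ⟨df, -, hdf⟩ := key k (hs k)
  exact iteratedDirDeriv_succ (hdf x hx y)

theorem IsBastianiSmoothOn.isKellerCrOn [T2Space F] {f : E → F} {U : Set E}
    (h : IsBastianiSmoothOn 𝕜 f U) (hU : IsOpen U) (r : ℕ∞) : IsKellerCrOn 𝕜 r f U :=
  ⟨_root_.iteratedDirDeriv 𝕜 f, fun _ _ _ => rfl, fun k _ => (h.iteratedDirDeriv hU k).2,
    fun k _ => ((h.iteratedDirDeriv hU k).1 0)⟩

/-- In the first slot this is homogeneity of a directional derivative; in the other slots the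
identity holds one order lower and is differentiated. -/
theorem keller_update_smul [ContinuousSMul 𝕜 F] [T2Space F] {U : Set E}
    {d : ∀ k : ℕ, E → (Fin k → E) → F} (hU : IsOpen U)
    (hd : ∀ k, ∀ x ∈ U, ∀ y : Fin (k + 1) → E,
      HasDirDeriv 𝕜 (fun x' => d k x' (Fin.tail y)) (d (k + 1) x y) x (y 0))
    (k : ℕ) (x : E) (hx : x ∈ U) (y : Fin k → E) (m : Fin k) (c : 𝕜) (a : E) :
    d k x (Function.update y m (c • a)) = c • d k x (Function.update y m a) := by
  induction k generalizing x with
  | zero => exact m.elim0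
  | succ k ih =>
    have hd' : ∀ z : Fin (k + 1) → E, _ := fun z => hd k x hx z
    refine m.cases ?_ fun m => ?_
    · have h1 := hd' (Function.update y 0 a)
      have h2 := hd' (Function.update y 0 (c • a))
      rw [Fin.tail_update_zero, Function.update_self] at h1 h2
      exact dirDeriv_smul h1 h2
    · have h1 := hd' (Function.update y m.succ a)
      have h3 := hd' (Function.update y m.succ (c • a))
      rw [Fin.tail_update_succ, Function.update_of_ne (Fin.succ_ne_zero m).symm] at h1 h3
      refine h3.unique (HasDirDeriv.congr_of_eqOn hU hx (fun x' hx' => (ih x' hx' (Fin.tail y) m).symm)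
        ((Tendsto.const_smul h1 c).congr fun t => ?_))
      rw [← smul_sub, smul_comm]

section KellerToBastiani

variable [IsTopologicalAddGroup F] [ContinuousSMul 𝕜 F] [PolynormableSpace 𝕜 F] [T2Space F]
  {U : Set E} {d : ∀ k : ℕ, E → (Fin k → E) → F}

theorem keller_update_add (hU : IsOpen U)
    (hd : ∀ k, ∀ x ∈ U, ∀ y : Fin (k + 1) → E,
      HasDirDeriv 𝕜 (fun x' => d k x' (Fin.tail y)) (d (k + 1) x y) x (y 0))
    (hc : ∀ k, ContinuousOn (fun q : E × (Fin k → E) => d k q.1 q.2) (U ×ˢ univ))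
    (k : ℕ) (x : E) (hx : x ∈ U) (y : Fin k → E) (m : Fin k) (a b : E) :
    d k x (Function.update y m (a + b)) =
      d k x (Function.update y m a) + d k x (Function.update y m b) := by
  induction k generalizing x with
  | zero => exact m.elim0
  | succ k ih =>
    have hd' : ∀ z : Fin (k + 1) → E, _ := fun z => hd k x hx z
    refine m.cases ?_ fun m => ?_
    · have hcy : Continuous fun x' : E => (x', Fin.tail y) := by fun_prop
      have hcy' : Continuous fun q : E × E => (q.1, (Fin.cons q.2 (Fin.tail y) : Fin (k + 1) → E)) :=
        by fun_prop
      have := dirDeriv_add_of_continuousOn (𝕜 := 𝕜) (f := fun x' => d k x' (Fin.tail y))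
        (df := fun q => d (k + 1) q.1 (Fin.cons q.2 (Fin.tail y))) hU
        ((hc k).comp hcy.continuousOn fun x' hx' => ⟨hx', trivial⟩)
        (fun x' hx' z => by simpa using hd k x' hx' (Fin.cons z (Fin.tail y)))
        ((hc (k + 1)).comp hcy'.continuousOn fun q hq => ⟨hq.1, trivial⟩) hx a b
      have hup : ∀ c : E, Function.update y 0 c = Fin.cons c (Fin.tail y) := fun c => by
        rw [← Fin.update_cons_zero (y 0), Fin.cons_self_tail]
      simpa only [hup] using this
    · have h1 := hd' (Function.update y m.succ a)
      have h2 := hd' (Function.update y m.succ b)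
      have h3 := hd' (Function.update y m.succ (a + b))
      rw [Fin.tail_update_succ, Function.update_of_ne (Fin.succ_ne_zero m).symm] at h1 h2 h3
      refine h3.unique (HasDirDeriv.congr_of_eqOn hU hx (fun x' hx' => (ih x' hx' (Fin.tail y) m).symm)
        ((h1.add h2).congr fun t => ?_))
      rw [← smul_add, add_sub_add_comm]

/-- The total derivative of a map that is multilinear in `y`: one term for the change of `x`, and
one for each slot of `y`. -/
theorem keller_hasDirDeriv (hU : IsOpen U)
    (hd : ∀ k, ∀ x ∈ U, ∀ y : Fin (k + 1) → E,
      HasDirDeriv 𝕜 (fun x' => d k x' (Fin.tail y)) (d (k + 1) x y) x (y 0))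
    (hc : ∀ k, ContinuousOn (fun q : E × (Fin k → E) => d k q.1 q.2) (U ×ˢ univ))
    (k : ℕ) (x : E) (hx : x ∈ U) (y : Fin k → E) (x' : E) (y' : Fin k → E) :
    HasDirDeriv 𝕜 (fun q : E × (Fin k → E) => d k q.1 q.2)
      (d (k + 1) x (Fin.cons x' y) + ∑ m, d k x (Function.update y m (y' m))) (x, y) (x', y') := by
  -- `Y t m` has its first `m` entries already moved to `y + t y'`. The increment in `y` telescopes
  -- along `m`, and multilinearity extracts the factor `t`.
  let Y : 𝕜 → ℕ → Fin k → E := fun t m l => if (l : ℕ) < m then y l + t • y' l else y l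
  have hY0 : ∀ t, Y t 0 = y := fun t => by ext l; simp [Y]
  have hYk : ∀ t, Y t k = y + t • y' := fun t => by ext l; simp [Y]
  have hYs : ∀ t (m : Fin k), Y t (m + 1) = Function.update (Y t m) m (y m + t • y' m) := by
    intro t m
    ext l
    rcases eq_or_ne l m with rfl | hl
    · simp [Y]
    · have : (l : ℕ) ≠ m := fun h => hl (Fin.ext h)
      have h2 : (l : ℕ) < m + 1 ↔ (l : ℕ) < m := by omega
      simp [Y, Function.update_of_ne hl, h2]
  have hYm : ∀ t (m : Fin k), Function.update (Y t m) m (y m) = Y t m := by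
    intro t m
    have : Y t m m = y m := by simp [Y]
    rw [← this, Function.update_eq_self]
  have hsum : ∀ t, x + t • x' ∈ U → d k (x + t • x') (y + t • y') - d k (x + t • x') y =
      t • ∑ m : Fin k, d k (x + t • x') (Function.update (Y t m) m (y' m)) := by
    intro t ht
    rw [← hYk, ← hY0 t, ← Finset.sum_range_sub (fun m => d k (x + t • x') (Y t m)),
      Finset.sum_range, Finset.smul_sum]
    refine Finset.sum_congr rfl fun m _ => ?_
    rw [hYs, keller_update_add hU hd hc k _ ht, hYm, keller_update_smul hU hd k _ ht,
      add_sub_cancel_left]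
  have hxt : ∀ᶠ t in 𝓝[≠] (0 : 𝕜), x + t • x' ∈ U :=
    ((tendsto_add_smul 𝕜 x x').eventually (hU.mem_nhds hx)).filter_mono nhdsWithin_le_nhds
  have h1 : Tendsto (fun t : 𝕜 => t⁻¹ • (d k (x + t • x') y - d k x y)) (𝓝[≠] 0)
      (𝓝 (d (k + 1) x (Fin.cons x' y))) := by
    simpa [HasDirDeriv] using hd k x hx (Fin.cons x' y)
  have h2 : Tendsto (fun t : 𝕜 => ∑ m : Fin k,
      d k (x + t • x') (Function.update (Y t m) m (y' m))) (𝓝[≠] 0)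
      (𝓝 (∑ m, d k x (Function.update y m (y' m)))) := by
    refine tendsto_finsetSum _ fun m _ => ?_
    have hYc : Continuous fun t : 𝕜 => Y t m := by
      refine continuous_pi fun l => ?_
      by_cases hl : (l : ℕ) < m
      · simp only [Y, hl, if_true]; fun_prop
      · simp only [Y, hl, if_false]; fun_prop
    have hcm : Continuous fun t : 𝕜 => (x + t • x', Function.update (Y t m) m (y' m)) :=
      (by fun_prop : Continuous fun t : 𝕜 => x + t • x').prodMk
        (hYc.update m continuous_const)
    have hlim := hcm.tendsto 0
    have hY00 : Y 0 m = y := by ext l; simp [Y]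
    simp only [zero_smul, add_zero, hY00] at hlim
    exact ((((hc k).continuousAt ((hU.prod isOpen_univ).mem_nhds ⟨hx, trivial⟩)).tendsto).comp
      hlim).mono_left nhdsWithin_le_nhds
  refine (h1.add h2).congr' ?_
  filter_upwards [hxt, self_mem_nhdsWithin] with t ht ht0
  have ht0 : t ≠ 0 := ht0
  have hs := hsum t ht
  rw [← inv_smul_smul₀ ht0 (∑ m : Fin k, _), ← hs, ← smul_add, add_comm, sub_add_sub_cancel]
  rfl

/-- Induction on the order for all iterated derivatives simultaneously: the derivative of the `k`-th
one is a sum of `(k + 1)`-st and `k`-th ones composed with continuous linear maps. -/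
theorem IsKellerCrOn.isBastianiSmoothOn {f : E → F} (h : IsKellerCrOn 𝕜 ⊤ f U) (hU : IsOpen U) :
    IsBastianiSmoothOn 𝕜 f U := by
  obtain ⟨d, hd0, hd, hc⟩ := h
  replace hd := fun k => hd k le_top
  replace hc := fun k => hc k le_top
  have key : ∀ r k, IsBastianiCkOn 𝕜 r (fun q : E × (Fin k → E) => d k q.1 q.2) (U ×ˢ univ) := by
    intro r
    induction r with
    | zero => exact hc
    | succ r ih =>
      intro k
      refine ⟨hc k, fun q => d (k + 1) q.1.1 (Fin.cons q.2.1 q.1.2) +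
        ∑ m, d k q.1.1 (Function.update q.1.2 m (q.2.2 m)),
        fun x hx y => keller_hasDirDeriv hU hd hc k x.1 hx.1 x.2 y.1 y.2, ?_⟩
      let P := E × (Fin k → E)
      let x₁ : P × P →L[𝕜] E :=
        (ContinuousLinearMap.fst 𝕜 E (Fin k → E)).comp (ContinuousLinearMap.fst 𝕜 P P)
      let y₁ : P × P →L[𝕜] (Fin k → E) :=
        (ContinuousLinearMap.snd 𝕜 E (Fin k → E)).comp (ContinuousLinearMap.fst 𝕜 P P)
      let x₂ : P × P →L[𝕜] E :=
        (ContinuousLinearMap.fst 𝕜 E (Fin k → E)).comp (ContinuousLinearMap.snd 𝕜 P P)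
      let y₂ : P × P →L[𝕜] (Fin k → E) :=
        (ContinuousLinearMap.snd 𝕜 E (Fin k → E)).comp (ContinuousLinearMap.snd 𝕜 P P)
      refine IsBastianiCkOn.add ?_ (IsBastianiCkOn.sum fun m _ => ?_)
      · let L : P × P →L[𝕜] E × (Fin (k + 1) → E) := x₁.prod (ContinuousLinearMap.pi
          (Fin.cons x₂ fun l => (ContinuousLinearMap.proj l).comp y₁))
        have hL : ∀ q, L q = (q.1.1, Fin.cons q.2.1 q.1.2) := fun q => by
          refine Prod.ext rfl (funext fun l => ?_)
          refine l.cases ?_ fun l => ?_ <;> rfl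
        have := (ih (k + 1)).comp_continuousLinearMap L (V := (U ×ˢ univ) ×ˢ univ)
          fun q hq => ⟨hq.1.1, trivial⟩
        simpa only [hL] using this
      · let L : P × P →L[𝕜] E × (Fin k → E) := x₁.prod (ContinuousLinearMap.pi fun l =>
          if l = m then (ContinuousLinearMap.proj m).comp y₂ else
            (ContinuousLinearMap.proj l).comp y₁)
        have hL : ∀ q, L q = (q.1.1, Function.update q.1.2 m (q.2.2 m)) := fun q => by
          refine Prod.ext rfl (funext fun l => ?_)
          rcases eq_or_ne l m with rfl | hl
          · simp [L, y₂]
          · simp [L, hl, y₁]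
        have := (ih k).comp_continuousLinearMap L (V := (U ×ˢ univ) ×ˢ univ)
          fun q hq => ⟨hq.1.1, trivial⟩
        simpa only [hL] using this
  intro r
  have h0 := (key r 0).comp_continuousLinearMap
    ((ContinuousLinearMap.id 𝕜 E).prod (0 : E →L[𝕜] (Fin 0 → E))) (V := U)
    fun x hx => ⟨hx, trivial⟩
  exact h0.congr hU fun x hx => hd0 x hx _

end KellerToBastiani

end Comparison

/-! ### Smoothness of multiplication and inversion -/

section SmoothAlgebra

variable {𝕜 : Type*} [RCLike 𝕜] {R : Type u} [Ring R] [Algebra 𝕜 R] [TopologicalSpace R]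
  [IsTopologicalRing R] [ContinuousSMul 𝕜 R]

theorem isBastianiCkOn_mul (k : ℕ) (U : Set (R × R)) :
    IsBastianiCkOn 𝕜 k (fun q : R × R => q.1 * q.2) U := by
  refine IsBastianiCkOn.mono (U := univ) ?_ (subset_univ U)
  induction k with
  | zero => exact continuous_mul.continuousOn
  | succ k ih =>
    refine ⟨continuous_mul.continuousOn, fun q => q.1.1 * q.2.2 + q.2.1 * q.1.2,
      fun x _ y => ?_, ?_⟩
    · have hc : Tendsto (fun t : 𝕜 => x.1 * y.2 + y.1 * (x.2 + t • y.2)) (𝓝[≠] 0)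
          (𝓝 (x.1 * y.2 + y.1 * x.2)) := by
        have : Continuous fun t : 𝕜 => x.1 * y.2 + y.1 * (x.2 + t • y.2) := by fun_prop
        simpa using (this.tendsto 0).mono_left nhdsWithin_le_nhds
      refine hc.congr' ?_
      filter_upwards [self_mem_nhdsWithin] with t ht
      have ht : t ≠ 0 := ht
      rw [Prod.fst_add, Prod.snd_add, Prod.smul_fst, Prod.smul_snd, add_mul, mul_add x.1,
        add_assoc, add_sub_cancel_left, smul_mul_assoc, mul_smul_comm, ← smul_add,
        inv_smul_smul₀ ht]
    · let P := R × R
      have h1 : IsBastianiCkOn 𝕜 k (fun q : P × P => q.1.1 * q.2.2) univ :=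
        ih.comp_continuousLinearMap
          (((ContinuousLinearMap.fst 𝕜 R R).comp (ContinuousLinearMap.fst 𝕜 P P)).prod
            ((ContinuousLinearMap.snd 𝕜 R R).comp (ContinuousLinearMap.snd 𝕜 P P)))
          (mapsTo_univ _ _)
      have h2 : IsBastianiCkOn 𝕜 k (fun q : P × P => q.2.1 * q.1.2) univ :=
        ih.comp_continuousLinearMap
          (((ContinuousLinearMap.fst 𝕜 R R).comp (ContinuousLinearMap.snd 𝕜 P P)).prod
            ((ContinuousLinearMap.snd 𝕜 R R).comp (ContinuousLinearMap.fst 𝕜 P P)))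
          (mapsTo_univ _ _)
      exact (h1.add h2).mono (subset_univ _)

theorem hasDirDeriv_inverse (hU : IsOpen {x : R | IsUnit x})
    (hinv : ContinuousOn Ring.inverse {x : R | IsUnit x}) {x : R} (hx : IsUnit x) (y : R) :
    HasDirDeriv 𝕜 Ring.inverse (-(Ring.inverse x * (y * Ring.inverse x))) x y := by
  have hxt := (tendsto_add_smul 𝕜 x y).mono_left (nhdsWithin_le_nhds (s := {0}ᶜ))
  have h1 : Tendsto (fun t : 𝕜 => Ring.inverse (x + t • y)) (𝓝[≠] 0) (𝓝 (Ring.inverse x)) :=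
    (hinv.continuousAt (hU.mem_nhds hx)).tendsto.comp hxt
  refine (h1.mul_const (y * Ring.inverse x)).neg.congr' ?_
  filter_upwards [self_mem_nhdsWithin, hxt.eventually (hU.mem_nhds hx)] with t ht htu
  have ht : t ≠ 0 := ht
  have htu : IsUnit (x + t • y) := htu
  have key : Ring.inverse (x + t • y) - Ring.inverse x =
      t • -(Ring.inverse (x + t • y) * (y * Ring.inverse x)) := by
    have h2 : Ring.inverse (x + t • y) * (x + t • y) * Ring.inverse x = Ring.inverse x := by
      rw [Ring.inverse_mul_cancel _ htu, one_mul]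
    rw [mul_add, add_mul, mul_assoc _ x, Ring.mul_inverse_cancel _ hx, mul_one, mul_smul_comm,
      smul_mul_assoc] at h2
    rw [smul_neg, ← mul_assoc, eq_neg_iff_add_eq_zero, sub_add_eq_add_sub, h2, sub_self]
  rw [key, inv_smul_smul₀ ht]

/-- The derivative `-x⁻¹ y x⁻¹` is built from inversion and multiplication, so each order gives the
next. -/
theorem isBastianiCkOn_inverse [PolynormableSpace 𝕜 R] (hU : IsOpen {x : R | IsUnit x})
    (hinv : ContinuousOn Ring.inverse {x : R | IsUnit x}) (k : ℕ) :
    IsBastianiCkOn 𝕜 k Ring.inverse {x : R | IsUnit x} := by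
  induction k with
  | zero => exact hinv
  | succ k ih =>
    refine ⟨hinv, fun q => -(Ring.inverse q.1 * (q.2 * Ring.inverse q.1)),
      fun x hx y => hasDirDeriv_inverse hU hinv hx y, ?_⟩
    have h1 : IsBastianiCkOn 𝕜 k (fun q : R × R => Ring.inverse q.1)
        ({x : R | IsUnit x} ×ˢ univ) :=
      ih.comp_continuousLinearMap (ContinuousLinearMap.fst 𝕜 R R) fun q hq => hq.1
    have h2 : IsBastianiCkOn 𝕜 k (fun q : R × R => q.2) ({x : R | IsUnit x} ×ˢ univ) :=
      IsBastianiCkOn.continuousLinearMap k (ContinuousLinearMap.snd 𝕜 R R) _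
    have h3 := (isBastianiCkOn_mul (𝕜 := 𝕜) k (univ : Set (R × R))).comp (h2.prodMk h1)
      isOpen_univ (mapsTo_univ _ _)
    exact ((isBastianiCkOn_mul (𝕜 := 𝕜) k (univ : Set (R × R))).comp (h1.prodMk h3)
      isOpen_univ (mapsTo_univ _ _)).neg

end SmoothAlgebra

/-! ### Analyticity -/

section Analytic

variable {𝕜 : Type*} [RCLike 𝕜] {E F : Type*}
  [AddCommGroup E] [Module 𝕜 E] [TopologicalSpace E]
  [AddCommGroup F] [Module 𝕜 F] [TopologicalSpace F]

theorem tendsto_sum_range_of_eq_zero {f : ℕ → F} {M : ℕ} (hf : ∀ k, M ≤ k → f k = 0) :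
    Tendsto (fun N => ∑ k ∈ Finset.range N, f k) atTop (𝓝 (∑ k ∈ Finset.range M, f k)) := by
  refine tendsto_atTop_of_eventually_const (i₀ := M) fun N hN => ?_
  refine (Finset.sum_subset (Finset.range_mono hN) fun k _ hk => hf k ?_).symm
  simpa using hk

theorem IsSeriesAnalyticOn.congr [IsTopologicalAddGroup E] {f g : E → F} {U : Set E}
    (h : IsSeriesAnalyticOn 𝕜 f U) (hU : IsOpen U) (hfg : EqOn f g U) :
    IsSeriesAnalyticOn 𝕜 g U := by
  refine ⟨h.1.congr hfg.symm, fun x hx => ?_⟩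
  obtain ⟨p, hp⟩ := h.2 x hx
  have hxv : Tendsto (fun v => x + v) (𝓝 0) (𝓝 x) := by
    simpa using (continuous_const_add x).tendsto 0
  refine ⟨p, ?_⟩
  filter_upwards [hp, hxv.eventually (hU.mem_nhds hx)] with v hv hvU
  rwa [← hfg hvU]

theorem isSeriesAnalyticOn_continuousLinearMap (L : E →L[𝕜] F) (U : Set E) :
    IsSeriesAnalyticOn 𝕜 L U := by
  refine ⟨L.continuous.continuousOn, fun x _ => ?_⟩
  let p : ∀ k : ℕ, ContinuousMultilinearMap 𝕜 (fun _ : Fin k => E) F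
    | 0 => ContinuousMultilinearMap.constOfIsEmpty 𝕜 _ (L x)
    | 1 => ContinuousMultilinearMap.ofSubsingleton 𝕜 E F 0 L
    | _ + 2 => 0
  refine ⟨p, Eventually.of_forall fun v => ?_⟩
  have := tendsto_sum_range_of_eq_zero (f := fun k => p k fun _ => v) (M := 2) fun k hk => by
    obtain ⟨k, rfl⟩ := Nat.exists_eq_add_of_le' hk
    rfl
  simpa [Finset.sum_range_succ, p] using this

end Analytic

theorem Ring.inverse_eq_of_mul_eq_one {R : Type*} [Ring R] {x y : R} (h : x * y = 1) (h' : y * x = 1) :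
    Ring.inverse x = y :=
  Ring.inverse_unit ⟨x, y, h, h'⟩

/-! ### Power series of multiplication and inversion -/

section AnalyticAlgebra

variable {K : Type*} [RCLike K] {R : Type*} [Ring R] [Module K R] [TopologicalSpace R]
  [IsTopologicalRing R]

/-- Expand `P (x + v) * Q (x + v)` into degrees 0, 1 and 2. Compatibility with scalars is an
explicit hypothesis so that the result also covers the complexification with its locally chosen
complex structure. -/
theorem isSeriesAnalyticOn_mul (hK : ∀ (r : K) (x y : R), r • x * y = r • (x * y))
    (hK' : ∀ (r : K) (x y : R), x * r • y = r • (x * y))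
    {E : Type*} [AddCommGroup E] [Module K E] [TopologicalSpace E] (P Q : E →L[K] R)
    (U : Set E) : IsSeriesAnalyticOn K (fun z => P z * Q z) U := by
  let _ : Algebra K R := Algebra.ofModule hK hK'
  refine ⟨(P.continuous.mul Q.continuous).continuousOn, fun x _ => ?_⟩
  let L : E →L[K] R := ⟨(LinearMap.mulLeft K (P x)).comp Q.toLinearMap +
    (LinearMap.mulRight K (Q x)).comp P.toLinearMap,
    (continuous_const.mul Q.continuous).add (P.continuous.mul continuous_const)⟩
  let p : ∀ k : ℕ, ContinuousMultilinearMap K (fun _ : Fin k => E) R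
    | 0 => ContinuousMultilinearMap.constOfIsEmpty K _ (P x * Q x)
    | 1 => ContinuousMultilinearMap.ofSubsingleton K E R 0 L
    | 2 => (ContinuousMultilinearMap.mkPiAlgebraFin K 2 R).compContinuousLinearMap ![P, Q]
    | _ + 3 => 0
  refine ⟨p, Eventually.of_forall fun v => ?_⟩
  have := tendsto_sum_range_of_eq_zero (f := fun k => p k fun _ => v) (M := 3) fun k hk => by
    obtain ⟨k, rfl⟩ := Nat.exists_eq_add_of_le' hk
    rfl
  have hsum : ∑ k ∈ Finset.range 3, (p k fun _ => v) = P (x + v) * Q (x + v) := by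
    have h0 : (p 0 fun _ => v) = P x * Q x := rfl
    have h1 : (p 1 fun _ => v) = P x * Q v + P v * Q x := rfl
    have h2 : (p 2 fun _ => v) = P v * Q v := by simp [p]
    rw [Finset.sum_range_succ, Finset.sum_range_succ, Finset.sum_range_one, h0, h1, h2, map_add,
      map_add]
    noncomm_ring
  rwa [hsum] at this

/-- Geometric series converge pointwise on a neighbourhood of `0`. -/
def HasGeomSeriesNhds (R : Type*) [Ring R] [TopologicalSpace R] : Prop :=
  ∃ W ∈ 𝓝 (0 : R), ∀ v ∈ W, ∃ s, Tendsto (fun N => ∑ k ∈ Finset.range N, v ^ k) atTop (𝓝 s)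

/-- Powers tend to 0, being differences of consecutive partial sums; then pass to the limit in the
telescoping identity. -/
theorem mul_eq_one_of_tendsto_geom [T2Space R] {v s : R}
    (h : Tendsto (fun N => ∑ k ∈ Finset.range N, v ^ k) atTop (𝓝 s)) :
    (1 - v) * s = 1 ∧ s * (1 - v) = 1 := by
  have h0 : Tendsto (fun N => v ^ N) atTop (𝓝 0) := by
    have := (h.comp (tendsto_add_atTop_nat 1)).sub h
    rw [sub_self] at this
    refine this.congr fun N => ?_
    simp [Finset.sum_range_succ]
  have h1 : Tendsto (fun N => 1 - v ^ N) atTop (𝓝 1) := by simpa using h0.const_sub 1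
  constructor
  · refine tendsto_nhds_unique (h.const_mul (1 - v)) (h1.congr fun N => ?_)
    rw [mul_neg_geom_sum]
  · refine tendsto_nhds_unique (h.mul_const (1 - v)) (h1.congr fun N => ?_)
    rw [geom_sum_mul_neg]

theorem HasGeomSeriesNhds.isOpen_isUnit [T2Space R] (h : HasGeomSeriesNhds R) :
    IsOpen {x : R | IsUnit x} := by
  refine isOpen_isUnit_of_mem_nhds ?_
  obtain ⟨W, hW, hs⟩ := h
  have : Tendsto (fun x : R => 1 - x) (𝓝 1) (𝓝 0) := by
    simpa using (continuous_sub_left (1 : R)).tendsto 1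
  filter_upwards [this.eventually hW] with x hx
  obtain ⟨s, hs⟩ := hs _ hx
  have h1 := mul_eq_one_of_tendsto_geom hs
  rw [sub_sub_cancel] at h1
  exact ⟨⟨x, s, h1.1, h1.2⟩, rfl⟩

/-- From `x + v = x (1 + x⁻¹ v)`, the series is the Neumann series with terms `(-x⁻¹ v)^k x⁻¹`. -/
theorem HasGeomSeriesNhds.isSeriesAnalyticOn_inverse [T2Space R] (h : HasGeomSeriesNhds R)
    (hK : ∀ (r : K) (x y : R), r • x * y = r • (x * y))
    (hK' : ∀ (r : K) (x y : R), x * r • y = r • (x * y))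
    (hc : ContinuousOn Ring.inverse {x : R | IsUnit x}) :
    IsSeriesAnalyticOn K (Ring.inverse : R → R) {x : R | IsUnit x} := by
  let _ : Algebra K R := Algebra.ofModule hK hK'
  obtain ⟨W, hW, hs⟩ := h
  refine ⟨hc, fun x hx => ?_⟩
  have hx : IsUnit x := hx
  let L : R →L[K] R := ⟨LinearMap.mulLeft K (-Ring.inverse x), continuous_const_mul _⟩
  let M : R →L[K] R := ⟨LinearMap.mulRight K (Ring.inverse x), continuous_mul_const _⟩
  refine ⟨fun k => M.compContinuousMultilinearMap
    ((ContinuousMultilinearMap.mkPiAlgebraFin K k R).compContinuousLinearMap fun _ => L), ?_⟩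
  have hL : Tendsto L (𝓝 0) (𝓝 0) := by simpa using L.continuous.tendsto 0
  filter_upwards [hL.eventually hW] with v hv
  obtain ⟨s, hs⟩ := hs _ hv
  have h1 := mul_eq_one_of_tendsto_geom hs
  have hxv : x + v = x * (1 - L v) := by
    change x + v = x * (1 - -Ring.inverse x * v)
    rw [neg_mul, sub_neg_eq_add, mul_add, mul_one, ← mul_assoc, Ring.mul_inverse_cancel _ hx,
      one_mul]
  have hinv : Ring.inverse (x + v) = s * Ring.inverse x := by
    refine Ring.inverse_eq_of_mul_eq_one ?_ ?_
    · rw [hxv, mul_assoc, ← mul_assoc (1 - L v), h1.1, one_mul, Ring.mul_inverse_cancel _ hx]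
    · rw [hxv, mul_assoc, ← mul_assoc (Ring.inverse x), Ring.inverse_mul_cancel _ hx, one_mul, h1.2]
  rw [hinv]
  refine (hs.mul_const (Ring.inverse x)).congr fun N => ?_
  rw [Finset.sum_mul]
  refine Finset.sum_congr rfl fun k _ => ?_
  change _ = _ * Ring.inverse x
  simp

/-- The limit algebra is not assumed complete; summation takes place in a complete normed group and
is pushed forward by `D`. -/
theorem exists_tendsto_geom_sum_of_norm_le {R : Type*} [Ring R] [TopologicalSpace R]
    {M : Type*} [NormedAddCommGroup M] [CompleteSpace M] (D : M →+ R) (hD : Continuous D) {v : R}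
    {c : ℝ} (h : ∀ k, ∃ x, D x = v ^ k ∧ ‖x‖ ≤ c * (1 / 2) ^ k) :
    ∃ s, Tendsto (fun N => ∑ k ∈ Finset.range N, v ^ k) atTop (𝓝 s) := by
  choose x hx hxc using h
  have hsum : Summable x := Summable.of_norm_bounded
    ((summable_geometric_of_lt_one (by norm_num) (by norm_num : (1 / 2 : ℝ) < 1)).mul_left c) hxc
  refine ⟨D (∑' k, x k), ((hD.tendsto _).comp hsum.hasSum.tendsto_sum_nat).congr fun N => ?_⟩
  rw [Function.comp_apply, map_sum]
  exact Finset.sum_congr rfl fun k _ => hx k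

end AnalyticAlgebra

/-! ### The complexification of an algebra -/

namespace Complexif

section Ring

variable {R : Type*} [Ring R]

instance instMul : Mul (Complexif R) :=
  ⟨fun x y => (x.1 * y.1 - x.2 * y.2, x.1 * y.2 + x.2 * y.1)⟩

instance instOne : One (Complexif R) := ⟨((1 : R), (0 : R))⟩

theorem mul_def (x y : Complexif R) :
    x * y = (x.1 * y.1 - x.2 * y.2, x.1 * y.2 + x.2 * y.1) := rfl

instance instRing : Ring (Complexif R) :=
  { (inferInstance : AddCommGroup (Complexif R)) with
    mul := (· * ·)
    one := 1
    left_distrib := fun x y z => Prod.ext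
      (show x.1 * (y.1 + z.1) - x.2 * (y.2 + z.2) =
        (x.1 * y.1 - x.2 * y.2) + (x.1 * z.1 - x.2 * z.2) by noncomm_ring)
      (show x.1 * (y.2 + z.2) + x.2 * (y.1 + z.1) =
        (x.1 * y.2 + x.2 * y.1) + (x.1 * z.2 + x.2 * z.1) by noncomm_ring)
    right_distrib := fun x y z => Prod.ext
      (show (x.1 + y.1) * z.1 - (x.2 + y.2) * z.2 =
        (x.1 * z.1 - x.2 * z.2) + (y.1 * z.1 - y.2 * z.2) by noncomm_ring)
      (show (x.1 + y.1) * z.2 + (x.2 + y.2) * z.1 =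
        (x.1 * z.2 + x.2 * z.1) + (y.1 * z.2 + y.2 * z.1) by noncomm_ring)
    zero_mul := fun x => Prod.ext (show 0 * x.1 - 0 * x.2 = 0 by simp)
      (show 0 * x.2 + 0 * x.1 = 0 by simp)
    mul_zero := fun x => Prod.ext (show x.1 * 0 - x.2 * 0 = 0 by simp)
      (show x.1 * 0 + x.2 * 0 = 0 by simp)
    mul_assoc := fun x y z => Prod.ext
      (show (x.1 * y.1 - x.2 * y.2) * z.1 - (x.1 * y.2 + x.2 * y.1) * z.2 =
        x.1 * (y.1 * z.1 - y.2 * z.2) - x.2 * (y.1 * z.2 + y.2 * z.1) by noncomm_ring)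
      (show (x.1 * y.1 - x.2 * y.2) * z.2 + (x.1 * y.2 + x.2 * y.1) * z.1 =
        x.1 * (y.1 * z.2 + y.2 * z.1) + x.2 * (y.1 * z.1 - y.2 * z.2) by noncomm_ring)
    one_mul := fun x => Prod.ext (show 1 * x.1 - 0 * x.2 = x.1 by simp)
      (show 1 * x.2 + 0 * x.1 = x.2 by simp)
    mul_one := fun x => Prod.ext (show x.1 * 1 - x.2 * 0 = x.1 by simp)
      (show x.1 * 0 + x.2 * 1 = x.2 by simp)
    zsmul := (inferInstance : AddCommGroup (Complexif R)).zsmul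
    zsmul_zero' := (inferInstance : AddCommGroup (Complexif R)).zsmul_zero'
    zsmul_succ' := (inferInstance : AddCommGroup (Complexif R)).zsmul_succ'
    zsmul_neg' := (inferInstance : AddCommGroup (Complexif R)).zsmul_neg'
    neg_add_cancel := (inferInstance : AddCommGroup (Complexif R)).neg_add_cancel }

theorem ofReal_mul (x y : R) : ofReal (x * y) = ofReal x * ofReal y :=
  Prod.ext (show x * y = x * y - 0 * 0 by simp) (show (0 : R) = x * 0 + 0 * y by simp)

theorem ofReal_one : ofReal (1 : R) = 1 := rfl

theorem isUnit_ofReal {x : R} (hx : IsUnit x) : IsUnit (ofReal x) ∧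
    Ring.inverse (ofReal x) = ofReal (Ring.inverse x) := by
  have h1 : ofReal x * ofReal (Ring.inverse x) = 1 := by
    rw [← ofReal_mul, Ring.mul_inverse_cancel _ hx, ofReal_one]
  have h2 : ofReal (Ring.inverse x) * ofReal x = 1 := by
    rw [← ofReal_mul, Ring.inverse_mul_cancel _ hx, ofReal_one]
  exact ⟨⟨⟨_, _, h1, h2⟩, rfl⟩, Ring.inverse_eq_of_mul_eq_one h1 h2⟩

variable [TopologicalSpace R]

instance [T2Space R] : T2Space (Complexif R) := inferInstanceAs (T2Space (R × R))

instance [IsTopologicalAddGroup R] : IsTopologicalAddGroup (Complexif R) :=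
  inferInstanceAs (IsTopologicalAddGroup (R × R))

/-- The sum of `q` over the two components is submultiplicative. -/
theorem hasRingSeminormBasis (h : HasRingSeminormBasis R) :
    HasRingSeminormBasis (Complexif R) := by
  intro W hW
  have hW' : W ∈ 𝓝 ((0 : R), (0 : R)) := hW
  rw [nhds_prod_eq] at hW'
  obtain ⟨V, hV, V', hV', hVW⟩ := mem_prod_iff.1 hW'
  obtain ⟨q, hq, hqV⟩ := h _ (inter_mem hV hV')
  refine ⟨{
    toFun := fun z => q z.1 + q z.2
    map_zero' := show q 0 + q 0 = 0 by simp
    add_le' := fun x y => ?_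
    neg' := fun x => show q (-x.1) + q (-x.2) = q x.1 + q x.2 by simp
    mul_le' := fun x y => ?_ }, ?_, fun z hz => ?_⟩
  · change q (x.1 + y.1) + q (x.2 + y.2) ≤ q x.1 + q x.2 + (q y.1 + q y.2)
    have h1 := map_add_le_add q x.1 y.1
    have h2 := map_add_le_add q x.2 y.2
    linarith
  · change q (x.1 * y.1 - x.2 * y.2) + q (x.1 * y.2 + x.2 * y.1) ≤
      (q x.1 + q x.2) * (q y.1 + q y.2)
    have h1 := map_sub_le_add q (x.1 * y.1) (x.2 * y.2)
    have h2 := map_add_le_add q (x.1 * y.2) (x.2 * y.1)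
    have h3 := map_mul_le_mul q x.1 y.1
    have h4 := map_mul_le_mul q x.2 y.2
    have h5 := map_mul_le_mul q x.1 y.2
    have h6 := map_mul_le_mul q x.2 y.1
    linarith
  · exact (hq.comp continuous_fst).add (hq.comp continuous_snd)
  · have hz : q z.1 + q z.2 < 1 := hz
    have h1 := apply_nonneg q z.1
    have h2 := apply_nonneg q z.2
    exact hVW ⟨(hqV z.1 (by linarith)).1, (hqV z.2 (by linarith)).2⟩

instance [IsTopologicalRing R] : IsTopologicalRing (Complexif R) where
  continuous_mul := by
    have h : Continuous fun q : (R × R) × (R × R) =>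
      (q.1.1 * q.2.1 - q.1.2 * q.2.2, q.1.1 * q.2.2 + q.1.2 * q.2.1) := by fun_prop
    exact h
  continuous_add := continuous_add
  continuous_neg := continuous_neg

end Ring

theorem smul_mul_complexif {𝕜 R : Type*} [RCLike 𝕜] [Ring R] [Algebra 𝕜 R] (r : ℂ)
    (x y : Complexif R) :
    letI := Complexif.module 𝕜 R
    r • x * y = r • (x * y) :=
  Prod.ext
    (show ((r.re : 𝕜) • x.1 - (r.im : 𝕜) • x.2) * y.1 - ((r.re : 𝕜) • x.2 + (r.im : 𝕜) • x.1) * y.2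
      = (r.re : 𝕜) • (x.1 * y.1 - x.2 * y.2) - (r.im : 𝕜) • (x.1 * y.2 + x.2 * y.1) by
      simp only [sub_mul, add_mul, smul_mul_assoc]; module)
    (show ((r.re : 𝕜) • x.1 - (r.im : 𝕜) • x.2) * y.2 + ((r.re : 𝕜) • x.2 + (r.im : 𝕜) • x.1) * y.1
      = (r.re : 𝕜) • (x.1 * y.2 + x.2 * y.1) + (r.im : 𝕜) • (x.1 * y.1 - x.2 * y.2) by
      simp only [sub_mul, add_mul, smul_mul_assoc]; module)

theorem mul_smul_complexif {𝕜 R : Type*} [RCLike 𝕜] [Ring R] [Algebra 𝕜 R] (r : ℂ)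
    (x y : Complexif R) :
    letI := Complexif.module 𝕜 R
    x * r • y = r • (x * y) :=
  Prod.ext
    (show x.1 * ((r.re : 𝕜) • y.1 - (r.im : 𝕜) • y.2) - x.2 * ((r.re : 𝕜) • y.2 + (r.im : 𝕜) • y.1)
      = (r.re : 𝕜) • (x.1 * y.1 - x.2 * y.2) - (r.im : 𝕜) • (x.1 * y.2 + x.2 * y.1) by
      simp only [mul_sub, mul_add, mul_smul_comm]; module)
    (show x.1 * ((r.re : 𝕜) • y.2 + (r.im : 𝕜) • y.1) + x.2 * ((r.re : 𝕜) • y.1 - (r.im : 𝕜) • y.2)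
      = (r.re : 𝕜) • (x.1 * y.2 + x.2 * y.1) + (r.im : 𝕜) • (x.1 * y.1 - x.2 * y.2) by
      simp only [mul_sub, mul_add, mul_smul_comm]; module)

end Complexif

/-! ### Analyticity of the algebra operations on ascending unions -/

section

variable {𝕜 : Type*} [RCLike 𝕜] {E F : Type*}
  [AddCommGroup E] [Module 𝕜 E] [TopologicalSpace E]
  [AddCommGroup F] [Module 𝕜 F] [TopologicalSpace F]

theorem IsKAnalyticOn.congr [IsTopologicalAddGroup E] {f g : E → F} {U : Set E}
    (h : IsKAnalyticOn 𝕜 f U) (hU : IsOpen U) (hfg : EqOn f g U) : IsKAnalyticOn 𝕜 g U := by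
  refine ⟨fun hI => (h.1 hI).congr hU hfg, fun hI => ?_⟩
  obtain ⟨V, G, hV, hG, hVG⟩ := h.2 hI
  exact ⟨V, G, hV, hG, fun x hx => ⟨(hVG x hx).1, by rw [(hVG x hx).2, hfg hx]⟩⟩

theorem IsKellerCrOn.congr [IsTopologicalAddGroup E] [ContinuousSMul 𝕜 E] {r : ℕ∞} {f g : E → F}
    {U : Set E} (h : IsKellerCrOn 𝕜 r f U) (hfg : EqOn f g U) : IsKellerCrOn 𝕜 r g U := by
  obtain ⟨d, hd0, hd, hc⟩ := h
  exact ⟨d, fun x hx y => (hd0 x hx y).trans (hfg hx), hd, hc⟩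

theorem IsClassOn.congr [IsTopologicalAddGroup E] [ContinuousSMul 𝕜 E] {r : WithTop ℕ∞}
    {f g : E → F} {U : Set E} (h : IsClassOn 𝕜 r f U) (hU : IsOpen U) (hfg : EqOn f g U) :
    IsClassOn 𝕜 r g U :=
  ⟨fun hr => (h.1 hr).congr hU hfg, fun k hk => (h.2 k hk).congr hfg⟩

theorem isKAnalyticOn_id (U : Set E) : IsKAnalyticOn 𝕜 (fun x : E => x) U := by
  refine ⟨fun _ => isSeriesAnalyticOn_continuousLinearMap (ContinuousLinearMap.id 𝕜 E) U,
    fun _ => ?_⟩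
  let _ := Complexif.module 𝕜 E
  exact ⟨univ, fun z => z, isOpen_univ,
    isSeriesAnalyticOn_continuousLinearMap (ContinuousLinearMap.id ℂ (Complexif E)) univ,
    fun x _ => ⟨trivial, rfl⟩⟩

theorem isKAnalyticOn_mul {R : Type*} [Ring R] [Algebra 𝕜 R] [TopologicalSpace R]
    [IsTopologicalRing R] (U : Set (R × R)) :
    IsKAnalyticOn 𝕜 (fun q : R × R => q.1 * q.2) U := by
  refine ⟨fun _ => isSeriesAnalyticOn_mul smul_mul_assoc (fun r x y => mul_smul_comm r x y)
    (ContinuousLinearMap.fst 𝕜 R R) (ContinuousLinearMap.snd 𝕜 R R) U, fun _ => ?_⟩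
  let _ := Complexif.module 𝕜 R
  let _ := Complexif.module 𝕜 (R × R)
  let P : Complexif (R × R) →L[ℂ] Complexif R :=
    { toFun := fun z => (z.1.1, z.2.1)
      map_add' := fun _ _ => rfl
      map_smul' := fun _ _ => rfl
      cont := by
        have : Continuous fun z : (R × R) × (R × R) => (z.1.1, z.2.1) := by fun_prop
        exact this }
  let Q : Complexif (R × R) →L[ℂ] Complexif R :=
    { toFun := fun z => (z.1.2, z.2.2)
      map_add' := fun _ _ => rfl
      map_smul' := fun _ _ => rfl
      cont := by
        have : Continuous fun z : (R × R) × (R × R) => (z.1.2, z.2.2) := by fun_prop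
        exact this }
  exact ⟨univ, fun z => P z * Q z, isOpen_univ, isSeriesAnalyticOn_mul
    (Complexif.smul_mul_complexif (𝕜 := 𝕜)) (Complexif.mul_smul_complexif (𝕜 := 𝕜)) P Q univ,
    fun x _ => ⟨trivial, (Complexif.ofReal_mul x.1 x.2).symm⟩⟩

/-- In the real case, inversion in the complexified algebra is the required complex analytic
extension. -/
theorem isKAnalyticOn_inverse {R : Type*} [Ring R] [Algebra 𝕜 R] [TopologicalSpace R]
    [IsTopologicalRing R] [T2Space R] (hR : HasRingSeminormBasis R) (hg : HasGeomSeriesNhds R)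
    (hg' : HasGeomSeriesNhds (Complexif R)) :
    IsKAnalyticOn 𝕜 (Ring.inverse : R → R) {x : R | IsUnit x} := by
  refine ⟨fun _ => hg.isSeriesAnalyticOn_inverse smul_mul_assoc (fun r x y => mul_smul_comm r x y)
    hR.continuousOn_inverse, fun _ => ?_⟩
  let _ := Complexif.module 𝕜 R
  exact ⟨{z | IsUnit z}, Ring.inverse, hg'.isOpen_isUnit, hg'.isSeriesAnalyticOn_inverse
    (Complexif.smul_mul_complexif (𝕜 := 𝕜)) (Complexif.mul_smul_complexif (𝕜 := 𝕜))
    (Complexif.hasRingSeminormBasis hR).continuousOn_inverse,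
    fun x hx => Complexif.isUnit_ofReal hx⟩

end

/-! ### Convergence of geometric series near zero -/

namespace IsLCUnion

variable {𝕜 : Type*} [RCLike 𝕜] {A : ℕ → Type*} [∀ n, NormedRing (A n)]
  [∀ n, NormedAlgebra 𝕜 (A n)] [∀ n, CompleteSpace (A n)] {B : Type*} [Ring B] [Algebra 𝕜 B]
  [TopologicalSpace B] {i : ∀ n, A n →ₐ[𝕜] B}

/-- If `q v < 1/2`, then `2 v` comes from a bounded semigroup in some step, so `v^k` lifts to an
element of norm at most `M / 2^k`. The power `k = 0` is treated apart, as the semigroup need not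
contain 1. -/
theorem hasGeomSeriesNhds (h : IsLCUnion 𝕜 i) : HasGeomSeriesNhds B := by
  obtain ⟨q, C, hq, -, -, hM, hCm, -, -, -, hqC⟩ := h.exists_submultiplicative (W := univ) univ_mem
  have hq0 : Tendsto q (𝓝 0) (𝓝 0) := by simpa using hq.tendsto 0
  refine ⟨{v | q v < 1 / 2}, hq0.eventually (gt_mem_nhds (by norm_num)), fun v hv => ?_⟩
  have hv : q v < 1 / 2 := hv
  obtain ⟨n, x, hx, hxv⟩ := hqC ((2 : 𝕜) • v) (by
    rw [map_smul_eq_mul, RCLike.norm_ofNat]; linarith)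
  obtain ⟨M, hM⟩ := hM n
  have hv' : v = (2⁻¹ : 𝕜) • i n x := by rw [hxv, inv_smul_smul₀ two_ne_zero]
  refine exists_tendsto_geom_sum_of_norm_le (i n : A n →+ B) (h.continuous_incl n)
    (c := max M ‖(1 : A n)‖) fun k => ⟨(2⁻¹ : 𝕜) ^ k • x ^ k, ?_, ?_⟩
  · rw [hv', smul_pow]
    simp
  · rw [norm_smul, norm_pow, norm_inv, RCLike.norm_ofNat, mul_comm, one_div]
    refine mul_le_mul_of_nonneg_right ?_ (by positivity)
    rcases k.eq_zero_or_pos with rfl | hk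
    · simp
    · refine le_max_of_le_left (hM _ ?_)
      induction k, hk using Nat.le_induction with
      | base => simpa using hx
      | succ k _ ih => rw [pow_succ]; exact hCm n _ ih x hx

theorem hasGeomSeriesNhds_complexif (h : IsLCUnion 𝕜 i) : HasGeomSeriesNhds (Complexif B) := by
  obtain ⟨q, C, hq, -, -, hM, hCm, hCn, hC2, hmono, hqC⟩ :=
    h.exists_submultiplicative (W := univ) univ_mem
  have hq0 : Tendsto q (𝓝 0) (𝓝 0) := by simpa using hq.tendsto 0
  have hq1 : Tendsto (fun z : B × B => q z.1) (𝓝 0) (𝓝 0) := by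
    exact hq0.comp (continuous_fst.tendsto (0 : B × B))
  have hq2 : Tendsto (fun z : B × B => q z.2) (𝓝 0) (𝓝 0) := by
    exact hq0.comp (continuous_snd.tendsto (0 : B × B))
  refine ⟨{z : B × B | q z.1 < 1 / 4 ∧ q z.2 < 1 / 4},
    (hq1.eventually (gt_mem_nhds (by norm_num))).and
      (hq2.eventually (gt_mem_nhds (by norm_num))), ?_⟩
  intro v hv
  have hb : q v.1 < 1 / 4 := hv.1
  have hb' : q v.2 < 1 / 4 := hv.2
  have h4 : ∀ c : B, q c < 1 / 4 → ∃ n, (4 : 𝕜) • c ∈ i n '' C n := fun c hc => hqC _ (by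
    rw [map_smul_eq_mul, RCLike.norm_ofNat]; linarith)
  obtain ⟨n₁, h₁⟩ := h4 v.1 hb
  obtain ⟨n₂, h₂⟩ := h4 v.2 hb'
  -- Real and imaginary part are brought into one step by monotonicity.
  obtain ⟨n, y, hy, y', hy', hyb, hyb'⟩ : ∃ n, ∃ y ∈ C n, ∃ y' ∈ C n,
      i n y = (4 : 𝕜) • v.1 ∧ i n y' = (4 : 𝕜) • v.2 := by
    obtain ⟨y, hy, hyb⟩ := hmono (le_max_left n₁ n₂) h₁
    obtain ⟨y', hy', hyb'⟩ := hmono (le_max_right n₁ n₂) h₂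
    exact ⟨_, y, hy, y', hy', hyb, hyb'⟩
  obtain ⟨M, hM⟩ := hM n
  have h42 : ((2⁻¹ : 𝕜) * 2⁻¹) * 4 = 1 := by norm_num
  have hhalf : ∀ x ∈ C n, (2⁻¹ : 𝕜) • x ∈ C n := fun x hx => by
    have h0 : (0 : A n) ∈ C n := by simpa using hC2 n x hx _ (hCn n x hx)
    simpa using hC2 n x hx 0 h0
  let D : A n × A n →+ Complexif B :=
    { toFun := fun x => (i n x.1, i n x.2)
      map_zero' := Prod.ext (map_zero (i n)) (map_zero (i n))
      map_add' := fun x y => Prod.ext (map_add (i n) _ _) (map_add (i n) _ _) }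
  have hD : Continuous D :=
    ((h.continuous_incl n).comp continuous_fst).prodMk ((h.continuous_incl n).comp continuous_snd)
  have hv : v = D ((2⁻¹ * 2⁻¹ : 𝕜) • (y, y')) := by
    refine Prod.ext ?_ ?_
    · change v.1 = i n ((2⁻¹ * 2⁻¹ : 𝕜) • y)
      rw [map_smul, hyb, smul_smul, h42, one_smul]
    · change v.2 = i n ((2⁻¹ * 2⁻¹ : 𝕜) • y')
      rw [map_smul, hyb', smul_smul, h42, one_smul]
  -- The components of a product are sums of two elements of the semigroup, so each must be halved
  -- to return to it. This uses one of the two factors 1/2 in `v = (y + i y') / 4`; the other gives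
  -- the geometric decay.
  have hpow : ∀ k, 1 ≤ k → ∃ x ∈ C n, ∃ x' ∈ C n, D ((2⁻¹ : 𝕜) ^ k • (x, x')) = v ^ k := by
    intro k hk
    induction k, hk using Nat.le_induction with
    | base =>
      refine ⟨_, hhalf y hy, _, hhalf y' hy', ?_⟩
      rw [pow_one v, pow_one, hv, mul_smul]
      rfl
    | succ k _ ih =>
      obtain ⟨x, hx, x', hx', hk⟩ := ih
      refine ⟨_, hC2 n _ (hCm n x hx y hy) _ (hCn n _ (hCm n x' hx' y' hy')),
        _, hC2 n _ (hCm n x hx y' hy') _ (hCm n x' hx' y hy), ?_⟩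
      rw [pow_succ v, ← hk, hv, Complexif.mul_def]
      refine Prod.ext ?_ ?_
      · change i n ((2⁻¹ : 𝕜) ^ (k + 1) • (2⁻¹ : 𝕜) • (x * y + -(x' * y'))) =
          i n ((2⁻¹ : 𝕜) ^ k • x) * i n ((2⁻¹ * 2⁻¹ : 𝕜) • y) -
          i n ((2⁻¹ : 𝕜) ^ k • x') * i n ((2⁻¹ * 2⁻¹ : 𝕜) • y')
        simp only [map_smul, map_add, map_neg, map_mul, smul_mul_assoc, mul_smul_comm]
        module
      · change i n ((2⁻¹ : 𝕜) ^ (k + 1) • (2⁻¹ : 𝕜) • (x * y' + x' * y)) =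
          i n ((2⁻¹ : 𝕜) ^ k • x) * i n ((2⁻¹ * 2⁻¹ : 𝕜) • y') +
          i n ((2⁻¹ : 𝕜) ^ k • x') * i n ((2⁻¹ * 2⁻¹ : 𝕜) • y)
        simp only [map_smul, map_add, map_mul, smul_mul_assoc, mul_smul_comm]
        module
  refine exists_tendsto_geom_sum_of_norm_le D hD (c := max M ‖(1 : A n)‖) fun k => ?_
  rcases k.eq_zero_or_pos with rfl | hk
  · refine ⟨(1, 0), Prod.ext (map_one (i n)) (map_zero (i n)), ?_⟩
    simp [Prod.norm_def]
  · obtain ⟨x, hx, x', hx', hxk⟩ := hpow k hk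
    refine ⟨_, hxk, ?_⟩
    rw [norm_smul, norm_pow, norm_inv, RCLike.norm_ofNat, mul_comm, one_div]
    exact mul_le_mul_of_nonneg_right
      (le_max_of_le_left (max_le (hM x hx) (hM x' hx'))) (by positivity)

end IsLCUnion

/-! ### Differentiability classes -/

section

variable {𝕜 : Type*} [RCLike 𝕜] {E : Type u} [AddCommGroup E] [Module 𝕜 E] [TopologicalSpace E]
  {F : Type v} [AddCommGroup F] [Module 𝕜 F] [TopologicalSpace F] {f : E → F} {U : Set E}

theorem IsKAnalyticOn.isClassOn (h : IsKAnalyticOn 𝕜 f U) : IsClassOn 𝕜 ω f U :=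
  ⟨fun _ => h, fun k hk => absurd hk (by simp)⟩

theorem IsBastianiSmoothOn.isClassOn [IsTopologicalAddGroup E] [ContinuousSMul 𝕜 E] [T2Space F]
    (h : IsBastianiSmoothOn 𝕜 f U) (hU : IsOpen U) : IsClassOn 𝕜 ∞ f U :=
  ⟨fun hr => absurd hr (by simp), fun k _ => h.isKellerCrOn hU k⟩

theorem IsClassOn.isBastianiSmoothOn [IsTopologicalAddGroup E] [ContinuousSMul 𝕜 E]
    [IsTopologicalAddGroup F] [ContinuousSMul 𝕜 F] [PolynormableSpace 𝕜 F] [T2Space F]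
    (h : IsClassOn 𝕜 ∞ f U) (hU : IsOpen U) : IsBastianiSmoothOn 𝕜 f U :=
  (h.2 ⊤ rfl).isBastianiSmoothOn hU

end

/-! ### The Lie group structure on unit groups -/

namespace UnitGrp

section

variable {R : Type*} [Ring R] [TopologicalSpace R] (hU : IsOpen {x : R | IsUnit x})

/-- The atlas is a singleton, so every chart is the inclusion; `e.symm` is meaningful only at units.
-/
theorem chart_spec {e : OpenPartialHomeomorph (UnitGrp R) R}
    (he : letI := UnitGrp.chartedSpace R hU; e ∈ atlas R (UnitGrp R)) :
    e.source = univ ∧ e.target = {x : R | IsUnit x} ∧ (∀ g, e g = g) ∧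
      ∀ x, IsUnit x → (e.symm x : R) = x := by
  have he := eq_of_mem_singleton he
  have h1 : e.source = univ := by rw [he]; rfl
  have h2 : e.target = {x : R | IsUnit x} := by
    rw [he]
    exact (IsOpenEmbedding.toOpenPartialHomeomorph_target _ _).trans Subtype.range_coe
  have h3 : ∀ g, e g = g := fun g => by rw [he]; rfl
  refine ⟨h1, h2, h3, fun x hx => ?_⟩
  have hx : x ∈ e.target := by rw [h2]; exact hx
  rw [← h3, e.right_inv hx]

variable {𝕜 : Type*} [RCLike 𝕜] [Algebra 𝕜 R] [IsTopologicalRing R] [ContinuousSMul 𝕜 R]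

theorem isClassMap_map {r : WithTop ℕ∞} {S : Type*} [Ring S] [TopologicalSpace S]
    [Algebra 𝕜 S] (hS : IsOpen {x : S | IsUnit x}) (f : R →* S) (hf : Continuous f)
    (h : IsClassOn 𝕜 r f {x : R | IsUnit x}) :
    letI := UnitGrp.chartedSpace R hU
    letI := UnitGrp.chartedSpace S hS
    IsClassMap 𝕜 r R S (UnitGrp.map f) := by
  let _ := UnitGrp.chartedSpace R hU
  let _ := UnitGrp.chartedSpace S hS
  refine ⟨IsLCUnion.continuous_unitGrpMap f hf, fun e he e' he' => ?_⟩
  obtain ⟨-, h2, -, h4⟩ := chart_spec hU he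
  obtain ⟨h1', -, h3', -⟩ := chart_spec hS he'
  have hset : {x | x ∈ e.target ∧ UnitGrp.map f (e.symm x) ∈ e'.source} = {x : R | IsUnit x} := by
    ext x; simp [h1', h2]
  rw [hset]
  refine h.congr hU fun x hx => ?_
  rw [h3']
  change f x = f (e.symm x : R)
  rw [h4 x hx]

variable [PolynormableSpace 𝕜 R] [T2Space R]

theorem isLCLieGroup {r : WithTop ℕ∞} (hinv : ContinuousOn Ring.inverse {x : R | IsUnit x})
    (h₁ : IsClassOn 𝕜 r (fun x : R => x) {x : R | IsUnit x})
    (h₂ : IsClassOn 𝕜 r (fun q : R × R => q.1 * q.2) ({x : R | IsUnit x} ×ˢ {x : R | IsUnit x}))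
    (h₃ : IsClassOn 𝕜 r Ring.inverse {x : R | IsUnit x}) :
    letI := UnitGrp.chartedSpace R hU
    IsLCLieGroup 𝕜 r R (UnitGrp R) := by
  let _ := UnitGrp.chartedSpace R hU
  have hG := UnitGrp.isTopologicalGroup hinv
  refine ⟨inferInstance, inferInstance, inferInstance, inferInstance, inferInstance, hG,
    fun e he e' he' => ?_, fun e₁ he₁ e₂ he₂ e he => ?_, continuous_inv, fun e he e' he' => ?_⟩
  · obtain ⟨-, h2, -, h4⟩ := chart_spec hU he
    obtain ⟨h1', -, h3', -⟩ := chart_spec hU he'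
    have hset : {x | x ∈ e.target ∧ e.symm x ∈ e'.source} = {x : R | IsUnit x} := by
      ext x; simp [h1', h2]
    rw [hset]
    refine h₁.congr hU fun x hx => ?_
    change x = e' (e.symm x)
    rw [h3', h4 x hx]
  · obtain ⟨-, h2, -, h4⟩ := chart_spec hU he₁
    obtain ⟨-, h2', -, h4'⟩ := chart_spec hU he₂
    obtain ⟨h1'', -, h3'', -⟩ := chart_spec hU he
    have hset : {x : R × R | x.1 ∈ e₁.target ∧ x.2 ∈ e₂.target ∧
        e₁.symm x.1 * e₂.symm x.2 ∈ e.source} = {x : R | IsUnit x} ×ˢ {x : R | IsUnit x} := by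
      ext x; simp [h1'', h2, h2']
    rw [hset]
    refine h₂.congr (hU.prod hU) fun x hx => ?_
    change x.1 * x.2 = e (e₁.symm x.1 * e₂.symm x.2)
    rw [h3'', Submonoid.coe_mul, h4 _ hx.1, h4' _ hx.2]
  · obtain ⟨-, h2, -, h4⟩ := chart_spec hU he
    obtain ⟨h1', -, h3', -⟩ := chart_spec hU he'
    have hset : {x | x ∈ e.target ∧ (e.symm x)⁻¹ ∈ e'.source} = {x : R | IsUnit x} := by
      ext x; simp [h1', h2]
    rw [hset]
    refine h₃.congr hU fun x hx => ?_
    change Ring.inverse x = e' (e.symm x)⁻¹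
    rw [h3', coe_inv_eq_inverse, h4 x hx]

theorem isLCLieGroup_smooth (hinv : ContinuousOn Ring.inverse {x : R | IsUnit x}) :
    letI := UnitGrp.chartedSpace R hU
    IsLCLieGroup 𝕜 ∞ R (UnitGrp R) :=
  isLCLieGroup hU hinv
    (IsBastianiSmoothOn.isClassOn (fun k => IsBastianiCkOn.continuousLinearMap k
      (ContinuousLinearMap.id 𝕜 R) _) hU)
    (IsBastianiSmoothOn.isClassOn (fun k => isBastianiCkOn_mul k _) (hU.prod hU))
    (IsBastianiSmoothOn.isClassOn (isBastianiCkOn_inverse hU hinv) hU)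

end

end UnitGrp

/-! ### Smoothness of homomorphisms on the union -/

theorem IsLCLieGroup.isOpen_mul_domain {F H : Type*} [TopologicalSpace F] [Group H]
    [TopologicalSpace H] [IsTopologicalGroup H] (e₁ e₂ e : OpenPartialHomeomorph H F) :
    IsOpen {x : F × F | x.1 ∈ e₁.target ∧ x.2 ∈ e₂.target ∧
      e₁.symm x.1 * e₂.symm x.2 ∈ e.source} := by
  have hc : ContinuousOn (fun x : F × F => e₁.symm x.1 * e₂.symm x.2) (e₁.target ×ˢ e₂.target) :=
    (e₁.continuousOn_symm.comp continuous_fst.continuousOn fun x hx => hx.1).mul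
      (e₂.continuousOn_symm.comp continuous_snd.continuousOn fun x hx => hx.2)
  have := hc.isOpen_inter_preimage (e₁.open_target.prod e₂.open_target) e.open_source
  convert this using 1
  ext x
  exact and_assoc.symm

namespace IsLCUnion

section SmoothHom

variable {𝕜 : Type*} [RCLike 𝕜] {A : ℕ → Type*} [∀ n, NormedRing (A n)]
  [∀ n, NormedAlgebra 𝕜 (A n)] [∀ n, CompleteSpace (A n)] {B : Type*} [Ring B] [Algebra 𝕜 B]
  [TopologicalSpace B] {i : ∀ n, A n →ₐ[𝕜] B}
  {F : Type w₁} {H : Type w₂} [AddCommGroup F] [Module 𝕜 F] [TopologicalSpace F]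
  [Group H] [TopologicalSpace H] [ChartedSpace F H]

/-- Each restriction to a step is smooth, hence has a continuous additive derivative at 1. These
agree by uniqueness of derivatives and glue to a map on the union. Here `s` plays the role of the
inverse chart and is prescribed only at units. -/
theorem exists_deriv_at_one (h : IsLCUnion 𝕜 i) (hH : IsLCLieGroup 𝕜 ∞ F H)
    (φ : UnitGrp B →* H) (s : B → UnitGrp B) (hs : ∀ x, IsUnit x → (s x : B) = x)
    (hφ : letI := fun n => UnitGrp.chartedSpace (A n) Units.isOpen
      ∀ n, IsClassMap 𝕜 ∞ (A n) F (φ.comp (UnitGrp.map (i n : A n →* B)))) :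
    ∃ l : B →L[𝕜] F, ∀ z, HasDirDeriv 𝕜 (fun x => chartAt F (1 : H) (φ (s x))) (l z) 1 z := by
  let _ := fun n => UnitGrp.chartedSpace (A n) Units.isOpen
  have := hH.addGroup_model
  have := hH.smul_model
  have := hH.locallyConvex_model
  have := hH.t2_model
  have := h.addGroup
  have := h.smul
  set e₁ := chartAt F (1 : H)
  have key : ∀ n, ∃ dn : A n → F, Continuous dn ∧ (∀ a b, dn (a + b) = dn a + dn b) ∧
      ∀ a, HasDirDeriv 𝕜 (fun x => e₁ (φ (s x))) (dn a) 1 (i n a) := by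
    intro n
    let e := chartAt (A n) (1 : UnitGrp (A n))
    obtain ⟨-, h2, -, h4⟩ := UnitGrp.chart_spec Units.isOpen
      (chart_mem_atlas (A n) (1 : UnitGrp (A n)))
    set S := {x | x ∈ e.target ∧ φ.comp (UnitGrp.map (i n : A n →* B)) (e.symm x) ∈ e₁.source}
    have hS : IsOpen S := e.isOpen_inter_preimage_symm (e₁.open_source.preimage (hφ n).1)
    have hsm := ((hφ n).2 e (chart_mem_atlas _ _) e₁ (chart_mem_atlas _ _)).isBastianiSmoothOn hS
    obtain ⟨df, hdf, hdfs⟩ := hsm.exists_deriv hS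
    have h1S : (1 : A n) ∈ S := by
      refine ⟨by rw [h2]; exact isUnit_one, ?_⟩
      have : e.symm 1 = 1 := Subtype.ext (h4 1 isUnit_one)
      rw [this, map_one]
      exact mem_chart_source F 1
    have hdc := (hdfs 0).continuousOn
    have heq : ∀ x : A n, IsUnit x →
        φ.comp (UnitGrp.map (i n : A n →* B)) (e.symm x) = φ (s (i n x)) := fun x hx => by
      refine congrArg φ (Subtype.ext ?_)
      rw [hs _ (hx.map (i n))]
      exact congrArg (i n) (h4 x hx)
    refine ⟨fun a => df (1, a), ?_, fun a b =>
      dirDeriv_add_of_continuousOn hS (hsm 0).continuousOn hdf hdc h1S a b, fun a => ?_⟩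
    · rw [← continuousOn_univ]
      exact hdc.comp (by fun_prop : Continuous fun a : A n => ((1 : A n), a)).continuousOn
        fun a _ => ⟨h1S, trivial⟩
    · refine Tendsto.congr' ?_ (hdf 1 h1S a)
      filter_upwards [((tendsto_add_smul 𝕜 (1 : A n) a).eventually
        (Units.isOpen.mem_nhds isUnit_one)).filter_mono nhdsWithin_le_nhds] with t ht
      rw [heq _ ht, heq _ isUnit_one]
      simp
  choose d hdc hda hd using key
  have hex : ∀ z : B, ∃ v, HasDirDeriv 𝕜 (fun x => e₁ (φ (s x))) v 1 z := fun z => by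
    obtain ⟨n, a, rfl⟩ := h.exists_eq z
    exact ⟨_, hd n a⟩
  choose l hl using hex
  have hli : ∀ n a, l (i n a) = d n a := fun n a => (hl _).unique (hd n a)
  let L : B →ₗ[𝕜] F :=
    { toFun := l
      map_add' := fun x y => by
        obtain ⟨n, -, a, b, rfl, rfl⟩ := h.exists_common_pair x y 0
        rw [← map_add, hli, hli, hli, hda]
      map_smul' := fun c x => dirDeriv_smul (hl x) (hl (c • x)) }
  refine ⟨⟨L, ?_⟩, hl⟩
  -- Continuity is tested by composing with continuous seminorms of `F`, which reduces it to the
  -- steps.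
  refine continuous_of_continuousAt_zero L ?_
  rw [ContinuousAt, map_zero, (PolynormableSpace.withSeminorms 𝕜 F).tendsto_nhds]
  rintro ⟨p, hp⟩ ε hε
  have hpL : Continuous (p.comp L) := h.continuous_seminorm _ fun n => by
    have : (fun x => (p.comp L) (i n x)) = fun x => p (d n x) := funext fun x =>
      congrArg p (hli n x)
    rw [this]
    exact hp.comp (hdc n)
  have := hpL.tendsto 0
  rw [map_zero] at this
  filter_upwards [this.eventually (gt_mem_nhds hε)] with x hx
  simpa using hx

/-- A homomorphism is determined near `x` by its behaviour near 1. Its derivative is therefore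
expressible through the homomorphism itself and smooth data, and regularity bootstraps from
continuity. -/
theorem isClassMap_hom (h : IsLCUnion 𝕜 i) [T2Space B] (hU : IsOpen {b : B | IsUnit b})
    (hH : IsLCLieGroup 𝕜 ∞ F H) (φ : UnitGrp B →* H)
    (hφ : letI := fun n => UnitGrp.chartedSpace (A n) Units.isOpen
      ∀ n, IsClassMap 𝕜 ∞ (A n) F (φ.comp (UnitGrp.map (i n : A n →* B)))) :
    letI := UnitGrp.chartedSpace B hU
    IsClassMap 𝕜 ∞ B F φ := by
  let _ := UnitGrp.chartedSpace B hU
  have := hH.addGroup_model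
  have := hH.smul_model
  have := hH.locallyConvex_model
  have := hH.t2_model
  have := hH.topGroup
  have := h.isTopologicalRing
  have := h.smul
  have := h.polynormable
  have hinv := h.hasRingSeminormBasis.continuousOn_inverse
  have hφc : Continuous φ := h.continuous_hom φ fun n => (hφ n).1
  refine ⟨hφc, fun e he e' he' => ?_⟩
  obtain ⟨-, h2, -, hs⟩ := UnitGrp.chart_spec hU he
  have hΩ : IsOpen {x | x ∈ e.target ∧ φ (e.symm x) ∈ e'.source} :=
    e.isOpen_inter_preimage_symm (e'.open_source.preimage hφc)
  refine IsBastianiSmoothOn.isClassOn ?_ hΩ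
  set Ω := {x | x ∈ e.target ∧ φ (e.symm x) ∈ e'.source}
  obtain ⟨l, hl⟩ := h.exists_deriv_at_one hH φ e.symm hs hφ
  set e₁ := chartAt F (1 : H)
  have hΩu : Ω ⊆ {x | IsUnit x} := fun x hx => h2 ▸ hx.1
  have hSm := IsLCLieGroup.isOpen_mul_domain e' e₁ e'
  have hm := (hH.mul e' he' e₁ (chart_mem_atlas _ _) e' he').isBastianiSmoothOn hSm
  set Sm := {x : F × F | x.1 ∈ e'.target ∧ x.2 ∈ e₁.target ∧ e'.symm x.1 * e₁.symm x.2 ∈ e'.source}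
  obtain ⟨dm, hdm, hdms⟩ := hm.exists_deriv hSm
  have h1s : (1 : H) ∈ e₁.source := mem_chart_source F 1
  have hmem : ∀ x ∈ Ω, (e' (φ (e.symm x)), e₁ 1) ∈ Sm := fun x hx =>
    ⟨e'.map_source hx.2, e₁.map_source h1s, by
      simpa [e'.left_inv hx.2, e₁.left_inv h1s] using hx.2⟩
  have hs1 : e.symm 1 = 1 := Subtype.ext (hs 1 isUnit_one)
  -- With `z = x⁻¹ y`, one has `φ (x + t y) = φ x * φ (1 + t z)`; the chain rule differentiates
  -- multiplication in charts at `(φ x, 1)` in direction `(0, l z)`.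
  have hderiv : ∀ x ∈ Ω, ∀ y, HasDirDeriv 𝕜 (fun x => e' (φ (e.symm x)))
      (dm ((e' (φ (e.symm x)), e₁ 1), (0, l (Ring.inverse x * y)))) x y := by
    intro x hx y
    have hxu : IsUnit x := hΩu hx
    set z := Ring.inverse x * y
    have hg : HasDirDeriv 𝕜 (fun b : B => (e' (φ (e.symm x)), e₁ (φ (e.symm b)))) (0, l z) 1 z := by
      have h0 : Tendsto (fun t : 𝕜 => t⁻¹ • (e' (φ (e.symm x)) - e' (φ (e.symm x))))
          (𝓝[≠] 0) (𝓝 0) := by simp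
      exact h0.prodMk_nhds (hl z)
    have hcomp := IsBastianiCkOn.hasDirDeriv_comp (g := fun b : B =>
      (e' (φ (e.symm x)), e₁ (φ (e.symm b)))) hSm (hm 0).continuousOn hdm (hdms 0).continuousOn
      (by simpa only [hs1, map_one] using hmem x hx) hg
    simp only [hs1, map_one] at hcomp
    refine Tendsto.congr' ?_ hcomp
    have hopen : IsOpen {b | b ∈ e.target ∧ φ (e.symm b) ∈ e₁.source} :=
      e.isOpen_inter_preimage_symm (e₁.open_source.preimage hφc)
    have h1mem : (1 : B) ∈ {b | b ∈ e.target ∧ φ (e.symm b) ∈ e₁.source} :=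
      ⟨by rw [h2]; exact isUnit_one, by rw [hs1, map_one]; exact h1s⟩
    filter_upwards [((tendsto_add_smul 𝕜 (1 : B) z).eventually
      (hopen.mem_nhds h1mem)).filter_mono nhdsWithin_le_nhds] with t ht
    have htu : IsUnit (1 + t • z) := by
      have := ht.1; rwa [h2] at this
    have hprod : x + t • y = x * (1 + t • z) := by
      rw [mul_add, mul_one, mul_smul_comm, ← mul_assoc, Ring.mul_inverse_cancel _ hxu, one_mul]
    have hsp : e.symm (x + t • y) = e.symm x * e.symm (1 + t • z) := by
      refine Subtype.ext ?_
      rw [Submonoid.coe_mul, hs x hxu, hs _ htu, hprod, hs _ (hxu.mul htu)]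
    simp only [hs1, map_one, hsp, map_mul, e'.left_inv hx.2, e₁.left_inv ht.2, e₁.left_inv h1s,
      mul_one]
  intro k
  induction k with
  | zero =>
    refine e'.continuousOn.comp (hφc.comp_continuousOn
      (e.continuousOn_symm.mono fun x hx => hx.1)) fun x hx => hx.2
  | succ k ih =>
    refine ⟨ih.continuousOn, fun q =>
      dm ((e' (φ (e.symm q.1)), e₁ 1), (0, l (Ring.inverse q.1 * q.2))), hderiv, ?_⟩
    have hfst : IsBastianiCkOn 𝕜 k (fun q : B × B => e' (φ (e.symm q.1))) (Ω ×ˢ univ) :=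
      ih.comp_continuousLinearMap (ContinuousLinearMap.fst 𝕜 B B) fun q hq => hq.1
    have hinvq : IsBastianiCkOn 𝕜 k (fun q : B × B => Ring.inverse q.1) (Ω ×ˢ univ) :=
      ((isBastianiCkOn_inverse hU hinv k).mono hΩu).comp_continuousLinearMap
        (ContinuousLinearMap.fst 𝕜 B B) fun q hq => hq.1
    have hsnd : IsBastianiCkOn 𝕜 k (fun q : B × B => q.2) (Ω ×ˢ univ) :=
      IsBastianiCkOn.continuousLinearMap k (ContinuousLinearMap.snd 𝕜 B B) _
    have hl' := ((isBastianiCkOn_mul (𝕜 := 𝕜) k univ).comp (hinvq.prodMk hsnd) isOpen_univ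
      (mapsTo_univ _ _)).continuousLinearMap_comp l
    -- All ingredients of the derivative formula are of class `C^k`: the homomorphism in charts by
    -- the induction hypothesis, and `l (x⁻¹ y)` by smoothness of the algebra operations.
    exact (hdms k).comp ((hfst.prodMk (IsBastianiCkOn.const k (e₁ 1) _)).prodMk
      ((IsBastianiCkOn.const k (0 : F) _).prodMk hl')) (hSm.prod isOpen_univ)
      fun q hq => ⟨hmem q.1 hq.1, trivial⟩

end SmoothHom

end IsLCUnion

/-! ### The main theorem -/

theorem proposition12p1 {𝕜 : Type*} [RCLike 𝕜]
    -- a sequence of unital Banach algebras with continuous unital inclusions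
    {A : ℕ → Type*} [∀ n, NormedRing (A n)] [∀ n, NormedAlgebra 𝕜 (A n)] [∀ n, CompleteSpace (A n)]
    (j : ∀ n, A n →ₐ[𝕜] A (n + 1)) (hj : ∀ n, Continuous (j n))
    -- the union of the sequence, with the locally convex direct limit topology
    {B : Type*} [Ring B] [Algebra 𝕜 B] [tB : TopologicalSpace B]
    (i : ∀ n, A n →ₐ[𝕜] B) (hi : ∀ n, Function.Injective (i n))
    (hij : ∀ n x, i (n + 1) (j n x) = i n x) (hB : ∀ b : B, ∃ n x, i n x = b)
    (htB : tB = lcDirectLimitTopology 𝕜 (fun n => (i n).toLinearMap)) :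
    -- (a)
    (IsTopologicalRing B ∧ IsLocallyMConvex 𝕜 B ∧
      {b : B | IsUnit b} = ⋃ n, i n '' {x : A n | IsUnit x} ∧
      IsOpen {b : B | IsUnit b} ∧ IsTopologicalGroup (UnitGrp B)) ∧
    -- (b)
    IsTopGroupDirectLimit.{w}
      (fun n => UnitGrp.map (j n : A n →* A (n + 1))) (fun n => UnitGrp.map (i n : A n →* B)) ∧
    -- (c)
    (ProductSetsLarge (fun n => UnitGrp.map (i n : A n →* B)) ∧
      SatisfiesPTA (fun n => UnitGrp.map (i n : A n →* B))) ∧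
    -- strictness implies that the limit is Hausdorff
    ((∀ n, IsEmbedding (j n)) → T2Space B) ∧
    -- the Lie group structure, for which the inclusion into the algebra is a global chart
    (T2Space B → ∃ hU : IsOpen {b : B | IsUnit b},
      letI := UnitGrp.chartedSpace B hU
      letI := fun n => UnitGrp.chartedSpace (A n) Units.isOpen
      IsLCLieGroup 𝕜 ω B (UnitGrp B) ∧
      IsLieGroupDirectLimit.{w₁, w₂} 𝕜 A B
        (fun n => UnitGrp.map (j n : A n →* A (n + 1)))
        (fun n => UnitGrp.map (i n : A n →* B))) := by
  have h := IsLCUnion.of_lcDirectLimitTopology j hj i hi hij hB htB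
  refine ⟨⟨h.isTopologicalRing, h.isLocallyMConvex, h.isUnit_eq_iUnion, h.isOpen_isUnit,
    h.isTopologicalGroup⟩, h.isTopGroupDirectLimit j hj hij, ⟨h.productSetsLarge, h.satisfiesPTA⟩,
    fun hemb => h.t2Space_of_isEmbedding j hij hemb, fun _ => ⟨h.isOpen_isUnit, ?_⟩⟩
  let _ := UnitGrp.chartedSpace B h.isOpen_isUnit
  let _ := fun n => UnitGrp.chartedSpace (A n) Units.isOpen
  have := h.isTopologicalRing
  have := h.smul
  have := h.polynormable
  have hinv := h.hasRingSeminormBasis.continuousOn_inverse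
  have hcone : ∀ n, (UnitGrp.map (i (n + 1) : A (n + 1) →* B)).comp
      (UnitGrp.map (j n : A n →* A (n + 1))) = UnitGrp.map (i n : A n →* B) := fun n =>
    MonoidHom.ext fun x => Subtype.ext (hij n x)
  refine ⟨UnitGrp.isLCLieGroup h.isOpen_isUnit hinv (isKAnalyticOn_id _).isClassOn
    (isKAnalyticOn_mul _).isClassOn (isKAnalyticOn_inverse h.hasRingSeminormBasis
      h.hasGeomSeriesNhds h.hasGeomSeriesNhds_complexif).isClassOn,
    fun n => UnitGrp.isLCLieGroup_smooth Units.isOpen (continuousOn_inverse_of_normed (A n)),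
    UnitGrp.isLCLieGroup_smooth h.isOpen_isUnit hinv, fun n => ?_, fun n => ?_, hcone,
    fun F H _ _ _ _ _ _ hH ψ hψ hψj => ?_⟩
  · exact UnitGrp.isClassMap_map Units.isOpen Units.isOpen _ (hj n)
      (IsBastianiSmoothOn.isClassOn (fun k => IsBastianiCkOn.continuousLinearMap k
        ⟨(j n).toLinearMap, hj n⟩ _) Units.isOpen)
  · exact UnitGrp.isClassMap_map Units.isOpen h.isOpen_isUnit _ (h.continuous_incl n)
      (IsBastianiSmoothOn.isClassOn (fun k => IsBastianiCkOn.continuousLinearMap k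
        ⟨(i n).toLinearMap, h.continuous_incl n⟩ _) Units.isOpen)
  · obtain ⟨φ, hφ, huniq⟩ := h.exists_unique_hom j hij ψ hψj
    refine ⟨φ, ⟨h.isClassMap_hom h.isOpen_isUnit hH φ fun n => ?_, hφ⟩, fun φ' h' => huniq φ' h'.2⟩
    rw [hφ n]
    exact hψ n
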